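/- For $f:\mathbb R\to\mathbb C$ put $\widehat f(\xi)=\int f(x)e^{-i\xi x}\,dx$ and $\langle f,g\rangle=\int f\,\overline g$. For a dyadic interval $I=[n2^k,(n+1)2^k)$, $k,n\in\mathbb Z$, with length $|I|=2^k$ and centre $c(I)$, put $f_I(x)=|I|^{-1/2}f\big((x-c(I))/|I|\big)$; let $\mathcal D$ be the set of all dyadic intervals. Let $w$ be a Meyer wavelet: a Schwartz function with $\widehat w$ supported in $\tfrac{2\pi}{3}\le|\xi|\le\tfrac{8\pi}{3}$ such that $\{w_I: I\in\mathcal D\}$ is an orthonormal basis of $L^2(\mathbb R)$. Let $u$ be its antianalytic part, i.e. $\widehat u=\mathbf 1_{(-\infty,0)}\widehat w$, and for $j\in\mathbb Z$ set $$\Delta \mathrm U_j f=\sum_{I\in\mathcal D,\ |I|=2^j}\langle f,u_I\rangle u_I,\qquad \mathrm U_j f=\sum_{k\ge j}\Delta \mathrm U_k f .$$ Let $\mathrm{BMO}(\mathbb R)$ be the space of measurable $b:\mathbb R\to\mathbb C$ with $\int |b(x)|(1+x^2)^{-1}dx<\infty$ and $$\|b\|_{\mathrm{BMO}(\mathbb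 R)}=\sup_{J}\Big[\frac1{|J|}\sum_{I\in\mathcal D,\ I\subset J}|\langle b,w_I\rangle|^2\Big]^{1/2}<\infty,$$ the supremum being over all bounded intervals $J$ of positive length. Then there is a constant $C$, depending only on $w$, such that for all $b\in\mathrm{BMO}(\mathbb R)$ and all $\varphi\in L^2(\mathbb R)$ the sums that define $\Delta\mathrm U_j b$, $\Delta\mathrm U_j\varphi$ and $\mathrm U_j\varphi$ converge absolutely at every point, each product $(\Delta \mathrm U_j b)\,\overline{\mathrm U_j\varphi}$ is in $L^2(\mathbb R)$, the series $\sum_{j\in\mathbb Z}(\Delta \mathrm U_j b)\,\overline{\mathrm U_j\varphi}$ converges unconditionally in $L^2(\mathbb R)$, and $$\Big\|\sum_{j\in\mathbb Z}(\Delta \mathrm U_j b)\cdot\overline{\mathrm U_j\varphi}\Big\|_2\le C\,\|b\|_{\mathrm{BMO}(\mathbb R)}\,\|\varphi\|_2 .$$ -/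

import Mathlib

open MeasureTheory
open scoped ENNReal NNReal FourierTransform ComplexConjugate SchwartzMap

noncomputable section

namespace MeyerPara

/-- The pair `I = (k, n)` labels the dyadic interval `[n 2^k, (n+1) 2^k)`. -/
abbrev Dyadic : Type := ℤ × ℤ

/-- The length `|I| = 2^k`. -/
def len (I : Dyadic) : ℝ := (2 : ℝ) ^ I.1

/-- The centre `c(I)`. -/
def center (I : Dyadic) : ℝ := ((I.2 : ℝ) + 1 / 2) * (2 : ℝ) ^ I.1

/-- The dyadic interval itself, as a set of reals. -/
def interval (I : Dyadic) : Set ℝ :=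
  Set.Ico ((I.2 : ℝ) * (2 : ℝ) ^ I.1) (((I.2 : ℝ) + 1) * (2 : ℝ) ^ I.1)

/-- The `L²`-normalized dilate `f_I(x) = |I|^{-1/2} f((x - c(I)) / |I|)`. -/
def dil (f : ℝ → ℂ) (I : Dyadic) (x : ℝ) : ℂ :=
  (((Real.sqrt (len I))⁻¹ : ℝ) : ℂ) * f ((x - center I) / len I)

/-- The pairing `⟨f, g⟩ = ∫ f conj(g)`, linear in the first argument. -/
def pair (f g : ℝ → ℂ) : ℂ := ∫ x, f x * conj (g x)

/-- The antianalytic part `P₋ f`: the restriction of `f` to negative frequencies. -/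
def antianalytic (f : ℝ → ℂ) : ℝ → ℂ :=
  𝓕⁻ (Set.indicator (Set.Iio (0 : ℝ)) (𝓕 f))

/-- `w` is a Meyer wavelet: a Schwartz function whose Fourier transform
`ŵ(ξ) = ∫ w(x) e^{-iξx} dx` (in Mathlib's normalization, `𝓕 w (ξ / (2π))`) is supported in
`2π/3 ≤ |ξ| ≤ 8π/3`, and whose dilates `w_I`, `I` dyadic, are an orthonormal basis of `L²(ℝ)`. -/
structure IsMeyerWavelet (w : 𝓢(ℝ, ℂ)) : Prop where
  fourier_support : ∀ ξ : ℝ, 𝓕 (⇑w) (ξ / (2 * Real.pi)) ≠ 0 →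
    2 * Real.pi / 3 ≤ |ξ| ∧ |ξ| ≤ 8 * Real.pi / 3
  orthonormal_basis : ∃ B : HilbertBasis Dyadic ℂ (Lp ℂ 2 (volume : Measure ℝ)),
    ∀ I : Dyadic, (B I : ℝ → ℂ) =ᵐ[volume] dil w I

/-- The BMO norm in terms of wavelet coefficients: the supremum over all intervals
`J = [α, β]` of `(|J|⁻¹ ∑_{I ⊆ J} |⟨b, w_I⟩|²)^{1/2}`. -/
def bmoNorm (w b : ℝ → ℂ) : ℝ≥0∞ :=
  ⨆ (α : ℝ) (β : ℝ) (_ : α < β),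
    ((ENNReal.ofReal (β - α))⁻¹ *
      ∑' I : {I : Dyadic // interval I ⊆ Set.Icc α β}, ‖pair b (dil w I)‖ₑ ^ 2) ^ (1 / 2 : ℝ)

/-- `b ∈ BMO(ℝ)`. The integrability condition, which every function of bounded mean
oscillation satisfies, gives a meaning to the wavelet coefficients of `b`. -/
structure MemBMO (w b : ℝ → ℂ) : Prop where
  integrable_weight : Integrable (fun x : ℝ => b x / ((1 + x ^ 2 : ℝ) : ℂ)) volume
  norm_lt_top : bmoNorm w b < ∞

/-- `ΔU_j f = ∑_{|I| = 2^j} ⟨f, u_I⟩ u_I`, where `u = P₋ w`. -/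
def deltaU (w : ℝ → ℂ) (j : ℤ) (f : ℝ → ℂ) (x : ℝ) : ℂ :=
  ∑' n : ℤ, pair f (dil (antianalytic w) (j, n)) * dil (antianalytic w) (j, n) x

/-- `U_j f = ∑_{k ≥ j} ΔU_k f`. -/
def opU (w : ℝ → ℂ) (j : ℤ) (f : ℝ → ℂ) (x : ℝ) : ℂ :=
  ∑' k : {k : ℤ // j ≤ k}, deltaU w k f x

/-- The `j`-th term `(ΔU_j b) · conj(U_j φ)` of the paraproduct. -/
def term (w b φ : ℝ → ℂ) (j : ℤ) (x : ℝ) : ℂ :=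
  deltaU w j b x * conj (opU w j φ x)

end MeyerPara

end

noncomputable section

namespace MeyerPara

/-! With frequencies normalized by `e^{-2πixξ}`, a dilate `u_I` with `|I| = 2^j` lives in `1/3 <
-2^j ξ < 4/3`. Split `U_j φ = ∑_{i<4} ΔU_{j+i} φ + U_{j+4} φ`. The paraproduct becomes four
near-diagonal sums and one separated sum.

Separated sum: the factor `conj (U_{j+4} φ)` has frequencies in `[0, 2^{-j}/12]`, too small to move
`ΔU_j b` near zero, so the product keeps its frequency at height about `2^{-j}`. Products at scales
three or more apart are therefore orthogonal (`pair_deltaU_mul_opU_eq_zero`), and it suffices to sum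
the squared norms. Pointwise, `U_{j+4} φ` is a smooth average of `P₋ φ` at scale `2^j` plus two
boundary scales (`opU_eq_lowpass`, `exists_opU_bound`), and `ΔU_j b` is controlled by a sequence
whose squares satisfy a packing condition. The Carleson embedding theorem (`IsCarleson.tsum_avg_le`)
bounds the averages, Bessel's inequality the boundary scales.

Near-diagonal sums: the frequencies may cancel, so there is no orthogonality. A finite partial sum
`X` is paired with itself. Each term is at most `2^{-j} a d` on a dyadic interval, with `a²`
Carleson and `d` square summable, so Cauchy–Schwarz leaves `∑ a² (avg |X|)²`, and the embedding
theorem gives `‖X‖² ≤ 4K ∑ d²` (`IsCarleson.sq_enorm_sum_le`).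

The hypothesis on `b` concerns `⟨b, w_I⟩`, while the operators use `⟨b, u_I⟩`. The matrix `⟨u_I,
w_{I'}⟩` vanishes unless the scales are equal or adjacent, and decays rapidly in position. Packing
survives translation, passage to parents and to children with at most linear loss in the
translation, so it passes to `⟨b, u_I⟩` (`exists_isCarleson_coeff`). Since `b` is only integrable
against `(1+x²)⁻¹`, expanding `⟨b, u_I⟩` in wavelets needs a weighted majorant
(`exists_summable_majorant`).

Both kinds of sum bound every finite partial sum by a summable sequence of squares, which yields
unconditional convergence along with the estimate. -/

/-! ### Carleson sequences on the dyadic tree -/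

/-- The sum of `a` over the descendants of `(k, n)` that are `d` generations below it. -/
def levelSum {M : Type*} [AddCommMonoid M] (a : ℤ → ℤ → M) (d : ℕ) (k n : ℤ) : M :=
  ∑ m ∈ Finset.Ico (2 ^ d * n) (2 ^ d * (n + 1)), a (k - d) m

/-- The length `2^k` as an extended nonnegative real. -/
def vol (k : ℤ) : ℝ≥0∞ := ENNReal.ofReal ((2 : ℝ) ^ k)

/-- The packing condition `∑_{I ⊆ J} a_I ≤ K |J|` for all dyadic `J`. -/
def IsCarleson (a : ℤ → ℤ → ℝ≥0∞) (K : ℝ≥0∞) : Prop :=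
  ∀ (N : ℕ) (k n : ℤ), ∑ d ∈ Finset.range N, levelSum a d k n ≤ K * vol k

lemma vol_pos (k : ℤ) : 0 < vol k := ENNReal.ofReal_pos.2 (by positivity)

lemma vol_ne_zero (k : ℤ) : vol k ≠ 0 := (vol_pos k).ne'

lemma vol_ne_top (k : ℤ) : vol k ≠ ∞ := ENNReal.ofReal_ne_top

lemma vol_sub_one (k : ℤ) : vol (k - 1) + vol (k - 1) = vol k := by
  unfold vol
  rw [← ENNReal.ofReal_add (by positivity) (by positivity), zpow_sub_one₀ (by norm_num)]
  congr 1; ring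

section levelSum
variable {M : Type*} [AddCommMonoid M]

lemma levelSum_zero (a : ℤ → ℤ → M) (k n : ℤ) : levelSum a 0 k n = a k n := by
  have : Finset.Ico n (n + 1) = {n} := by ext; simp; lia
  simp [levelSum, this]

lemma levelSum_succ (a : ℤ → ℤ → M) (d : ℕ) (k n : ℤ) :
    levelSum a (d + 1) k n = levelSum a d (k - 1) (2 * n) + levelSum a d (k - 1) (2 * n + 1) := by
  have h1 : (2 : ℤ) ^ (d + 1) * n = 2 ^ d * (2 * n) := by ring
  have h2 : (2 : ℤ) ^ (d + 1) * (n + 1) = 2 ^ d * (2 * n + 1 + 1) := by ring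
  have h3 : k - ((d + 1 : ℕ) : ℤ) = k - 1 - d := by push_cast; ring
  have hp : (0 : ℤ) < 2 ^ d := by positivity
  simp only [levelSum, h1, h2, h3]
  rw [← Finset.sum_union]
  · congr 1
    rw [Finset.Ico_union_Ico_eq_Ico] <;> nlinarith
  · exact Finset.Ico_disjoint_Ico_consecutive _ _ _

end levelSum

lemma levelSum_mono {a a' : ℤ → ℤ → ℝ≥0∞} (h : ∀ k n, a k n ≤ a' k n) (d : ℕ) (k n : ℤ) :
    levelSum a d k n ≤ levelSum a' d k n := Finset.sum_le_sum fun _ _ => h _ _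

lemma mem_Ico_iff_ediv (d : ℕ) (n m : ℤ) :
    m ∈ Finset.Ico (2 ^ d * n) (2 ^ d * (n + 1)) ↔ m / 2 ^ d = n := by
  have hp : (0 : ℤ) < 2 ^ d := by positivity
  rw [Finset.mem_Ico, Int.ediv_eq_iff_of_pos hp]
  constructor <;> rintro ⟨h1, h2⟩ <;> constructor <;> nlinarith

lemma tsum_levelSum (a : ℤ → ℤ → ℝ≥0∞) (d : ℕ) (k : ℤ) :
    ∑' n, levelSum a d k n = ∑' m, a (k - d) m := by
  have h : ∀ n, levelSum a d k n = ∑' m : ℤ, if m / 2 ^ d = n then a (k - d) m else 0 := by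
    intro n
    rw [levelSum, tsum_eq_sum (s := Finset.Ico (2 ^ d * n) (2 ^ d * (n + 1)))]
    · exact Finset.sum_congr rfl fun m hm => by rw [if_pos ((mem_Ico_iff_ediv d n m).1 hm)]
    · intro m hm
      rw [if_neg (fun h => hm ((mem_Ico_iff_ediv d n m).2 h))]
  simp_rw [h]
  rw [ENNReal.tsum_comm]
  simp

namespace IsCarleson
variable {a : ℤ → ℤ → ℝ≥0∞} {K : ℝ≥0∞}

lemma mono {a' : ℤ → ℤ → ℝ≥0∞} {K' : ℝ≥0∞} (ha : IsCarleson a K) (h : ∀ k n, a' k n ≤ a k n)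
    (hK : K ≤ K') : IsCarleson a' K' := fun N k n =>
  (Finset.sum_le_sum fun d _ => levelSum_mono h d k n).trans ((ha N k n).trans (by gcongr))

lemma apply_le (ha : IsCarleson a K) (k n : ℤ) : a k n ≤ K * vol k := by
  simpa [levelSum_zero] using ha 1 k n

lemma tsum {ι : Type*} {a : ι → ℤ → ℤ → ℝ≥0∞} {K c : ι → ℝ≥0∞} (ha : ∀ i, IsCarleson (a i) (K i)) :
    IsCarleson (fun k n => ∑' i, c i * a i k n) (∑' i, c i * K i) := by
  intro N k n
  have : ∑ d ∈ Finset.range N, levelSum (fun k n => ∑' i, c i * a i k n) d k n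
      = ∑' i, c i * ∑ d ∈ Finset.range N, levelSum (a i) d k n := by
    simp only [levelSum, Finset.mul_sum]
    rw [Summable.tsum_finsetSum (fun _ _ => ENNReal.summable)]
    refine Finset.sum_congr rfl fun d _ => ?_
    rw [Summable.tsum_finsetSum (fun _ _ => ENNReal.summable)]
  rw [this, ← ENNReal.tsum_mul_right]
  refine ENNReal.tsum_le_tsum fun i => ?_
  rw [mul_assoc]
  gcongr
  exact ha i N k n

lemma add {a' : ℤ → ℤ → ℝ≥0∞} {K' : ℝ≥0∞} (ha : IsCarleson a K) (ha' : IsCarleson a' K') :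
    IsCarleson (fun k n => a k n + a' k n) (K + K') := by
  intro N k n
  simp only [levelSum, Finset.sum_add_distrib, add_mul]
  exact add_le_add (ha N k n) (ha' N k n)

lemma const_mul (ha : IsCarleson a K) (c : ℝ≥0∞) : IsCarleson (fun k n => c * a k n) (c * K) := by
  intro N k n
  simp only [levelSum, ← Finset.mul_sum, mul_assoc]
  gcongr
  exact ha N k n

/-- Descendants of an interval, translated by `t` of their own lengths, move by at most `|t|`
lengths of the ancestor. They lie under `2|t| + 1` neighbours of it, each satisfying the packing
bound. -/
lemma shift (ha : IsCarleson a K) (t : ℤ) :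
    IsCarleson (fun k n => a k (n + t)) ((2 * |t| + 1 : ℤ).toNat * K) := by
  intro N k n
  have key : ∀ d, levelSum (fun k n => a k (n + t)) d k n
      ≤ ∑ i ∈ Finset.Icc (n - |t|) (n + |t|), levelSum a d k i := by
    intro d
    have hp : (1 : ℤ) ≤ 2 ^ d := one_le_pow₀ (by norm_num)
    have h1 : levelSum (fun k n => a k (n + t)) d k n
        = ∑ m ∈ (Finset.Ico (2 ^ d * n) (2 ^ d * (n + 1))).image (· + t), a (k - d) m := by
      rw [Finset.sum_image (fun x _ y _ h => by simpa using h)]; rfl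
    rw [h1]
    unfold levelSum
    rw [← Finset.sum_biUnion]
    · refine Finset.sum_le_sum_of_subset fun m hm => ?_
      rw [Finset.mem_image] at hm
      obtain ⟨m', hm', rfl⟩ := hm
      rw [Finset.mem_Ico] at hm'
      rw [Finset.mem_biUnion]
      refine ⟨(m' + t) / 2 ^ d, ?_, (mem_Ico_iff_ediv d _ _).2 rfl⟩
      have := neg_abs_le t
      have := le_abs_self t
      have := abs_nonneg t
      rw [Finset.mem_Icc]
      constructor
      · rw [Int.le_ediv_iff_mul_le (by positivity)]
        nlinarith
      · rw [← Int.lt_add_one_iff, Int.ediv_lt_iff_lt_mul (by positivity)]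
        nlinarith
    · intro i _ j _ hij
      rw [Function.onFun, Finset.disjoint_left]
      intro m hm hm'
      rw [mem_Ico_iff_ediv] at hm hm'
      exact hij (hm.symm.trans hm')
  calc _ ≤ ∑ d ∈ Finset.range N, ∑ i ∈ Finset.Icc (n - |t|) (n + |t|), levelSum a d k i :=
        Finset.sum_le_sum fun d _ => key d
    _ = ∑ i ∈ Finset.Icc (n - |t|) (n + |t|), ∑ d ∈ Finset.range N, levelSum a d k i :=
        Finset.sum_comm
    _ ≤ ∑ i ∈ Finset.Icc (n - |t|) (n + |t|), K * vol k := Finset.sum_le_sum fun i _ => ha N k i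
    _ = _ := by
        rw [Finset.sum_const, nsmul_eq_mul, Int.card_Icc, mul_assoc]
        congr 3; ring

/-- Strictly below the root every entry is counted twice, once per child, which costs `2K`. The root
contributes its own parent, bounded by `K` times twice the length: another `2K`. -/
lemma parent (ha : IsCarleson a K) : IsCarleson (fun k n => a (k + 1) (n / 2)) (4 * K) := by
  have key : ∀ (d : ℕ) (k n : ℤ), levelSum (fun k n => a (k + 1) (n / 2)) (d + 1) k n
      = 2 * levelSum a d k n := by
    intro d
    induction d with
    | zero =>
      intro k n
      rw [levelSum_succ]
      simp only [levelSum_zero, sub_add_cancel, two_mul (a k n)]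
      congr 2 <;> lia
    | succ d ih =>
      intro k n
      rw [levelSum_succ, ih, ih, ← mul_add, ← levelSum_succ]
  intro N k n
  have h0 : a (k + 1) (n / 2) ≤ 2 * K * vol k := by
    refine (ha.apply_le _ _).trans_eq ?_
    rw [← vol_sub_one (k + 1), add_sub_cancel_right]; ring
  calc _ ≤ ∑ d ∈ Finset.range (N + 1), levelSum (fun k n => a (k + 1) (n / 2)) d k n :=
        Finset.sum_le_sum_of_subset (by simp)
    _ = 2 * ∑ d ∈ Finset.range N, levelSum a d k n + a (k + 1) (n / 2) := by
        rw [Finset.sum_range_succ', levelSum_zero, Finset.mul_sum]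
        simp_rw [key]
    _ ≤ 2 * (K * vol k) + 2 * K * vol k := by gcongr; exact ha N k n
    _ = _ := by ring

lemma child (ha : IsCarleson a K) : IsCarleson (fun k n => a (k - 1) (2 * n)) K := by
  have key : ∀ (d : ℕ) (k n : ℤ), levelSum (fun k n => a (k - 1) (2 * n)) d k n
      ≤ levelSum a (d + 1) k n := by
    intro d
    induction d with
    | zero =>
      intro k n
      rw [levelSum_succ]
      simp only [levelSum_zero]
      exact le_self_add
    | succ d ih =>
      intro k n
      rw [levelSum_succ, levelSum_succ a]
      exact add_le_add (ih _ _) (ih _ _)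
  intro N k n
  refine le_trans ?_ (ha (N + 1) k n)
  rw [Finset.sum_range_succ']
  exact (Finset.sum_le_sum fun d _ => key d k n).trans le_self_add

end IsCarleson

/-! ### The dyadic Carleson embedding theorem -/

/-- Two effects: `(G, L) ↦ G²/L` is subadditive, which merges the two children; and adding `a` to
the denominator lowers `4G²/(2L + A)` by at least `a (G/2L)²`, because packing keeps the
denominators below `4L`. This is the source of the constant 4. -/
lemma bellman_step {L G₁ G₂ A₁ A₂ a : ℝ} (hL : 0 < L) (hA₁ : 0 ≤ A₁) (hA₂ : 0 ≤ A₂) (ha : 0 ≤ a)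
    (h : A₁ + A₂ + a ≤ 2 * L) :
    a * ((G₁ + G₂) / (2 * L)) ^ 2 + 4 * ((G₁ + G₂) ^ 2 / (2 * L + (A₁ + A₂ + a)))
      ≤ 4 * (G₁ ^ 2 / (L + A₁)) + 4 * (G₂ ^ 2 / (L + A₂)) := by
  have h1 : (G₁ + G₂) ^ 2 / (2 * L + (A₁ + A₂)) ≤ G₁ ^ 2 / (L + A₁) + G₂ ^ 2 / (L + A₂) := by
    rw [div_add_div _ _ (by positivity) (by positivity), div_le_div_iff₀ (by positivity)
      (by positivity)]
    nlinarith [sq_nonneg (G₁ * (L + A₂) - G₂ * (L + A₁))]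
  have h2 : a * ((G₁ + G₂) / (2 * L)) ^ 2 + 4 * ((G₁ + G₂) ^ 2 / (2 * L + (A₁ + A₂ + a)))
      ≤ 4 * ((G₁ + G₂) ^ 2 / (2 * L + (A₁ + A₂))) := by
    set G := (G₁ + G₂) ^ 2 with hG
    set B := A₁ + A₂
    have hB : 0 ≤ B := by positivity
    have hG0 : 0 ≤ G := sq_nonneg _
    have e : 4 * (G / (2 * L + B)) - 4 * (G / (2 * L + (B + a)))
        = 4 * (G * a / ((2 * L + B) * (2 * L + (B + a)))) := by field_simp; ring
    have e2 : a * ((G₁ + G₂) / (2 * L)) ^ 2 = 4 * (G * a / ((4 * L) * (4 * L))) := by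
      rw [div_pow, ← hG]; field_simp; ring
    have : G * a / ((4 * L) * (4 * L)) ≤ G * a / ((2 * L + B) * (2 * L + (B + a))) := by
      apply div_le_div_of_nonneg_left (by positivity) (by positivity)
      apply mul_le_mul <;> linarith
    linarith
  linarith

/-- Bellman function argument. The induction runs with the sharper bound `4F - 4G²/(2^k + A)`, where
`A` is the packing mass so far; the subtracted term is what makes the step from children to parent
close. -/
lemma bellman {a F G : ℤ → ℤ → ℝ} (ha : ∀ k n, 0 ≤ a k n)
    (hA : ∀ (N : ℕ) k n, ∑ d ∈ Finset.range N, levelSum a d k n ≤ 2 ^ k)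
    (hF : ∀ k n, F k n = F (k - 1) (2 * n) + F (k - 1) (2 * n + 1))
    (hG : ∀ k n, G k n = G (k - 1) (2 * n) + G (k - 1) (2 * n + 1))
    (hGF : ∀ k n, G k n ^ 2 ≤ F k n * 2 ^ k) (N : ℕ) (k n : ℤ) :
    ∑ d ∈ Finset.range N, levelSum (fun k n => a k n * (G k n / 2 ^ k) ^ 2) d k n
      ≤ 4 * F k n := by
  have hA0 : ∀ (N : ℕ) k n, 0 ≤ ∑ d ∈ Finset.range N, levelSum a d k n := fun N k n =>
    Finset.sum_nonneg fun d _ => Finset.sum_nonneg fun m _ => ha _ _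
  suffices h : ∑ d ∈ Finset.range N, levelSum (fun k n => a k n * (G k n / 2 ^ k) ^ 2) d k n
      ≤ 4 * F k n - 4 * (G k n ^ 2 / (2 ^ k + ∑ d ∈ Finset.range N, levelSum a d k n)) by
    have : 0 ≤ G k n ^ 2 / (2 ^ k + ∑ d ∈ Finset.range N, levelSum a d k n) :=
      div_nonneg (sq_nonneg _) (add_nonneg (by positivity) (hA0 N k n))
    linarith
  induction N generalizing k n with
  | zero =>
    have := hGF k n
    have hk : (0 : ℝ) < 2 ^ k := by positivity
    have : G k n ^ 2 / 2 ^ k ≤ F k n := by rwa [div_le_iff₀ hk]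
    simp only [Finset.range_zero, Finset.sum_empty, add_zero]
    linarith
  | succ N ih =>
    have hk : (2 : ℝ) ^ k = 2 * 2 ^ (k - 1) := by
      rw [zpow_sub_one₀ (by norm_num)]; ring
    have split : ∀ c : ℤ → ℤ → ℝ, ∑ d ∈ Finset.range (N + 1), levelSum c d k n
        = ∑ d ∈ Finset.range N, levelSum c d (k - 1) (2 * n)
          + ∑ d ∈ Finset.range N, levelSum c d (k - 1) (2 * n + 1) + c k n := by
      intro c
      rw [Finset.sum_range_succ', levelSum_zero, ← Finset.sum_add_distrib]
      simp_rw [levelSum_succ]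
    have hN := hA (N + 1) k n
    rw [split] at hN ⊢
    rw [split a, hF k n, hG k n]
    have i1 := ih (k - 1) (2 * n)
    have i2 := ih (k - 1) (2 * n + 1)
    rw [hk] at hN ⊢
    have := bellman_step (G₁ := G (k - 1) (2 * n)) (G₂ := G (k - 1) (2 * n + 1))
      (by positivity : (0 : ℝ) < 2 ^ (k - 1)) (hA0 N (k - 1) (2 * n)) (hA0 N (k - 1) (2 * n + 1))
      (ha k n) hN
    linarith

/-- The average of `f` over the dyadic interval `(k, n)`. -/
def avg (f : ℝ → ℝ≥0∞) (k n : ℤ) : ℝ≥0∞ := (∫⁻ x in interval (k, n), f x) / vol k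

lemma measurableSet_interval (I : Dyadic) : MeasurableSet (interval I) := measurableSet_Ico

lemma mem_interval_iff (k n : ℤ) (x : ℝ) : x ∈ interval (k, n) ↔ ⌊x / 2 ^ k⌋ = n := by
  have hk : (0 : ℝ) < 2 ^ k := by positivity
  rw [Int.floor_eq_iff, le_div_iff₀ hk, div_lt_iff₀ hk]; rfl

lemma volume_interval (k n : ℤ) : volume (interval (k, n)) = vol k := by
  simp only [interval, Real.volume_Ico, vol]; congr 1; ring

lemma iUnion_interval (k : ℤ) : ⋃ n : ℤ, interval (k, n) = Set.univ := by
  ext x; simp [mem_interval_iff]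

lemma disjoint_interval (k : ℤ) : Pairwise (Function.onFun Disjoint fun n : ℤ => interval (k, n)) := by
  intro m n hmn
  rw [Function.onFun, Set.disjoint_left]
  intro x hx hx'
  rw [mem_interval_iff] at hx hx'
  exact hmn (hx.symm.trans hx')

lemma tsum_lintegral_interval (f : ℝ → ℝ≥0∞) (k : ℤ) :
    ∑' n : ℤ, ∫⁻ x in interval (k, n), f x = ∫⁻ x, f x := by
  rw [← lintegral_iUnion (fun n => measurableSet_interval _) (disjoint_interval k),
    iUnion_interval, setLIntegral_univ]

lemma interval_eq_union (k n : ℤ) :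
    interval (k, n) = interval (k - 1, 2 * n) ∪ interval (k - 1, 2 * n + 1) := by
  have hk : (2 : ℝ) ^ k = 2 * 2 ^ (k - 1) := by rw [zpow_sub_one₀ (by norm_num)]; ring
  have hp : (0 : ℝ) < 2 ^ (k - 1) := by positivity
  simp only [interval, hk]
  push_cast
  rw [show (2 * (n : ℝ) + 1) * 2 ^ (k - 1) = (2 * n + 1) * 2 ^ (k - 1) from rfl,
    Set.Ico_union_Ico_eq_Ico (by nlinarith) (by nlinarith)]
  congr 1 <;> ring

lemma lintegral_interval_split (f : ℝ → ℝ≥0∞) (k n : ℤ) :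
    ∫⁻ x in interval (k, n), f x = (∫⁻ x in interval (k - 1, 2 * n), f x)
      + ∫⁻ x in interval (k - 1, 2 * n + 1), f x := by
  rw [interval_eq_union, lintegral_union (measurableSet_interval _)]
  exact disjoint_interval (k - 1) (by lia)

lemma sq_lintegral_interval_le {f : ℝ → ℝ≥0∞} (hf : AEMeasurable f) (k n : ℤ) :
    (∫⁻ x in interval (k, n), f x) ^ 2 ≤ (∫⁻ x in interval (k, n), f x ^ 2) * vol k := by
  have := ENNReal.lintegral_mul_le_Lp_mul_Lq (volume.restrict (interval (k, n)))
    (p := 2) (q := 2) (by constructor <;> norm_num) hf.restrict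
    (aemeasurable_const (b := (1 : ℝ≥0∞)))
  simp only [Pi.mul_apply, mul_one, ENNReal.rpow_two, one_pow, lintegral_one,
    Measure.restrict_apply_univ, volume_interval] at this
  calc _ ≤ _ := pow_le_pow_left' this 2
    _ = _ := by
      rw [mul_pow, ← ENNReal.rpow_two, ← ENNReal.rpow_two, ← ENNReal.rpow_mul, ← ENNReal.rpow_mul]
      norm_num

lemma IsCarleson.levelSum_avg_le {a : ℤ → ℤ → ℝ≥0∞} {K : ℝ≥0∞} (ha : IsCarleson a K) (hK : K ≠ ∞)
    {f : ℝ → ℝ≥0∞} (hf : AEMeasurable f) (hf2 : ∫⁻ x, f x ^ 2 ≠ ∞) (N : ℕ) (k n : ℤ) :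
    ∑ d ∈ Finset.range N, levelSum (fun k n => a k n * avg f k n ^ 2) d k n
      ≤ 4 * K * ∫⁻ x in interval (k, n), f x ^ 2 := by
  rcases eq_or_ne K 0 with rfl | hK0
  · have : ∀ k n, a k n = 0 := fun k n => by simpa using ha.apply_le k n
    simp [this, levelSum]
  have hF : ∀ k n, ∫⁻ x in interval (k, n), f x ^ 2 ≠ ∞ := fun k n =>
    ne_top_of_le_ne_top hf2 (setLIntegral_le_lintegral _ _)
  have hG : ∀ k n, ∫⁻ x in interval (k, n), f x ≠ ∞ := by
    intro k n h
    have := sq_lintegral_interval_le hf k n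
    rw [h] at this
    exact ENNReal.mul_ne_top (hF k n) (vol_ne_top k) (top_unique (by simpa using this))
  have hat : ∀ k n, a k n ≠ ∞ := fun k n =>
    ne_top_of_le_ne_top (ENNReal.mul_ne_top hK (vol_ne_top k)) (ha.apply_le k n)
  have hac : ∀ k n, a k n = K * ENNReal.ofReal ((a k n / K).toReal) := fun k n => by
    rw [ENNReal.ofReal_toReal (ENNReal.div_ne_top (hat k n) hK0), ENNReal.mul_div_cancel hK0 hK]
  have ofReal_sum : ∀ c : ℤ → ℤ → ℝ, (∀ k n, 0 ≤ c k n) → ∀ (N : ℕ) k n,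
      ENNReal.ofReal (∑ d ∈ Finset.range N, levelSum c d k n)
        = ∑ d ∈ Finset.range N, levelSum (fun k n => ENNReal.ofReal (c k n)) d k n := by
    intro c hc N k n
    have hn : ∀ d ∈ Finset.range N, 0 ≤ levelSum c d k n := fun d _ =>
      Finset.sum_nonneg fun m _ => hc _ _
    rw [ENNReal.ofReal_sum_of_nonneg hn]
    refine Finset.sum_congr rfl fun d _ => ?_
    exact ENNReal.ofReal_sum_of_nonneg fun m _ => hc _ _
  have mulK : ∀ c : ℤ → ℤ → ℝ≥0∞, ∀ (N : ℕ) k n,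
      ∑ d ∈ Finset.range N, levelSum (fun k n => K * c k n) d k n
        = K * ∑ d ∈ Finset.range N, levelSum c d k n := by
    intro c N k n
    simp only [levelSum, Finset.mul_sum]
  have main := bellman (a := fun k n => (a k n / K).toReal)
    (F := fun k n => (∫⁻ x in interval (k, n), f x ^ 2).toReal)
    (G := fun k n => (∫⁻ x in interval (k, n), f x).toReal)
    (fun _ _ => ENNReal.toReal_nonneg) ?_ ?_ ?_ ?_ N k n
  · have h := ENNReal.ofReal_le_ofReal main
    rw [ofReal_sum _ (fun k n => by positivity), ENNReal.ofReal_mul (by norm_num),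
      ENNReal.ofReal_toReal (hF k n)] at h
    have e : (fun k n => a k n * avg f k n ^ 2) = fun k n => K * ENNReal.ofReal
        ((a k n / K).toReal * ((∫⁻ x in interval (k, n), f x).toReal / 2 ^ k) ^ 2) := by
      funext k n
      rw [ENNReal.ofReal_mul ENNReal.toReal_nonneg, ← mul_assoc, ← hac, ENNReal.ofReal_pow
        (by positivity), ENNReal.ofReal_div_of_pos (by positivity), ENNReal.ofReal_toReal (hG k n)]
      rfl
    rw [e, mulK]
    rw [show ENNReal.ofReal 4 = 4 by simp] at h
    calc _ ≤ K * (4 * ∫⁻ x in interval (k, n), f x ^ 2) := by gcongr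
      _ = _ := by ring
  · intro N k n
    rw [← ENNReal.ofReal_le_ofReal_iff (by positivity), ofReal_sum _ fun _ _ => ENNReal.toReal_nonneg,
      ← ENNReal.mul_le_mul_iff_right hK0 hK, ← mulK]
    simp_rw [← hac]
    exact ha N k n
  · intro k n
    rw [lintegral_interval_split, ENNReal.toReal_add (hF _ _) (hF _ _)]
  · intro k n
    rw [lintegral_interval_split, ENNReal.toReal_add (hG _ _) (hG _ _)]
  · intro k n
    have h := ENNReal.toReal_mono (ENNReal.mul_ne_top (hF k n) (vol_ne_top k))
      (sq_lintegral_interval_le hf k n)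
    rwa [ENNReal.toReal_pow, ENNReal.toReal_mul, vol, ENNReal.toReal_ofReal (by positivity)] at h

/-- The dyadic Carleson embedding theorem. -/
theorem IsCarleson.tsum_avg_le {a : ℤ → ℤ → ℝ≥0∞} {K : ℝ≥0∞} (ha : IsCarleson a K) (hK : K ≠ ∞)
    {f : ℝ → ℝ≥0∞} (hf : AEMeasurable f) (hf2 : ∫⁻ x, f x ^ 2 ≠ ∞) :
    ∑' k, ∑' n, a k n * avg f k n ^ 2 ≤ 4 * K * ∫⁻ x, f x ^ 2 := by
  have h : ∀ (N : ℕ) k, ∑ d ∈ Finset.range N, ∑' m, a (k - d) m * avg f (k - d) m ^ 2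
      ≤ 4 * K * ∫⁻ x, f x ^ 2 := by
    intro N k
    rw [← tsum_lintegral_interval _ k, ← ENNReal.tsum_mul_left]
    refine le_trans (le_of_eq ?_) (ENNReal.tsum_le_tsum fun n => ha.levelSum_avg_le hK hf hf2 N k n)
    rw [Summable.tsum_finsetSum fun _ _ => ENNReal.summable]
    refine Finset.sum_congr rfl fun d _ => ?_
    exact (tsum_levelSum (fun k n => a k n * avg f k n ^ 2) d k).symm
  -- A finite set of scales sits between some `k₀` and `k₁`, hence among finitely many generations
  -- below scale `k₁`.
  rw [ENNReal.tsum_eq_iSup_sum]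
  refine iSup_le fun s => ?_
  obtain ⟨k₁, h₁⟩ := s.bddAbove
  obtain ⟨k₀, h₀⟩ := s.bddBelow
  refine le_trans ?_ (h (k₁ - k₀ + 1).toNat k₁)
  have hinj : Set.InjOn (fun d : ℕ => k₁ - (d : ℤ)) (Finset.range (k₁ - k₀ + 1).toNat) := by
    intro x _ y _ hxy
    simpa using hxy
  rw [← Finset.sum_image (f := fun k => ∑' m, a k m * avg f k m ^ 2) hinj]
  refine Finset.sum_le_sum_of_subset fun k hk => ?_
  have hk1 : k ≤ k₁ := h₁ hk
  have hk0 : k₀ ≤ k := h₀ hk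
  refine Finset.mem_image.2 ⟨(k₁ - k).toNat, ?_, ?_⟩
  · rw [Finset.mem_range]; lia
  · lia

/-! ### Affine dilates of Schwartz functions and their Fourier transforms -/

/-- The Schwartz function `x ↦ f ((x - a) / r)`. -/
def stretch (f : 𝓢(ℝ, ℂ)) (a r : ℝ) (hr : r ≠ 0) : 𝓢(ℝ, ℂ) :=
  SchwartzMap.compCLMOfAntilipschitz ℂ (g := fun x : ℝ => (x - a) / r) (K := ‖r‖₊)
    (by simp only [div_eq_mul_inv]; fun_prop)
    (AntilipschitzWith.of_le_mul_dist fun x y => by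
      rw [Real.dist_eq, Real.dist_eq, ← sub_div, abs_div, coe_nnnorm, Real.norm_eq_abs,
        mul_div_cancel₀ _ (abs_ne_zero.2 hr)]
      simp) f

lemma stretch_apply (f : 𝓢(ℝ, ℂ)) (a r : ℝ) (hr : r ≠ 0) (x : ℝ) :
    stretch f a r hr x = f ((x - a) / r) := rfl

lemma fourier_stretch (f : 𝓢(ℝ, ℂ)) (a : ℝ) {r : ℝ} (hr : 0 < r) (ξ : ℝ) :
    𝓕 (stretch f a r hr.ne') ξ
      = r * Complex.exp (↑(-2 * Real.pi * a * ξ) * Complex.I) * 𝓕 f (r * ξ) := by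
  rw [SchwartzMap.fourier_coe, SchwartzMap.fourier_coe, Real.fourier_real_eq_integral_exp_smul,
    Real.fourier_real_eq_integral_exp_smul]
  set G : ℝ → ℂ := fun t => Complex.exp (↑(-2 * Real.pi * (r * t + a) * ξ) * Complex.I) • f t
  have h1 : ∀ v : ℝ, Complex.exp (↑(-2 * Real.pi * v * ξ) * Complex.I) • stretch f a r hr.ne' v
      = G ((v - a) / r) := by
    intro v
    simp only [G, stretch_apply, mul_div_cancel₀ _ hr.ne', sub_add_cancel]
  simp_rw [h1]
  have h2 : ∫ v, G ((v - a) / r) = ∫ v, G (v / r) :=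
    integral_sub_right_eq_self (μ := volume) (fun v => G (v / r)) a
  rw [h2, Measure.integral_comp_div G r, abs_of_pos hr, Complex.real_smul, mul_assoc]
  congr 1
  rw [← integral_const_mul]
  refine integral_congr_ae (Filter.Eventually.of_forall fun t => ?_)
  simp only [G, smul_eq_mul]
  rw [← mul_assoc, ← Complex.exp_add]
  congr 2
  push_cast
  ring

lemma len_pos (I : Dyadic) : 0 < len I := by unfold len; positivity

/-- The dilate `f_I` as a Schwartz function. -/
def dilS (f : 𝓢(ℝ, ℂ)) (I : Dyadic) : 𝓢(ℝ, ℂ) :=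
  (((Real.sqrt (len I))⁻¹ : ℝ) : ℂ) • stretch f (center I) (len I) (len_pos I).ne'

lemma coe_dilS (f : 𝓢(ℝ, ℂ)) (I : Dyadic) : ⇑(dilS f I) = dil f I := rfl

lemma fourier_dilS (f : 𝓢(ℝ, ℂ)) (I : Dyadic) (ξ : ℝ) :
    𝓕 (dilS f I) ξ = (((Real.sqrt (len I))⁻¹ : ℝ) : ℂ) * (len I *
      Complex.exp (↑(-2 * Real.pi * center I * ξ) * Complex.I)) * 𝓕 f (len I * ξ) := by
  rw [dilS, FourierTransform.fourier_smul, smul_apply, fourier_stretch f _ (len_pos I),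
    smul_eq_mul]
  ring

lemma fourier_dilS_ne_zero {f : 𝓢(ℝ, ℂ)} {I : Dyadic} {ξ : ℝ} (h : 𝓕 (dilS f I) ξ ≠ 0) :
    𝓕 f (len I * ξ) ≠ 0 := by
  rw [fourier_dilS] at h
  exact right_ne_zero_of_mul h

/-! ### Pairings and the Plancherel theorem -/

lemma inner_toLp_eq_pair {f g : ℝ → ℂ} (hf : MemLp f 2) (hg : MemLp g 2) :
    inner ℂ (hg.toLp g) (hf.toLp f) = pair f g := by
  rw [L2.inner_def]
  refine integral_congr_ae ?_
  filter_upwards [hf.coeFn_toLp, hg.coeFn_toLp] with x h1 h2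
  rw [h1, h2]; rfl

lemma inner_schwartz_eq_pair (f g : 𝓢(ℝ, ℂ)) : inner ℂ (g.toLp 2) (f.toLp 2) = pair f g :=
  inner_toLp_eq_pair (f.memLp 2) (g.memLp 2)

lemma inner_schwartz_left_eq_pair (F : Lp ℂ 2 (volume : Measure ℝ)) (g : 𝓢(ℝ, ℂ)) :
    inner ℂ (g.toLp 2) F = pair F g := by
  have := inner_toLp_eq_pair (Lp.memLp F) (g.memLp 2)
  rwa [Lp.toLp_coeFn] at this

lemma pair_congr {f f' g : ℝ → ℂ} (h : f =ᵐ[volume] f') : pair f g = pair f' g := by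
  refine integral_congr_ae ?_
  filter_upwards [h] with x hx
  rw [hx]

lemma pair_fourier (f g : 𝓢(ℝ, ℂ)) : pair (𝓕 f : 𝓢(ℝ, ℂ)) (𝓕 g : 𝓢(ℝ, ℂ)) = pair f g := by
  rw [← inner_schwartz_eq_pair, ← inner_schwartz_eq_pair, SchwartzMap.inner_fourier_toL2_eq]

lemma pair_eq_zero_of_disjoint {f g : 𝓢(ℝ, ℂ)} (h : ∀ ξ, 𝓕 f ξ ≠ 0 → 𝓕 g ξ ≠ 0 → False) :
    pair f g = 0 := by
  rw [← pair_fourier]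
  refine integral_eq_zero_of_ae (Filter.Eventually.of_forall fun ξ => ?_)
  by_contra hne
  simp only [Pi.zero_apply] at hne
  exact h ξ (left_ne_zero_of_mul hne) (by simpa using right_ne_zero_of_mul hne)

lemma fourierInv_apply_eq_neg (f : 𝓢(ℝ, ℂ)) (x : ℝ) : 𝓕⁻ f x = 𝓕 f (-x) := rfl

/-- The product of two Schwartz functions. -/
def mulS (f g : 𝓢(ℝ, ℂ)) : 𝓢(ℝ, ℂ) := SchwartzMap.pairing (ContinuousLinearMap.mul ℂ ℂ) f g

lemma mulS_apply (f g : 𝓢(ℝ, ℂ)) (x : ℝ) : mulS f g x = f x * g x := rfl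

/-- The transform of a product is a convolution, so its support lies in the sum of the supports. The
inverse transform causes the sign in `-ξ`. -/
lemma exists_of_fourierInv_mulS_ne_zero {f g : 𝓢(ℝ, ℂ)} {ξ : ℝ} (h : 𝓕⁻ (mulS f g) ξ ≠ 0) :
    ∃ t s, t + s = -ξ ∧ 𝓕 f t ≠ 0 ∧ 𝓕 g s ≠ 0 := by
  have e : 𝓕⁻ (mulS f g)
      = SchwartzMap.convolution (ContinuousLinearMap.mul ℂ ℂ) (𝓕⁻ f) (𝓕⁻ g) := by
    rw [← FourierTransform.fourierInv_fourier_eq (F := 𝓢(ℝ, ℂ))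
      (SchwartzMap.convolution (ContinuousLinearMap.mul ℂ ℂ) (𝓕⁻ f) (𝓕⁻ g)),
      SchwartzMap.fourier_convolution, FourierTransform.fourier_fourierInv_eq,
      FourierTransform.fourier_fourierInv_eq, mulS]
  rw [e, SchwartzMap.convolution_apply] at h
  by_contra hcon
  push Not at hcon
  refine h (integral_eq_zero_of_ae (Filter.Eventually.of_forall fun t => ?_))
  simp only [Pi.zero_apply, ContinuousLinearMap.mul_apply']
  by_contra hne
  rw [fourierInv_apply_eq_neg, fourierInv_apply_eq_neg] at hne
  exact (right_ne_zero_of_mul hne) (hcon _ _ (by ring) (left_ne_zero_of_mul hne))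

lemma integral_mul_conj_eq_zero {f g f' g' : 𝓢(ℝ, ℂ)}
    (h : ∀ t s t' s', t + s' = t' + s → 𝓕 f t ≠ 0 → 𝓕 g s ≠ 0 → 𝓕 f' t' ≠ 0 →
      𝓕 g' s' ≠ 0 → False) :
    pair (fun x => f x * conj (g x)) (fun x => f' x * conj (g' x)) = 0 := by
  -- Regrouping the four factors as `(f g') · conj (f' g)` leaves plain products, so conjugates need
  -- not be transformed.
  have e : pair (fun x => f x * conj (g x)) (fun x => f' x * conj (g' x))
      = pair (mulS f g') (mulS f' g) := by
    refine integral_congr_ae (Filter.Eventually.of_forall fun x => ?_)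
    simp only [mulS_apply, map_mul, Complex.conj_conj]
    ring
  have e2 : ∀ p : 𝓢(ℝ, ℂ), 𝓕 (𝓕⁻ p : 𝓢(ℝ, ℂ)) = p := FourierTransform.fourier_fourierInv_eq
  rw [e, ← e2 (mulS f g'), ← e2 (mulS f' g), pair_fourier]
  refine integral_eq_zero_of_ae (Filter.Eventually.of_forall fun ξ => ?_)
  by_contra hne
  simp only [Pi.zero_apply] at hne
  obtain ⟨t, s', h1, h2, h3⟩ := exists_of_fourierInv_mulS_ne_zero (left_ne_zero_of_mul hne)
  obtain ⟨t', s, h1', h2', h3'⟩ :=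
    exists_of_fourierInv_mulS_ne_zero (by simpa using right_ne_zero_of_mul hne)
  exact h t s t' s' (by rw [h1, h1']) h2 h3' h2' h3

/-! ### Multiplication by a bounded function -/

/-- Multiplication by a bounded function, as an operator on `L²`. -/
def mulCLM {g : ℝ → ℂ} (hg : MemLp g ∞) : Lp ℂ 2 (volume : Measure ℝ) →L[ℂ] Lp ℂ 2 (volume : Measure ℝ) :=
  (ContinuousLinearMap.mul ℂ ℂ).holderL volume ∞ 2 2 (hg.toLp g)

lemma coeFn_mulCLM {g : ℝ → ℂ} (hg : MemLp g ∞) (F : Lp ℂ 2 (volume : Measure ℝ)) :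
    mulCLM hg F =ᵐ[volume] fun x => g x * F x := by
  have := ContinuousLinearMap.coeFn_holder (r := 2) (ContinuousLinearMap.mul ℂ ℂ) (hg.toLp g) F
  filter_upwards [this, hg.coeFn_toLp] with x h1 h2
  refine Eq.trans h1 ?_
  rw [h2]; rfl

/-! ### The projection onto negative frequencies -/

lemma memLp_indicator_Iio : MemLp (Set.indicator (Set.Iio (0 : ℝ)) (fun _ => (1 : ℂ))) ∞ :=
  (memLp_top_const (1 : ℂ)).indicator measurableSet_Iio

/-- Restriction to the negative half-line. -/
def restrictNeg : Lp ℂ 2 (volume : Measure ℝ) →L[ℂ] Lp ℂ 2 (volume : Measure ℝ) :=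
  mulCLM memLp_indicator_Iio

/-- The Riesz projection onto negative frequencies. -/
def negProj : Lp ℂ 2 (volume : Measure ℝ) →L[ℂ] Lp ℂ 2 (volume : Measure ℝ) :=
  ((Lp.fourierTransformₗᵢ ℝ ℂ).symm.toContinuousLinearEquiv.toContinuousLinearMap).comp
    (restrictNeg.comp (Lp.fourierTransformₗᵢ ℝ ℂ).toContinuousLinearEquiv.toContinuousLinearMap)

lemma negProj_apply (F : Lp ℂ 2 (volume : Measure ℝ)) : negProj F = 𝓕⁻ (restrictNeg (𝓕 F)) := rfl

lemma coeFn_restrictNeg (F : Lp ℂ 2 (volume : Measure ℝ)) :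
    restrictNeg F =ᵐ[volume] Set.indicator (Set.Iio 0) F := by
  filter_upwards [coeFn_mulCLM memLp_indicator_Iio F] with x hx
  refine Eq.trans hx ?_
  by_cases h : x ∈ Set.Iio (0 : ℝ) <;> simp [h]

lemma restrictNeg_idem (F : Lp ℂ 2 (volume : Measure ℝ)) :
    restrictNeg (restrictNeg F) = restrictNeg F := by
  apply Lp.ext
  filter_upwards [coeFn_restrictNeg (restrictNeg F), coeFn_restrictNeg F] with x h1 h2
  rw [h1, h2]
  by_cases h : x ∈ Set.Iio (0 : ℝ) <;> simp_all

lemma inner_restrictNeg (F G : Lp ℂ 2 (volume : Measure ℝ)) :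
    inner ℂ (restrictNeg F) G = inner ℂ F (restrictNeg G) := by
  rw [L2.inner_def, L2.inner_def]
  refine integral_congr_ae ?_
  filter_upwards [coeFn_restrictNeg F, coeFn_restrictNeg G] with x h1 h2
  rw [h1, h2]
  by_cases h : x ∈ Set.Iio (0 : ℝ) <;> simp [h]

lemma negProj_idem (F : Lp ℂ 2 (volume : Measure ℝ)) : negProj (negProj F) = negProj F := by
  rw [negProj_apply (negProj F), negProj_apply F, FourierTransform.fourier_fourierInv_eq,
    restrictNeg_idem]

lemma inner_negProj (F G : Lp ℂ 2 (volume : Measure ℝ)) :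
    inner ℂ (negProj F) G = inner ℂ F (negProj G) := by
  rw [← Lp.inner_fourier_eq, ← Lp.inner_fourier_eq F, negProj_apply, negProj_apply,
    FourierTransform.fourier_fourierInv_eq, FourierTransform.fourier_fourierInv_eq,
    inner_restrictNeg]

lemma norm_negProj_le (F : Lp ℂ 2 (volume : Measure ℝ)) : ‖negProj F‖ ≤ ‖F‖ := by
  have h : ‖negProj F‖ ^ 2 ≤ ‖F‖ * ‖negProj F‖ := by
    have h1 : inner ℂ (negProj F) (negProj F) = inner ℂ F (negProj F) := by
      rw [inner_negProj, negProj_idem]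
    have h2 : ‖inner ℂ (negProj F) (negProj F)‖ = ‖negProj F‖ ^ 2 := by
      rw [inner_self_eq_norm_sq_to_K]; simp
    rw [← h2, h1]
    exact norm_inner_le_norm _ _
  by_contra hlt
  push Not at hlt
  nlinarith [norm_nonneg F]

lemma negProj_toLp {f g : 𝓢(ℝ, ℂ)} (h : ∀ ξ, 𝓕 g ξ = Set.indicator (Set.Iio 0) (𝓕 f : 𝓢(ℝ, ℂ)) ξ) :
    negProj (f.toLp 2) = g.toLp 2 := by
  have e : 𝓕⁻ (𝓕 (g.toLp 2 volume) : Lp ℂ 2 (volume : Measure ℝ)) = g.toLp 2 volume :=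
    FourierTransform.fourierInv_fourier_eq _
  rw [negProj_apply, SchwartzMap.toLp_fourier_eq, ← e, SchwartzMap.toLp_fourier_eq]
  congr 1
  apply Lp.ext
  filter_upwards [coeFn_restrictNeg ((𝓕 f).toLp 2), (𝓕 f).coeFn_toLp 2, (𝓕 g).coeFn_toLp 2]
    with x h1 h2 h3
  rw [h1, h3, h x]
  by_cases hx : x ∈ Set.Iio (0 : ℝ) <;> simp [hx, h2]

/-! ### The Meyer wavelet and its antianalytic part -/

namespace IsMeyerWavelet
variable {w : 𝓢(ℝ, ℂ)} (hw : IsMeyerWavelet w)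
include hw

lemma fourier_supp_closed {ξ : ℝ} (h : 𝓕 w ξ ≠ 0) : 1 / 3 ≤ |ξ| ∧ |ξ| ≤ 4 / 3 := by
  have hpi := Real.pi_pos
  have := hw.fourier_support (2 * Real.pi * ξ) (by
    rwa [mul_div_cancel_left₀ _ (by positivity)])
  rw [abs_mul, abs_of_pos (by positivity : (0 : ℝ) < 2 * Real.pi)] at this
  constructor
  · by_contra hlt
    push Not at hlt
    nlinarith [this.1]
  · by_contra hlt
    push Not at hlt
    nlinarith [this.2]

/-- The set where a continuous function is nonzero is open, so it avoids the endpoints. Strictness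
makes scales exactly two apart disjoint, as `pair_u_eq_zero` needs. -/
lemma fourier_supp {ξ : ℝ} (h : 𝓕 w ξ ≠ 0) : 1 / 3 < |ξ| ∧ |ξ| < 4 / 3 := by
  have hcont : Continuous (𝓕 w : 𝓢(ℝ, ℂ)) := (𝓕 w).continuous
  have hopen : IsOpen {ξ : ℝ | 𝓕 w ξ ≠ 0} := isOpen_ne_fun hcont continuous_const
  obtain ⟨ε, hε, hball⟩ := Metric.isOpen_iff.1 hopen ξ h
  have hmem : ∀ η, |η| < ε → 1 / 3 ≤ |ξ + η| ∧ |ξ + η| ≤ 4 / 3 := fun η hη =>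
    hw.fourier_supp_closed (hball (by simpa [Real.dist_eq] using hη))
  have hε2 : |ε / 2| < ε := by rw [abs_of_pos (by positivity)]; linarith
  have hp := hmem (ε / 2) hε2
  have hm := hmem (-(ε / 2)) (by rwa [abs_neg])
  have h0 := hw.fourier_supp_closed h
  rcases le_total 0 ξ with hξ | hξ
  · rw [abs_of_nonneg hξ] at *
    constructor
    · by_contra hcon
      have : ξ = 1 / 3 := by linarith
      subst this
      have := hm.1
      rcases abs_cases (1 / 3 + -(ε / 2)) with ⟨h1, h2⟩ | ⟨h1, h2⟩
      · linarith
      -- Here the ball around `1/3` is so large that it contains the origin, where the transform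
      -- vanishes.
      · have h3 := hmem (-1 / 3) (by rw [abs_lt]; constructor <;> linarith)
        norm_num at h3
    · have := le_abs_self (ξ + ε / 2)
      linarith [hp.2]
  · rw [abs_of_nonpos hξ] at *
    constructor
    · by_contra hcon
      have : ξ = -(1 / 3) := by linarith
      subst this
      have := hp.1
      rcases abs_cases (-(1 / 3) + ε / 2) with ⟨h1, h2⟩ | ⟨h1, h2⟩
      · have h3 := hmem (1 / 3) (by rw [abs_lt]; constructor <;> linarith)
        norm_num at h3
      · linarith
    · have := neg_abs_le (ξ + -(ε / 2))
      linarith [hm.2]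

/-- The transform of `w` vanishes near the origin, so cutting it off at zero creates no singularity:
the result is smooth with compact support. -/
lemma exists_antianalytic : ∃ u : 𝓢(ℝ, ℂ), ⇑u = antianalytic w ∧
    ∀ ξ, 𝓕 u ξ = Set.indicator (Set.Iio 0) (𝓕 w : 𝓢(ℝ, ℂ)) ξ := by
  set g : ℝ → ℂ := Set.indicator (Set.Iio 0) (𝓕 w : 𝓢(ℝ, ℂ)) with hg
  have hsmooth : ContDiff ℝ ((⊤ : ℕ∞) : WithTop ℕ∞) (g : ℝ → ℂ) := by
    rw [contDiff_iff_contDiffAt]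
    intro ξ
    rcases lt_or_ge ξ 0 with hξ | hξ
    · have hs : ContDiffAt ℝ ((⊤ : ℕ∞) : WithTop ℕ∞) (𝓕 w : 𝓢(ℝ, ℂ)) ξ := ((𝓕 w).smooth ⊤).contDiffAt
      refine hs.congr_of_eventuallyEq ?_
      filter_upwards [Iio_mem_nhds hξ] with η hη
      rw [hg, Set.indicator_of_mem hη]
    · refine (contDiffAt_const (c := (0 : ℂ))).congr_of_eventuallyEq ?_
      filter_upwards [Ioi_mem_nhds (show -(1 / 3) < ξ by linarith)] with η hη
      by_contra hne
      have h1 : η ∈ Set.Iio (0 : ℝ) := Set.mem_of_indicator_ne_zero hne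
      rw [hg, Set.indicator_of_mem h1] at hne
      have h2 := (hw.fourier_supp hne).1
      rw [abs_of_neg h1] at h2
      simp only [Set.mem_Ioi] at hη
      linarith
  have hcompact : HasCompactSupport g := by
    refine HasCompactSupport.intro (isCompact_Icc (a := (-2 : ℝ)) (b := 2)) fun ξ hξ => ?_
    by_contra hne
    have h1 : ξ ∈ Set.Iio (0 : ℝ) := Set.mem_of_indicator_ne_zero hne
    rw [hg, Set.indicator_of_mem h1] at hne
    have h2 := (hw.fourier_supp hne).2
    rw [abs_lt] at h2
    exact hξ ⟨by linarith [h2.1], by linarith [h2.2]⟩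
  set G : 𝓢(ℝ, ℂ) := hcompact.toSchwartzMap hsmooth
  have hG : ⇑G = g := rfl
  have e : 𝓕 (𝓕⁻ G : 𝓢(ℝ, ℂ)) = G := FourierTransform.fourier_fourierInv_eq G
  refine ⟨𝓕⁻ G, ?_, fun ξ => by rw [e, hG]⟩
  rw [SchwartzMap.fourierInv_coe, hG, hg, SchwartzMap.fourier_coe, antianalytic]

/-- The antianalytic part of a Meyer wavelet, as a Schwartz function. -/
def u : 𝓢(ℝ, ℂ) := hw.exists_antianalytic.choose

lemma coe_u : ⇑hw.u = antianalytic w := hw.exists_antianalytic.choose_spec.1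

lemma fourier_u (ξ : ℝ) : 𝓕 hw.u ξ = Set.indicator (Set.Iio 0) (𝓕 w : 𝓢(ℝ, ℂ)) ξ :=
  hw.exists_antianalytic.choose_spec.2 ξ

lemma fourier_u_supp {ξ : ℝ} (h : 𝓕 hw.u ξ ≠ 0) : -(4 / 3) < ξ ∧ ξ < -(1 / 3) := by
  rw [hw.fourier_u] at h
  have h1 : ξ ∈ Set.Iio (0 : ℝ) := Set.mem_of_indicator_ne_zero h
  rw [Set.indicator_of_mem h1] at h
  have h2 := hw.fourier_supp h
  rw [abs_of_neg h1] at h2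
  constructor <;> linarith

lemma fourier_dilS_u_supp {k n : ℤ} {ξ : ℝ} (h : 𝓕 (dilS hw.u (k, n)) ξ ≠ 0) :
    -(4 / 3) < 2 ^ k * ξ ∧ 2 ^ k * ξ < -(1 / 3) := by
  have := hw.fourier_u_supp (fourier_dilS_ne_zero h)
  rwa [show len (k, n) = 2 ^ k from rfl] at this

lemma fourier_dilS_supp {k n : ℤ} {ξ : ℝ} (h : 𝓕 (dilS w (k, n)) ξ ≠ 0) :
    1 / 3 < 2 ^ k * |ξ| ∧ 2 ^ k * |ξ| < 4 / 3 := by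
  have := hw.fourier_supp (fourier_dilS_ne_zero h)
  rwa [abs_mul, abs_of_pos (len_pos _)] at this

lemma negProj_dilS (I : Dyadic) : negProj ((dilS w I).toLp 2) = (dilS hw.u I).toLp 2 := by
  refine negProj_toLp fun ξ => ?_
  have hl := len_pos I
  rw [fourier_dilS, hw.fourier_u]
  by_cases hξ : ξ < 0
  · have h1 : len I * ξ ∈ Set.Iio (0 : ℝ) := mul_neg_of_pos_of_neg hl hξ
    have h2 : ξ ∈ Set.Iio (0 : ℝ) := hξ
    rw [Set.indicator_of_mem h1, Set.indicator_of_mem h2, fourier_dilS]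
  · have h1 : len I * ξ ∉ Set.Iio (0 : ℝ) := by
      simp only [Set.mem_Iio, not_lt] at *
      positivity
    have h2 : ξ ∉ Set.Iio (0 : ℝ) := hξ
    rw [Set.indicator_of_notMem h1, Set.indicator_of_notMem h2, mul_zero]

/-- The wavelet basis of `L²`. -/
def basis : HilbertBasis Dyadic ℂ (Lp ℂ 2 (volume : Measure ℝ)) := hw.orthonormal_basis.choose

lemma basis_apply (I : Dyadic) : hw.basis I = (dilS w I).toLp 2 := by
  apply Lp.ext
  exact (hw.orthonormal_basis.choose_spec I).trans ((dilS w I).coeFn_toLp 2).symm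

lemma inner_basis_negProj (F : Lp ℂ 2 (volume : Measure ℝ)) (I : Dyadic) :
    inner ℂ (hw.basis I) (negProj F) = pair F (dil hw.u I) := by
  rw [← inner_negProj, hw.basis_apply, hw.negProj_dilS, inner_schwartz_left_eq_pair]; rfl

/-- Expand `P₋ F` in wavelets and apply `P₋` once more: self-adjointness turns the coefficients into
`⟨F, u_I⟩`, and the vectors `w_I` become `u_I`. -/
lemma hasSum_negProj (F : Lp ℂ 2 (volume : Measure ℝ)) :
    HasSum (fun I => pair F (dil hw.u I) • (dilS hw.u I).toLp 2) (negProj F) := by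
  have h := (hw.basis.hasSum_repr (negProj F)).mapL negProj
  rw [negProj_idem] at h
  convert! h using 2 with I
  rw [map_smul, hw.basis.repr_apply_apply, hw.inner_basis_negProj, hw.basis_apply, hw.negProj_dilS]

lemma hasSum_pair_mul_pair (F : Lp ℂ 2 (volume : Measure ℝ)) (h : 𝓢(ℝ, ℂ)) :
    HasSum (fun I => pair F (dil hw.u I) * pair (dil hw.u I) h) (pair (negProj F) h) := by
  let L : Lp ℂ 2 (volume : Measure ℝ) →L[ℂ] ℂ := innerSL ℂ (h.toLp 2)
  have hs := (hw.hasSum_negProj F).mapL L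
  simp only [L, innerSL_apply_apply, inner_smul_right, inner_schwartz_eq_pair] at hs
  simp only [inner_schwartz_left_eq_pair, coe_dilS] at hs
  exact hs

/-- Since `⟨F, u_I⟩ = ⟨P₋ F, w_I⟩`, this is Bessel's inequality for the wavelet basis. -/
lemma tsum_enorm_pair_sq_le (F : Lp ℂ 2 (volume : Measure ℝ)) :
    ∑' I, ‖pair F (dil hw.u I)‖ₑ ^ 2 ≤ ‖F‖ₑ ^ 2 := by
  have h1 := hw.basis.orthonormal.inner_products_summable (negProj F)
  have h2 := hw.basis.orthonormal.tsum_inner_products_le (negProj F)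
  simp only [hw.inner_basis_negProj] at h1 h2
  have h3 : ∀ z : ℂ, ‖z‖ₑ ^ 2 = ENNReal.ofReal (‖z‖ ^ 2) := fun z => by
    rw [ENNReal.ofReal_pow (norm_nonneg _), ofReal_norm]
  simp_rw [h3]
  rw [← ENNReal.ofReal_tsum_of_nonneg (fun _ => by positivity) h1, ← ofReal_norm,
    ← ENNReal.ofReal_pow (norm_nonneg _)]
  refine ENNReal.ofReal_le_ofReal (h2.trans ?_)
  gcongr
  exact norm_negProj_le F

lemma hasSum_basis (f : 𝓢(ℝ, ℂ)) :
    HasSum (fun I => pair f (dil w I) • (dilS w I).toLp 2) (f.toLp 2) := by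
  have h := hw.basis.hasSum_repr (f.toLp 2)
  convert! h using 2 with I
  rw [hw.basis.repr_apply_apply, hw.basis_apply, inner_schwartz_eq_pair, coe_dilS]

end IsMeyerWavelet

/-! ### Low-pass kernels -/

/-- The radius `4/3` is the outer edge of the wavelet band, so the filter at scale `2^j` reproduces
every `u_I` with `|I| ≥ 2^j`; it kills those with `|I| ≤ 2^{j-3}`. -/
lemma exists_lowpass : ∃ h : 𝓢(ℝ, ℂ), (∀ ξ : ℝ, |ξ| ≤ 4 / 3 → 𝓕 h ξ = 1) ∧
    ∀ ξ : ℝ, 8 / 3 ≤ |ξ| → 𝓕 h ξ = 0 := by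
  let χ : ContDiffBump (0 : ℝ) := ⟨4 / 3, 8 / 3, by norm_num, by norm_num⟩
  have h1 : HasCompactSupport (fun ξ => (χ ξ : ℂ)) :=
    χ.hasCompactSupport.comp_left (g := fun t : ℝ => (t : ℂ)) (by simp)
  have h2 : ContDiff ℝ ((⊤ : ℕ∞) : WithTop ℕ∞) (fun ξ => (χ ξ : ℂ)) := Complex.ofRealCLM.contDiff.comp χ.contDiff
  have e : 𝓕 (𝓕⁻ (h1.toSchwartzMap h2) : 𝓢(ℝ, ℂ)) = h1.toSchwartzMap h2 :=
    FourierTransform.fourier_fourierInv_eq _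
  refine ⟨𝓕⁻ (h1.toSchwartzMap h2), fun ξ hξ => ?_, fun ξ hξ => ?_⟩
  · rw [e, HasCompactSupport.toSchwartzMap_toFun, χ.one_of_mem_closedBall (by
      simpa [Real.dist_eq] using hξ)]
    simp
  · rw [e, HasCompactSupport.toSchwartzMap_toFun, χ.zero_of_le_dist (by
      simpa [Real.dist_eq] using hξ)]
    simp

/-- The low-pass filter at scale `2^j`, in the form `⟨f, kernel⟩ = (f * η_j)(x)`. -/
def lowpass (j : ℤ) (x : ℝ) : 𝓢(ℝ, ℂ) :=
  (((2 : ℝ) ^ j : ℝ) : ℂ)⁻¹ • stretch exists_lowpass.choose x (2 ^ j) (by positivity)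

lemma fourier_lowpass (j : ℤ) (x ξ : ℝ) :
    𝓕 (lowpass j x) ξ = Complex.exp (↑(-2 * Real.pi * x * ξ) * Complex.I) *
      𝓕 exists_lowpass.choose (2 ^ j * ξ) := by
  have h : (((2 : ℝ) ^ j : ℝ) : ℂ) ≠ 0 := by
    rw [Complex.ofReal_ne_zero]; positivity
  rw [lowpass, FourierTransform.fourier_smul, smul_apply, smul_eq_mul,
    fourier_stretch _ x (by positivity), mul_assoc, inv_mul_cancel_left₀ h]

lemma pair_lowpass_eq {f : 𝓢(ℝ, ℂ)} {j : ℤ} (hf : ∀ ξ, 𝓕 f ξ ≠ 0 → 2 ^ j * |ξ| ≤ 4 / 3) (x : ℝ) :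
    pair f (lowpass j x) = f x := by
  have e : 𝓕⁻ (𝓕 f : 𝓢(ℝ, ℂ)) = f := FourierTransform.fourierInv_fourier_eq f
  conv_rhs => rw [← e, SchwartzMap.fourierInv_coe, Real.fourierInv_eq']
  rw [← pair_fourier]
  refine integral_congr_ae (Filter.Eventually.of_forall fun ξ => ?_)
  by_cases hξ : 𝓕 f ξ = 0
  · simp [hξ]
  · have h2 : |(2 : ℝ) ^ j * ξ| ≤ 4 / 3 := by
      rw [abs_mul, abs_of_pos (by positivity)]; exact hf ξ hξ
    simp only [fourier_lowpass, exists_lowpass.choose_spec.1 _ h2, mul_one, ← Complex.exp_conj,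
      map_mul, Complex.conj_ofReal, Complex.conj_I, smul_eq_mul]
    rw [mul_comm]
    congr 2
    simp
    ring

lemma pair_lowpass_eq_zero {f : 𝓢(ℝ, ℂ)} {j : ℤ} (hf : ∀ ξ, 𝓕 f ξ ≠ 0 → 8 / 3 ≤ 2 ^ j * |ξ|)
    (x : ℝ) : pair f (lowpass j x) = 0 := by
  refine pair_eq_zero_of_disjoint fun ξ h1 h2 => h2 ?_
  have h3 : 8 / 3 ≤ |(2 : ℝ) ^ j * ξ| := by
    rw [abs_mul, abs_of_pos (by positivity : (0 : ℝ) < 2 ^ j)]; exact hf ξ h1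
  rw [fourier_lowpass, exists_lowpass.choose_spec.2 _ h3, mul_zero]

/-! ### Polynomial weights on the integers -/

/-- The weight `(1 + |n|)^{-p}`. -/
def wt (p : ℕ) (n : ℤ) : ℝ≥0∞ := ENNReal.ofReal (((1 + |(n : ℝ)|) ^ p)⁻¹)

/-- The total mass of the weight `wt p`. -/
def wtSum (p : ℕ) : ℝ≥0∞ := ∑' n : ℤ, wt p n

lemma wt_neg (p : ℕ) (n : ℤ) : wt p (-n) = wt p n := by simp [wt]

lemma wt_sub_comm (p : ℕ) (m n : ℤ) : wt p (m - n) = wt p (n - m) := by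
  rw [← wt_neg, neg_sub]

lemma wt_add (p q : ℕ) (n : ℤ) : wt (p + q) n = wt p n * wt q n := by
  rw [wt, pow_add, mul_inv, ENNReal.ofReal_mul (by positivity)]; rfl

lemma wt_mul_wt_le (p : ℕ) (a b m : ℤ) : wt p (a - m) * wt p (b - m) ≤ wt p (a - b) := by
  unfold wt
  rw [← ENNReal.ofReal_mul (by positivity), ← mul_inv, ← mul_pow]
  apply ENNReal.ofReal_le_ofReal
  gcongr
  push_cast
  have : |(a : ℝ) - b| ≤ |(a : ℝ) - m| + |(b : ℝ) - m| := by
    have := abs_sub (a - m : ℝ) (b - m : ℝ)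
    simpa using this
  nlinarith [abs_nonneg ((a : ℝ) - m), abs_nonneg ((b : ℝ) - m),
    mul_nonneg (abs_nonneg ((a : ℝ) - m)) (abs_nonneg ((b : ℝ) - m))]

lemma wtSum_ne_top {p : ℕ} (hp : 2 ≤ p) : wtSum p ≠ ∞ := by
  have h2 : Summable (fun n : ℤ => ((1 + |(n : ℝ)|) ^ p)⁻¹) := by
    have h3 : Summable (fun n : ℕ => ((1 + (n : ℝ)) ^ p)⁻¹) := by
      have := (summable_nat_add_iff 1).2 (Real.summable_nat_pow_inv.2 (show 1 < p by lia))
      refine this.congr fun n => ?_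
      push_cast
      rw [add_comm]
    refine Summable.of_nat_of_neg ?_ ?_ <;> simpa using h3
  exact h2.tsum_ofReal_ne_top

lemma tsum_wt_comp_le {ι : Type*} (p : ℕ) {g : ι → ℤ} (hg : Function.Injective g) :
    ∑' n, wt p (g n) ≤ wtSum p := ENNReal.tsum_comp_le_tsum_of_injective hg _

lemma tsum_wt_sub (p : ℕ) (m : ℤ) : ∑' n, wt p (n - m) = wtSum p :=
  (Equiv.subRight m).tsum_eq (wt p)

lemma tsum_wt_sub' (p : ℕ) (m : ℤ) : ∑' n, wt p (m - n) = wtSum p :=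
  (Equiv.subLeft m).tsum_eq (wt p)

/-- One power of decay pays for the factor `2|t| + 1` lost in `IsCarleson.shift`. -/
lemma wt_succ_mul_le (p : ℕ) (t : ℤ) :
    wt (p + 1) t * ((2 * |t| + 1 : ℤ).toNat : ℝ≥0∞) ≤ 2 * wt p t := by
  have h : (((2 * |t| + 1 : ℤ).toNat : ℕ) : ℝ≥0∞) = ENNReal.ofReal (2 * |(t : ℝ)| + 1) := by
    rw [← ENNReal.ofReal_natCast]
    congr 1
    have h0 : (0 : ℤ) ≤ 2 * |t| + 1 := by positivity
    have h1 : (((2 * |t| + 1).toNat : ℤ) : ℝ) = ((2 * |t| + 1 : ℤ) : ℝ) := by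
      rw [Int.toNat_of_nonneg h0]
    push_cast at h1
    exact h1
  have h2 : wt 1 t * ENNReal.ofReal (2 * |(t : ℝ)| + 1) ≤ 2 := by
    rw [wt, ← ENNReal.ofReal_mul (by positivity), show (2 : ℝ≥0∞) = ENNReal.ofReal 2 by simp]
    apply ENNReal.ofReal_le_ofReal
    rw [pow_one, inv_mul_le_iff₀ (by positivity)]
    linarith
  rw [wt_add, mul_assoc, h, mul_comm 2 (wt p t)]
  gcongr

lemma sq_tsum_mul_le_mul_tsum_sq {ι : Type*} (f g : ι → ℝ≥0∞) :
    (∑' i, f i * g i) ^ 2 ≤ (∑' i, f i ^ 2) * ∑' i, g i ^ 2 := by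
  let _ : MeasurableSpace ι := ⊤
  have := ENNReal.lintegral_mul_le_Lp_mul_Lq (Measure.count : Measure ι)
    (p := 2) (q := 2) (by constructor <;> norm_num) (f := f) (g := g)
    (Measurable.of_discrete).aemeasurable (Measurable.of_discrete).aemeasurable
  simp only [Pi.mul_apply, lintegral_count, ENNReal.rpow_two] at this
  calc _ ≤ _ := pow_le_pow_left' this 2
    _ = _ := by
      rw [mul_pow, ← ENNReal.rpow_two, ← ENNReal.rpow_two, ← ENNReal.rpow_mul, ← ENNReal.rpow_mul]
      norm_num

lemma sq_tsum_weight_mul_le {ι : Type*} (c a : ι → ℝ≥0∞) :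
    (∑' i, c i * a i) ^ 2 ≤ (∑' i, c i) * ∑' i, c i * a i ^ 2 := by
  have h : ∀ x : ℝ≥0∞, (x ^ (1 / 2 : ℝ)) ^ 2 = x := fun x => by
    rw [← ENNReal.rpow_two, ← ENNReal.rpow_mul]; norm_num
  have := sq_tsum_mul_le_mul_tsum_sq (fun i => c i ^ (1 / 2 : ℝ)) (fun i => c i ^ (1 / 2 : ℝ) * a i)
  simp only [mul_pow, h, ← mul_assoc, ← sq] at this
  exact this

/-! ### Step functions at a dyadic scale -/

/-- The index of the dyadic interval of length `2^j` that contains `x`. -/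
def idx (j : ℤ) (x : ℝ) : ℤ := ⌊x / 2 ^ j⌋

lemma mem_interval_iff_idx (j m : ℤ) (x : ℝ) : x ∈ interval (j, m) ↔ idx j x = m :=
  mem_interval_iff j m x

lemma lintegral_step_mul (j : ℤ) (g : ℤ → ℝ≥0∞) {f : ℝ → ℝ≥0∞}
    (hf : AEMeasurable f) : ∫⁻ x, g (idx j x) * f x = ∑' m, g m * (vol j * avg f j m) := by
  rw [← tsum_lintegral_interval _ j]
  refine tsum_congr fun m => ?_
  rw [setLIntegral_congr_fun (g := fun x => g m * f x) (measurableSet_interval _) fun x hx => by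
    simp only [(mem_interval_iff_idx j m x).1 hx]]
  rw [avg, ENNReal.mul_div_cancel (vol_ne_zero j) (vol_ne_top j)]
  exact lintegral_const_mul'' _ hf.restrict

lemma lintegral_step (j : ℤ) (g : ℤ → ℝ≥0∞) : ∫⁻ x, g (idx j x) = vol j * ∑' m, g m := by
  have := lintegral_step_mul j g (f := 1) aemeasurable_const
  simp only [Pi.one_apply, mul_one] at this
  rw [this, ← ENNReal.tsum_mul_left]
  refine tsum_congr fun m => ?_
  rw [avg]
  simp only [Pi.one_apply, lintegral_one, Measure.restrict_apply_univ, volume_interval]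
  rw [ENNReal.div_self (vol_ne_zero j) (vol_ne_top j), mul_one, mul_comm]

/-! ### Pointwise bounds for dilates -/

/-- The normalizing factor `2^{-j/2}`. -/
def isq (j : ℤ) : ℝ≥0∞ := ENNReal.ofReal (Real.sqrt ((2 : ℝ) ^ j))⁻¹

lemma isq_ne_top (j : ℤ) : isq j ≠ ∞ := ENNReal.ofReal_ne_top

lemma isq_sq_mul_vol (j : ℤ) : isq j ^ 2 * vol j = 1 := by
  rw [isq, vol, ← ENNReal.ofReal_pow (by positivity), ← ENNReal.ofReal_mul (by positivity), inv_pow,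
    Real.sq_sqrt (by positivity), inv_mul_cancel₀ (by positivity), ENNReal.ofReal_one]

lemma isq_anti {j k : ℤ} (h : j ≤ k) : isq k ≤ isq j := by
  apply ENNReal.ofReal_le_ofReal
  gcongr
  norm_num

lemma schwartz_decay (f : 𝓢(ℝ, ℂ)) (p : ℕ) : ∃ A : ℝ, 0 ≤ A ∧
    ∀ y, ‖f y‖ ≤ A * ((1 + |y|) ^ p)⁻¹ := by
  refine ⟨2 ^ p * (Finset.Iic (p, 0)).sup (fun m => SchwartzMap.seminorm ℂ m.1 m.2) f, by positivity,
    fun y => ?_⟩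
  have := SchwartzMap.one_add_le_sup_seminorm_apply (𝕜 := ℂ) (m := (p, 0)) le_rfl le_rfl f y
  rwa [norm_iteratedFDeriv_zero, mul_comm, ← le_div_iff₀ (by positivity)] at this

/-- A function at scale `2^{j+i}` is measured on the finer grid of scale `2^j`, so that factors of
different scales can be compared on one grid; the constant depends on `i` but not on `j`. -/
lemma exists_stretch_bound (f : 𝓢(ℝ, ℂ)) (p i : ℕ) {D : ℝ} (hD : 0 ≤ D) :
    ∃ C : ℝ≥0, ∀ (j q : ℤ) (a x : ℝ), |q - a / 2 ^ j| ≤ D →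
      ‖f ((x - a) / 2 ^ (j + i))‖ₑ ≤ C * wt p (q - idx j x) := by
  obtain ⟨A, hA, hf⟩ := schwartz_decay f p
  -- The index distance is at most `D + 2^i |y| + 1`: offset of `q`, rescaled argument, rounding.
  -- Adding 1 gives at most `E (1 + |y|)`.
  set E : ℝ := D + 2 + 2 ^ i with hE
  refine ⟨(A * E ^ p).toNNReal, fun j q a x hq => ?_⟩
  set y := (x - a) / 2 ^ (j + i) with hy
  have hj : (0 : ℝ) < 2 ^ j := by positivity
  have e1 : x / 2 ^ j - a / 2 ^ j = 2 ^ i * y := by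
    rw [hy, zpow_add₀ (by norm_num), zpow_natCast]
    field_simp
  have h1 : |x / 2 ^ j - idx j x| ≤ 1 := by
    unfold idx
    rw [abs_le]
    constructor <;> linarith [Int.floor_le (x / 2 ^ j), Int.lt_floor_add_one (x / 2 ^ j)]
  have h2 : |((q - idx j x : ℤ) : ℝ)| ≤ D + 2 ^ i * |y| + 1 := by
    have e2 : ((q - idx j x : ℤ) : ℝ)
        = (q - a / 2 ^ j) - 2 ^ i * y + (x / 2 ^ j - idx j x) := by
      rw [← e1]; push_cast; ring
    rw [e2]
    calc _ ≤ |(q - a / 2 ^ j) - 2 ^ i * y| + |x / 2 ^ j - idx j x| := abs_add_le _ _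
      _ ≤ |q - a / 2 ^ j| + |2 ^ i * y| + |x / 2 ^ j - idx j x| := by
        gcongr; exact abs_sub _ _
      _ ≤ _ := by
        rw [abs_mul, abs_of_pos (by positivity : (0 : ℝ) < 2 ^ i)]
        gcongr
  have h3 : 1 + |((q - idx j x : ℤ) : ℝ)| ≤ E * (1 + |y|) := by
    have := abs_nonneg y
    have := mul_nonneg hD this
    have hi : (0 : ℝ) < 2 ^ i := by positivity
    rw [hE]
    nlinarith
  have h4 : ((1 + |y|) ^ p)⁻¹ ≤ E ^ p * ((1 + |((q - idx j x : ℤ) : ℝ)|) ^ p)⁻¹ := by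
    rw [inv_le_iff_one_le_mul₀ (by positivity), mul_right_comm, ← div_eq_mul_inv,
      one_le_div (by positivity), ← mul_pow]
    gcongr
  rw [← ofReal_norm, wt]
  change _ ≤ ENNReal.ofReal (A * E ^ p) * _
  rw [← ENNReal.ofReal_mul (by positivity), mul_assoc]
  apply ENNReal.ofReal_le_ofReal
  exact (hf y).trans (by gcongr)

lemma exists_dil_bound (f : 𝓢(ℝ, ℂ)) (p i : ℕ) : ∃ C : ℝ≥0, ∀ (j n : ℤ) (x : ℝ),
    ‖dil f (j + i, n) x‖ₑ ≤ C * isq j * wt p (2 ^ i * n - idx j x) := by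
  obtain ⟨C, hC⟩ := exists_stretch_bound f p i (D := 2 ^ i) (by positivity)
  refine ⟨C, fun j n x => ?_⟩
  have h := hC j (2 ^ i * n) (center (j + i, n)) x ?_
  · rw [dil, enorm_mul]
    have h1 : ‖(((Real.sqrt (len (j + i, n)))⁻¹ : ℝ) : ℂ)‖ₑ ≤ isq j := by
      refine le_trans (le_of_eq ?_) (isq_anti (show j ≤ j + i by lia))
      rw [← ofReal_norm, Complex.norm_real, Real.norm_of_nonneg (by positivity)]
      rfl
    calc _ ≤ isq j * (C * wt p (2 ^ i * n - idx j x)) := mul_le_mul' h1 h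
      _ = _ := by ring
  · have hj : (0 : ℝ) < 2 ^ j := by positivity
    have e : ((2 ^ i * n : ℤ) : ℝ) - center (j + i, n) / 2 ^ j = -(2 ^ i / 2) := by
      simp only [center]
      rw [zpow_add₀ (by norm_num), zpow_natCast]
      push_cast
      field_simp
      ring
    rw [e, abs_neg, abs_of_pos (by positivity)]
    linarith [show (0 : ℝ) < 2 ^ i by positivity]

lemma exists_lowpass_bound (p i : ℕ) : ∃ C : ℝ≥0, ∀ (j : ℤ) (x y : ℝ),
    ‖lowpass (j + i) x y‖ₑ ≤ C * isq j ^ 2 * wt p (idx j x - idx j y) := by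
  obtain ⟨C, hC⟩ := exists_stretch_bound exists_lowpass.choose p i (D := 1) (by positivity)
  refine ⟨C, fun j x y => ?_⟩
  have h := hC j (idx j x) x y ?_
  · have e : lowpass (j + i) x y = (((2 : ℝ) ^ (j + i) : ℝ) : ℂ)⁻¹ *
        exists_lowpass.choose ((y - x) / 2 ^ (j + i)) := rfl
    rw [e, enorm_mul]
    have h1 : ‖(((2 : ℝ) ^ (j + i) : ℝ) : ℂ)⁻¹‖ₑ ≤ isq j ^ 2 := by
      refine le_trans (le_of_eq ?_) (pow_le_pow_left' (isq_anti (show j ≤ j + i by lia)) 2)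
      rw [← ofReal_norm, norm_inv, Complex.norm_real, Real.norm_of_nonneg (by positivity), isq,
        ← ENNReal.ofReal_pow (by positivity), inv_pow, Real.sq_sqrt (by positivity)]
    calc _ ≤ isq j ^ 2 * (C * wt p (idx j x - idx j y)) := mul_le_mul' h1 h
      _ = _ := by ring
  · unfold idx
    rw [abs_le]
    constructor <;> linarith [Int.floor_le (x / 2 ^ j), Int.lt_floor_add_one (x / 2 ^ j)]

/-- Of the `p + 2` powers of decay of `F`, `p` are spent on the separation `a - b` through
`wt_mul_wt_le`, and two on integrability in `x`. -/
lemma enorm_pair_le {F G : ℝ → ℂ} {A B : ℝ≥0∞} {p : ℕ} {j a b : ℤ}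
    (hF : ∀ x, ‖F x‖ₑ ≤ A * wt (p + 2) (a - idx j x)) (hG : ∀ x, ‖G x‖ₑ ≤ B * wt p (b - idx j x)) :
    ‖pair F G‖ₑ ≤ A * B * vol j * wtSum 2 * wt p (a - b) := by
  calc ‖pair F G‖ₑ ≤ ∫⁻ x, ‖F x * conj (G x)‖ₑ := enorm_integral_le_lintegral_enorm _
    _ ≤ ∫⁻ x, A * B * wt p (a - b) * wt 2 (a - idx j x) := by
        refine lintegral_mono fun x => ?_
        have hc : ‖conj (G x)‖ₑ = ‖G x‖ₑ := by
          rw [← ofReal_norm, RCLike.norm_conj, ofReal_norm]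
        rw [enorm_mul, hc]
        calc _ ≤ (A * wt (p + 2) (a - idx j x)) * (B * wt p (b - idx j x)) :=
              mul_le_mul' (hF x) (hG x)
          _ = A * B * (wt p (a - idx j x) * wt p (b - idx j x)) * wt 2 (a - idx j x) := by
              rw [wt_add]; ring
          _ ≤ _ := by gcongr; exact wt_mul_wt_le _ _ _ _
    _ = vol j * ∑' m, A * B * wt p (a - b) * wt 2 (a - m) :=
        lintegral_step j (fun m => A * B * wt p (a - b) * wt 2 (a - m))
    _ = _ := by
        rw [ENNReal.tsum_mul_left, tsum_wt_sub']; ring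

/-! ### Pointwise limits of series in `L²` -/

/-- Convergence in `L²` gives a sequence of partial sums converging almost everywhere; its limit
must be the pointwise sum. -/
lemma ae_eq_of_hasSum {ι : Type*} [Countable ι] {G : ι → Lp ℂ 2 (volume : Measure ℝ)}
    {f : ι → ℝ → ℂ} {F : Lp ℂ 2 (volume : Measure ℝ)} {g : ℝ → ℂ} (hG : HasSum G F)
    (hf : ∀ i, G i =ᵐ[volume] f i) (hg : ∀ᵐ x, HasSum (fun i => f i x) (g x)) :
    F =ᵐ[volume] g := by
  obtain ⟨s, hs, h1⟩ := (tendstoInMeasure_of_tendsto_Lp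
    (show Filter.Tendsto (fun s : Finset ι => ∑ i ∈ s, G i) Filter.atTop (nhds F) from hG)
    ).exists_seq_tendsto_ae'
  have h2 : ∀ᵐ x, ∀ n, (∑ i ∈ s n, G i : Lp ℂ 2 (volume : Measure ℝ)) x = ∑ i ∈ s n, f i x := by
    rw [ae_all_iff]
    intro n
    have h3 : ∀ᵐ x, ∀ i, G i x = f i x := ae_all_iff.2 hf
    filter_upwards [Lp.coeFn_finsetSum (s n) G, h3] with x h4 h5
    rw [h4, Finset.sum_apply]
    exact Finset.sum_congr rfl fun i _ => h5 i
  filter_upwards [h1, h2, hg] with x h1 h2 hg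
  simp only [h2] at h1
  exact tendsto_nhds_unique h1 (hg.comp hs)

/-! ### The Carleson condition for wavelet coefficients -/

lemma isCarleson_bmo (w b : ℝ → ℂ) :
    IsCarleson (fun k n => ‖pair b (dil w (k, n))‖ₑ ^ 2) (bmoNorm w b ^ 2) := by
  intro N k n
  set a : Dyadic → ℝ≥0∞ := fun I => ‖pair b (dil w I)‖ₑ ^ 2
  have hk : (0 : ℝ) < 2 ^ k := by positivity
  set α : ℝ := n * 2 ^ k
  set β : ℝ := (n + 1) * 2 ^ k
  have hαβ : β - α = 2 ^ k := by simp only [α, β]; ring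
  have h1 : ((vol k)⁻¹ * ∑' I : {I : Dyadic // interval I ⊆ Set.Icc α β}, a I) ^ (1 / 2 : ℝ)
      ≤ bmoNorm w b := by
    have := le_iSup₂_of_le (f := fun (α : ℝ) (β : ℝ) => ⨆ (_ : α < β),
      ((ENNReal.ofReal (β - α))⁻¹ *
      ∑' I : {I : Dyadic // interval I ⊆ Set.Icc α β}, ‖pair b (dil w I)‖ₑ ^ 2) ^ (1 / 2 : ℝ)) α β
      (le_iSup_of_le (show α < β by linarith) le_rfl)
    rw [hαβ] at this
    exact this
  have h2 : ∑' I : {I : Dyadic // interval I ⊆ Set.Icc α β}, a I ≤ bmoNorm w b ^ 2 * vol k := by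
    have h3 := pow_le_pow_left' h1 2
    rw [← ENNReal.rpow_two, ← ENNReal.rpow_mul] at h3
    norm_num at h3
    rwa [mul_comm, ← div_eq_mul_inv, ENNReal.div_le_iff (vol_ne_zero k) (vol_ne_top k)] at h3
  refine le_trans ?_ h2
  set s : Finset ((_ : ℕ) × ℤ) := (Finset.range N).sigma
    fun d => Finset.Ico (2 ^ d * n) (2 ^ d * (n + 1))
  have h4 : ∑ d ∈ Finset.range N, levelSum (fun k n => a (k, n)) d k n
      = ∑ p ∈ s, a (k - p.1, p.2) := by
    rw [Finset.sum_sigma]; rfl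
  have hinj : Set.InjOn (fun p : (_ : ℕ) × ℤ => ((k - p.1, p.2) : Dyadic)) s := by
    rintro ⟨d, m⟩ _ ⟨d', m'⟩ _ h
    simp only [Prod.mk.injEq, sub_right_inj, Nat.cast_inj] at h
    obtain ⟨rfl, rfl⟩ := h
    rfl
  change ∑ d ∈ Finset.range N, levelSum (fun k n => a (k, n)) d k n ≤ _
  have h5 : ∑' I : {I : Dyadic // interval I ⊆ Set.Icc α β}, a I
      = ∑' I, Set.indicator {I : Dyadic | interval I ⊆ Set.Icc α β} a I :=
    tsum_subtype {I : Dyadic | interval I ⊆ Set.Icc α β} a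
  rw [h4, ← Finset.sum_image (f := a) hinj, h5]
  refine le_trans (le_of_eq ?_) (ENNReal.sum_le_tsum
    (s.image fun p : (_ : ℕ) × ℤ => ((k - p.1, p.2) : Dyadic)))
  refine Finset.sum_congr rfl fun I hI => ?_
  rw [Set.indicator_of_mem]
  rw [Finset.mem_image] at hI
  obtain ⟨⟨d, m⟩, hp, rfl⟩ := hI
  simp only [s, Finset.mem_sigma, Finset.mem_Ico] at hp
  obtain ⟨-, hm1, hm2⟩ := hp
  have hd : (0 : ℝ) < 2 ^ (k - (d : ℤ)) := by positivity
  have e : (2 : ℝ) ^ k = 2 ^ d * 2 ^ (k - (d : ℤ)) := by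
    rw [← zpow_natCast, ← zpow_add₀ (by norm_num)]; congr 1; ring
  intro x hx
  simp only [interval, Set.mem_Ico] at hx
  have hm1' : (2 : ℝ) ^ d * n ≤ m := by exact_mod_cast hm1
  have hm2' : (m : ℝ) + 1 ≤ 2 ^ d * (n + 1) := by exact_mod_cast hm2
  simp only [α, β, e, Set.mem_Icc]
  constructor <;> nlinarith [hx.1, hx.2]

lemma exists_coeff_bound (f g : 𝓢(ℝ, ℂ)) (p i : ℕ) : ∃ C : ℝ≥0, ∀ j m n : ℤ,
    ‖pair (dil f (j, m)) (dil g (j + i, n))‖ₑ ≤ C * wt p (2 ^ i * n - m) := by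
  obtain ⟨A, hA⟩ := exists_dil_bound f (p + 2) 0
  obtain ⟨B, hB⟩ := exists_dil_bound g p i
  refine ⟨A * B * (wtSum 2).toNNReal, fun j m n => ?_⟩
  have h := enorm_pair_le (F := dil f (j, m)) (G := dil g (j + i, n)) (a := m) (fun x => by
    simpa using hA j m x) (hB j n)
  refine h.trans (le_of_eq ?_)
  push_cast
  rw [ENNReal.coe_toNNReal (wtSum_ne_top le_rfl), wt_sub_comm]
  calc _ = A * B * (isq j ^ 2 * vol j) * wtSum 2 * wt p (2 ^ i * n - m) := by ring
    _ = _ := by rw [isq_sq_mul_vol]; ring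

lemma pair_conj_symm (f g : ℝ → ℂ) : pair f g = conj (pair g f) := by
  rw [pair, pair, ← integral_conj]
  refine integral_congr_ae (Filter.Eventually.of_forall fun x => ?_)
  simp [mul_comm]

lemma enorm_pair_comm (f g : ℝ → ℂ) : ‖pair f g‖ₑ = ‖pair g f‖ₑ := by
  rw [pair_conj_symm, ← ofReal_norm, RCLike.norm_conj, ofReal_norm]

/-! ### The matrix `⟨u_I, w_{I'}⟩` -/

namespace IsMeyerWavelet
variable {w : 𝓢(ℝ, ℂ)} (hw : IsMeyerWavelet w)
include hw

lemma pair_u_eq_zero {j k : ℤ} (h : j + 2 ≤ k ∨ k + 2 ≤ j) (m n : ℤ) :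
    pair (dil hw.u (j, m)) (dil w (k, n)) = 0 := by
  rw [← coe_dilS, ← coe_dilS]
  refine pair_eq_zero_of_disjoint fun ξ h1 h2 => ?_
  have h1 := hw.fourier_dilS_u_supp h1
  have h2 := hw.fourier_dilS_supp h2
  have hj : (0 : ℝ) < 2 ^ j := by positivity
  have hk : (0 : ℝ) < 2 ^ k := by positivity
  have hξ : ξ < 0 := by
    by_contra hcon
    push Not at hcon
    nlinarith [h1.2, mul_nonneg hj.le hcon]
  rw [abs_of_neg hξ] at h2
  rcases h with h | h
  · have : (2 : ℝ) ^ j * 4 ≤ 2 ^ k := by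
      calc (2 : ℝ) ^ j * 4 = 2 ^ (j + 2) := by rw [zpow_add₀ (by norm_num)]; norm_num
        _ ≤ _ := zpow_le_zpow_right₀ (by norm_num) h
    nlinarith [h1.1, h1.2, h2.1, h2.2]
  · have : (2 : ℝ) ^ k * 4 ≤ 2 ^ j := by
      calc (2 : ℝ) ^ k * 4 = 2 ^ (k + 2) := by rw [zpow_add₀ (by norm_num)]; norm_num
        _ ≤ _ := zpow_le_zpow_right₀ (by norm_num) h
    nlinarith [h1.1, h1.2, h2.1, h2.2]

lemma tsum_coeff_mul (j m : ℤ) (G : Dyadic → ℝ≥0∞) :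
    ∑' I, ‖pair (dil hw.u (j, m)) (dil w I)‖ₑ * G I
      = (∑' n, ‖pair (dil hw.u (j, m)) (dil w (j + 1, n))‖ₑ * G (j + 1, n))
        + (∑' n, ‖pair (dil hw.u (j, m)) (dil w (j, n))‖ₑ * G (j, n))
        + ∑' n, ‖pair (dil hw.u (j, m)) (dil w (j - 1, n))‖ₑ * G (j - 1, n) := by
  rw [ENNReal.tsum_prod', tsum_eq_sum (s := {j + 1, j, j - 1})]
  · rw [Finset.sum_insert, Finset.sum_insert, Finset.sum_singleton, add_assoc]
    · simpa using by lia
    · simpa using by lia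
  · intro k hk
    simp only [Finset.mem_insert, Finset.mem_singleton, not_or] at hk
    have : j + 2 ≤ k ∨ k + 2 ≤ j := by lia
    simp [hw.pair_u_eq_zero this]

lemma exists_coeff_decay (p : ℕ) : ∃ C : ℝ≥0, ∀ j m n : ℤ,
    ‖pair (dil hw.u (j, m)) (dil w (j + 1, n))‖ₑ ≤ C * wt p (2 * n - m) ∧
    ‖pair (dil hw.u (j, m)) (dil w (j, n))‖ₑ ≤ C * wt p (n - m) ∧
    ‖pair (dil hw.u (j, m)) (dil w (j - 1, n))‖ₑ ≤ C * wt p (2 * m - n) := by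
  obtain ⟨A, hA⟩ := exists_coeff_bound hw.u w p 1
  obtain ⟨B, hB⟩ := exists_coeff_bound hw.u w p 0
  obtain ⟨D, hD⟩ := exists_coeff_bound w hw.u p 1
  refine ⟨A + B + D, fun j m n => ⟨?_, ?_, ?_⟩⟩
  · refine (by simpa using hA j m n : _ ≤ A * wt p (2 * n - m)).trans ?_
    gcongr
    exact (le_add_right le_rfl : A ≤ A + B).trans (le_add_right le_rfl)
  · refine (by simpa using hB j m n : _ ≤ B * wt p (n - m)).trans ?_
    gcongr
    exact (le_add_left le_rfl : B ≤ A + B).trans (le_add_right le_rfl)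
  · rw [enorm_pair_comm]
    refine (by simpa using hD (j - 1) n m : _ ≤ D * wt p (2 * m - n)).trans ?_
    gcongr
    exact le_add_left le_rfl

end IsMeyerWavelet

/-! ### Expansion of the coefficients `⟨b, u_I⟩` -/

/-- Two of the four powers of decay absorb the growth `(1 + |n|)²` that the weight `1 + x²`
produces; the other two keep the sum finite. -/
lemma wt_mul_sq_le {n σ : ℤ} {M : ℝ}
    (h : 1 + |(n : ℝ)| ≤ (1 + |(σ : ℝ)|) * (1 + M)) :
    wt 4 σ * ENNReal.ofReal ((1 + |(n : ℝ)|) ^ 2) ≤ ENNReal.ofReal ((1 + M) ^ 2) * wt 2 σ := by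
  have h4 : wt 4 σ = wt 2 σ * wt 2 σ := wt_add 2 2 σ
  have h1 : wt 2 σ * ENNReal.ofReal ((1 + |(n : ℝ)|) ^ 2) ≤ ENNReal.ofReal ((1 + M) ^ 2) := by
    rw [wt, ← ENNReal.ofReal_mul (by positivity)]
    apply ENNReal.ofReal_le_ofReal
    rw [inv_mul_le_iff₀ (by positivity), ← mul_pow]
    gcongr
  calc _ = wt 2 σ * (wt 2 σ * ENNReal.ofReal ((1 + |(n : ℝ)|) ^ 2)) := by rw [h4]; ring
    _ ≤ wt 2 σ * ENNReal.ofReal ((1 + M) ^ 2) := by gcongr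
    _ = _ := mul_comm _ _

lemma exists_weighted_dil_bound (f : 𝓢(ℝ, ℂ)) (k : ℤ) : ∃ A : ℝ≥0, ∀ (n : ℤ) (x : ℝ),
    ‖dil f (k, n) x‖ₑ * ENNReal.ofReal (1 + x ^ 2)
      ≤ A * ENNReal.ofReal ((1 + |(n : ℝ)|) ^ 2) := by
  obtain ⟨C, hC⟩ := exists_dil_bound f 2 0
  have hk : (0 : ℝ) < 2 ^ k := by positivity
  refine ⟨C * (isq k).toNNReal * ((1 + 2 ^ k) ^ 2 : ℝ).toNNReal, fun n x => ?_⟩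
  have h1 : ‖dil f (k, n) x‖ₑ ≤ C * isq k * wt 2 (n - idx k x) := by simpa using hC k n x
  have h2 : wt 2 (n - idx k x) * ENNReal.ofReal (1 + x ^ 2)
      ≤ ENNReal.ofReal ((1 + 2 ^ k) ^ 2) * ENNReal.ofReal ((1 + |(n : ℝ)|) ^ 2) := by
    rw [wt, ← ENNReal.ofReal_mul (by positivity), ← ENNReal.ofReal_mul (by positivity)]
    apply ENNReal.ofReal_le_ofReal
    rw [inv_mul_le_iff₀ (by positivity), ← mul_pow, ← mul_pow]
    have h3 : |x| ≤ 2 ^ k * (|(idx k x : ℝ)| + 1) := by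
      have e : x = 2 ^ k * (x / 2 ^ k) := by field_simp
      have h4 : |x / 2 ^ k| ≤ |(idx k x : ℝ)| + 1 := by
        have a1 := Int.floor_le (x / 2 ^ k)
        have a2 := Int.lt_floor_add_one (x / 2 ^ k)
        unfold idx
        have a3 := le_abs_self ((⌊x / 2 ^ k⌋ : ℤ) : ℝ)
        have a4 := neg_abs_le ((⌊x / 2 ^ k⌋ : ℤ) : ℝ)
        rw [abs_le]
        constructor <;> linarith
      calc |x| = 2 ^ k * |x / 2 ^ k| := by
            rw [abs_div, abs_of_pos hk]; field_simp
        _ ≤ _ := by gcongr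
    have h5 : |(idx k x : ℝ)| ≤ |(n : ℝ)| + |((n - idx k x : ℤ) : ℝ)| := by
      have e : (idx k x : ℝ) = n - ((n - idx k x : ℤ) : ℝ) := by push_cast; ring
      calc |(idx k x : ℝ)| = |(n : ℝ) - ((n - idx k x : ℤ) : ℝ)| := by rw [← e]
        _ ≤ _ := abs_sub _ _
    have h6 : 1 + |x| ≤ (1 + |((n - idx k x : ℤ) : ℝ)|) * ((1 + 2 ^ k) * (1 + |(n : ℝ)|)) := by
      set N := |(n : ℝ)|
      set S := |((n - idx k x : ℤ) : ℝ)|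
      have hN : 0 ≤ N := abs_nonneg _
      have hS : 0 ≤ S := abs_nonneg _
      have h7 : 1 + |x| ≤ (1 + 2 ^ k) * (1 + (N + S)) := by nlinarith
      have h8 : 1 + (N + S) ≤ (1 + S) * (1 + N) := by nlinarith [mul_nonneg hN hS]
      calc _ ≤ _ := h7
        _ ≤ (1 + 2 ^ k) * ((1 + S) * (1 + N)) := by gcongr
        _ = _ := by ring
    calc 1 + x ^ 2 = 1 + |x| ^ 2 := by rw [sq_abs]
      _ ≤ (1 + |x|) ^ 2 := by nlinarith [abs_nonneg x]
      _ ≤ _ := by gcongr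
  push_cast
  rw [ENNReal.coe_toNNReal (isq_ne_top k)]
  change _ ≤ C * isq k * ENNReal.ofReal ((1 + 2 ^ k) ^ 2) * ENNReal.ofReal ((1 + |(n : ℝ)|) ^ 2)
  calc _ ≤ C * isq k * wt 2 (n - idx k x) * ENNReal.ofReal (1 + x ^ 2) := by gcongr
    _ = C * isq k * (wt 2 (n - idx k x) * ENNReal.ofReal (1 + x ^ 2)) := by ring
    _ ≤ C * isq k * (ENNReal.ofReal ((1 + 2 ^ k) ^ 2) * ENNReal.ofReal ((1 + |(n : ℝ)|) ^ 2)) := by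
        gcongr
    _ = _ := by ring

lemma two_mul_sub_injective (m : ℤ) : Function.Injective fun n : ℤ => 2 * n - m :=
  fun _ _ h => by simpa using h

namespace IsMeyerWavelet
variable {w : 𝓢(ℝ, ℂ)} (hw : IsMeyerWavelet w)
include hw

lemma exists_summable_majorant (I : Dyadic) : ∃ s : Dyadic → ℝ≥0∞, ∑' I', s I' ≠ ∞ ∧
    ∀ I' x, ‖pair (dil hw.u I) (dil w I')‖ₑ * (‖dil w I' x‖ₑ * ENNReal.ofReal (1 + x ^ 2))
      ≤ s I' := by
  obtain ⟨j, m⟩ := I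
  choose A hA using exists_weighted_dil_bound w
  obtain ⟨C, hC⟩ := hw.exists_coeff_decay 4
  refine ⟨fun I' => ‖pair (dil hw.u (j, m)) (dil w I')‖ₑ *
    (A I'.1 * ENNReal.ofReal ((1 + |(I'.2 : ℝ)|) ^ 2)), ?_, fun I' x => by
      exact mul_le_mul' le_rfl (hA I'.1 I'.2 x)⟩
  rw [hw.tsum_coeff_mul]
  have key : ∀ (k : ℤ) (M : ℝ) (σ : ℤ → ℤ), Function.Injective σ →
      (∀ n, ‖pair (dil hw.u (j, m)) (dil w (k, n))‖ₑ ≤ C * wt 4 (σ n)) →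
      (∀ n : ℤ, 1 + |(n : ℝ)| ≤ (1 + |(σ n : ℝ)|) * (1 + M)) →
      ∑' n : ℤ, ‖pair (dil hw.u (j, m)) (dil w (k, n))‖ₑ *
        (A k * ENNReal.ofReal ((1 + |(n : ℝ)|) ^ 2)) ≠ ∞ := by
    intro k M σ hσ h1 h2
    have h3 : ∑' n : ℤ, ‖pair (dil hw.u (j, m)) (dil w (k, n))‖ₑ *
        (A k * ENNReal.ofReal ((1 + |(n : ℝ)|) ^ 2))
        ≤ ∑' n : ℤ, C * A k * ENNReal.ofReal ((1 + M) ^ 2) * wt 2 (σ n) := by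
      refine ENNReal.tsum_le_tsum fun n => ?_
      calc _ ≤ C * wt 4 (σ n) * (A k * ENNReal.ofReal ((1 + |(n : ℝ)|) ^ 2)) := by
            gcongr; exact h1 n
        _ = C * A k * (wt 4 (σ n) * ENNReal.ofReal ((1 + |(n : ℝ)|) ^ 2)) := by ring
        _ ≤ C * A k * (ENNReal.ofReal ((1 + M) ^ 2) * wt 2 (σ n)) := by
            exact mul_le_mul' le_rfl (wt_mul_sq_le (h2 n))
        _ = _ := by ring
    refine ne_top_of_le_ne_top ?_ h3
    rw [ENNReal.tsum_mul_left]
    refine ENNReal.mul_ne_top (by finiteness) ?_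
    exact ne_top_of_le_ne_top (wtSum_ne_top le_rfl) (tsum_wt_comp_le 2 hσ)
  have bound : ∀ a s n : ℝ, |n| ≤ |s| + |a| → 1 + |n| ≤ (1 + |s|) * (1 + |a|) := fun a s n h => by
    nlinarith [mul_nonneg (abs_nonneg s) (abs_nonneg a)]
  refine ENNReal.add_ne_top.2 ⟨ENNReal.add_ne_top.2 ⟨?_, ?_⟩, ?_⟩
  · refine key (j + 1) |(m : ℝ)| (fun n => 2 * n - m) (two_mul_sub_injective m)
      (fun n => (hC j m n).1) fun n => bound _ _ _ ?_
    push_cast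
    have h1 : |2 * (n : ℝ)| ≤ |2 * (n : ℝ) - m| + |(m : ℝ)| := by
      simpa using abs_add_le (2 * (n : ℝ) - m) m
    rw [abs_mul, abs_two] at h1
    linarith [abs_nonneg (n : ℝ)]
  · refine key j |(m : ℝ)| (fun n => n - m) (sub_left_injective)
      (fun n => (hC j m n).2.1) fun n => bound _ _ _ ?_
    push_cast
    simpa using abs_add_le ((n : ℝ) - m) m
  · refine key (j - 1) |2 * (m : ℝ)| (fun n => 2 * m - n) (sub_right_injective)
      (fun n => (hC j m n).2.2) fun n => bound _ _ _ ?_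
    push_cast
    have := abs_sub (2 * (m : ℝ)) (2 * (m : ℝ) - n)
    rw [sub_sub_cancel] at this
    linarith

/-- Expand `u_I` in the basis `w_{I'}` and integrate against `b` term by term. As `b` need not be in
`L²`, the exchange is justified by the majorant weighted with `1 + x²`, which the integrability of
`b/(1+x²)` matches. -/
lemma enorm_pair_u_le {b : ℝ → ℂ} (hb : MemBMO w b) (I : Dyadic) :
    ‖pair b (dil hw.u I)‖ₑ
      ≤ ∑' I', ‖pair (dil hw.u I) (dil w I')‖ₑ * ‖pair b (dil w I')‖ₑ := by
  obtain ⟨s, hs, hle⟩ := hw.exists_summable_majorant I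
  set c : Dyadic → ℂ := fun I' => pair (dil hw.u I) (dil w I') with hc
  have hone : ∀ x : ℝ, 1 ≤ ENNReal.ofReal (1 + x ^ 2) := fun x => by
    rw [ENNReal.one_le_ofReal]; nlinarith [sq_nonneg x]
  have hsum : ∀ x, Summable fun I' => c I' * dil w I' x := by
    intro x
    apply Summable.of_norm
    rw [← summable_norm_iff] 
    have : ∑' I', ‖c I' * dil w I' x‖ₑ ≠ ∞ := by
      refine ne_top_of_le_ne_top hs (ENNReal.tsum_le_tsum fun I' => ?_)
      rw [enorm_mul]
      refine le_trans ?_ (hle I' x)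
      gcongr
      exact le_mul_of_one_le_right' (hone x)
    have h2 := ENNReal.summable_toReal this
    simpa using h2
  -- The expansion converges in `L²` to `u_I`, and absolutely at every point; the two limits agree
  -- almost everywhere.
  have hexp : ∀ᵐ x, ∑' I', c I' * dil w I' x = dil hw.u I x := by
    have h1 := ae_eq_of_hasSum (hw.hasSum_basis (dilS hw.u I))
      (f := fun I' x => c I' * dil w I' x) (g := fun x => ∑' I', c I' * dil w I' x)
      (fun I' => by
        filter_upwards [Lp.coeFn_smul (c I') ((dilS w I').toLp 2),
          (dilS w I').coeFn_toLp 2] with x h1 h2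
        refine Eq.trans h1 ?_
        rw [Pi.smul_apply, h2]; rfl)
      (Filter.Eventually.of_forall fun x => (hsum x).hasSum)
    filter_upwards [h1, (dilS hw.u I).coeFn_toLp 2] with x h2 h3
    rw [← h2, h3]; rfl
  have hbm : AEStronglyMeasurable b volume := by
    have h1 := hb.integrable_weight.aestronglyMeasurable.mul
      (Continuous.aestronglyMeasurable (f := fun x : ℝ => ((1 + x ^ 2 : ℝ) : ℂ)) (by fun_prop))
    refine h1.congr (Filter.Eventually.of_forall fun x => ?_)
    have : ((1 + x ^ 2 : ℝ) : ℂ) ≠ 0 := by rw [Complex.ofReal_ne_zero]; positivity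
    simp only [Pi.mul_apply]
    rw [div_mul_cancel₀ _ this]
  set F : Dyadic → ℝ → ℂ := fun I' x => b x * conj (c I' * dil w I' x) with hF
  have hFm : ∀ I', AEStronglyMeasurable (F I') volume := fun I' => by
    refine hbm.mul (Continuous.aestronglyMeasurable ?_)
    have : Continuous (dil w I') := (dilS w I').continuous
    fun_prop
  have hFb : ∀ I', ∫⁻ x, ‖F I' x‖ₑ ≤ (∫⁻ x, ‖b x / ((1 + x ^ 2 : ℝ) : ℂ)‖ₑ) * s I' := by
    intro I'
    rw [← lintegral_mul_const'' _ hb.integrable_weight.aestronglyMeasurable.enorm]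
    refine lintegral_mono fun x => ?_
    have hx : ((1 + x ^ 2 : ℝ) : ℂ) ≠ 0 := by rw [Complex.ofReal_ne_zero]; positivity
    have h1 : ‖b x‖ₑ = ‖b x / ((1 + x ^ 2 : ℝ) : ℂ)‖ₑ * ENNReal.ofReal (1 + x ^ 2) := by
      conv_lhs => rw [← div_mul_cancel₀ (b x) hx]
      rw [enorm_mul]
      congr 1
      rw [← ofReal_norm, Complex.norm_real, Real.norm_of_nonneg (by positivity)]
    have h2 : ‖conj (c I' * dil w I' x)‖ₑ = ‖c I'‖ₑ * ‖dil w I' x‖ₑ := by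
      rw [← ofReal_norm, RCLike.norm_conj, ofReal_norm, enorm_mul]
    simp only [hF]
    rw [enorm_mul, h1, h2]
    calc _ = ‖b x / ((1 + x ^ 2 : ℝ) : ℂ)‖ₑ *
          (‖c I'‖ₑ * (‖dil w I' x‖ₑ * ENNReal.ofReal (1 + x ^ 2))) := by ring
      _ ≤ _ := by gcongr; exact hle I' x
  have hfin : ∑' I', ∫⁻ x, ‖F I' x‖ₑ ≠ ∞ := by
    refine ne_top_of_le_ne_top ?_ (ENNReal.tsum_le_tsum hFb)
    rw [ENNReal.tsum_mul_left]
    exact ENNReal.mul_ne_top hb.integrable_weight.hasFiniteIntegral.ne hs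
  have heq : pair b (dil hw.u I) = ∑' I', ∫ x, F I' x := by
    rw [← integral_tsum hFm hfin]
    refine integral_congr_ae ?_
    filter_upwards [hexp] with x hx
    simp only [hF]
    rw [tsum_mul_left, ← Complex.conj_tsum, hx]
  have hterm : ∀ I', ‖∫ x, F I' x‖ₑ = ‖c I'‖ₑ * ‖pair b (dil w I')‖ₑ := by
    intro I'
    have : ∫ x, F I' x = conj (c I') * pair b (dil w I') := by
      rw [pair, ← integral_const_mul]
      refine integral_congr_ae (Filter.Eventually.of_forall fun x => ?_)
      simp only [hF, map_mul]
      ring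
    rw [this, enorm_mul, ← ofReal_norm, RCLike.norm_conj, ofReal_norm]
  rw [heq]
  exact enorm_tsum_le_tsum_enorm.trans_eq (tsum_congr hterm)

/-- Reindexing by the offset `t` displays the row sum as a weighted superposition of translated
parents, neighbours and children, the operations under which `IsCarleson` is stable. -/
lemma exists_tsum_coeff_mul_le : ∃ C : ℝ≥0, ∀ (j m : ℤ) (G : Dyadic → ℝ≥0∞),
    ∑' I, ‖pair (dil hw.u (j, m)) (dil w I)‖ₑ * G I
      ≤ C * ∑' t, wt 3 t * (G (j + 1, (m + t) / 2) + G (j, m + t) + G (j - 1, 2 * m + t)) := by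
  obtain ⟨C, hC⟩ := hw.exists_coeff_decay 3
  refine ⟨C, fun j m G => ?_⟩
  rw [hw.tsum_coeff_mul]
  simp only [mul_add]
  rw [ENNReal.tsum_add, ENNReal.tsum_add, mul_add, mul_add]
  simp only [← ENNReal.tsum_mul_left]
  refine add_le_add (add_le_add ?_ ?_) ?_
  -- Only offsets `t = 2n - m` occur at the coarser scale; for the others the right side merely
  -- gains nonnegative terms.
  · refine le_trans (ENNReal.tsum_le_tsum fun n => ?_) (ENNReal.tsum_comp_le_tsum_of_injective
      (two_mul_sub_injective m) fun t => C * (wt 3 t * G (j + 1, (m + t) / 2)))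
    have : (m + (2 * n - m)) / 2 = n := by lia
    rw [this, ← mul_assoc]
    gcongr
    exact (hC j m n).1
  · rw [← (Equiv.subRight m).tsum_eq (fun t => C * (wt 3 t * G (j, m + t)))]
    refine ENNReal.tsum_le_tsum fun n => ?_
    simp only [Equiv.subRight_apply, add_sub_cancel]
    rw [← mul_assoc]
    gcongr
    exact (hC j m n).2.1
  · rw [← (Equiv.subRight (2 * m)).tsum_eq (fun t => C * (wt 3 t * G (j - 1, 2 * m + t)))]
    refine ENNReal.tsum_le_tsum fun n => ?_
    simp only [Equiv.subRight_apply, add_sub_cancel]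
    rw [← mul_assoc, wt_sub_comm]
    gcongr
    exact (hC j m n).2.2

/-- By Cauchy–Schwarz with the matrix entries as weights, `|⟨b, u_I⟩|²` is at most a bounded row sum
times a weighted sum of `|⟨b, w_{I'}⟩|²`, to which the packing stability applies. -/
lemma exists_isCarleson_coeff : ∃ C : ℝ≥0, ∀ b, MemBMO w b →
    IsCarleson (fun k n => ‖pair b (dil hw.u (k, n))‖ₑ ^ 2) (C * bmoNorm w b ^ 2) := by
  obtain ⟨C, hC⟩ := hw.exists_tsum_coeff_mul_le
  refine ⟨(3 * C * (wtSum 3).toNNReal) * (C * (12 * (wtSum 2).toNNReal)), fun b hb => ?_⟩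
  set K := bmoNorm w b ^ 2 with hK
  set a : ℤ → ℤ → ℝ≥0∞ := fun k n => ‖pair b (dil w (k, n))‖ₑ ^ 2 with ha
  have hcar : IsCarleson a K := isCarleson_bmo w b
  set A : ℤ → ℤ → ℤ → ℝ≥0∞ := fun t k n =>
    a (k + 1) ((n + t) / 2) + a k (n + t) + a (k - 1) (2 * n + t) with hA
  -- `6 = 4 + 1 + 1` from parent, neighbour and child.
  have hAc : ∀ t, IsCarleson (A t) (((2 * |t| + 1 : ℤ).toNat : ℝ≥0∞) * (6 * K)) := by
    intro t
    have h := ((hcar.parent.shift t).add (hcar.shift t)).add (hcar.shift t).child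
    exact h.mono (fun _ _ => le_rfl) (le_of_eq (by ring))
  have hsum := IsCarleson.tsum (c := wt 3) hAc
  refine (hsum.const_mul ((3 * C * (wtSum 3).toNNReal : ℝ≥0) * C : ℝ≥0)).mono (fun k n => ?_) ?_
  · have h1 : ∑' I, ‖pair (dil hw.u (k, n)) (dil w I)‖ₑ ≤ (3 * C * (wtSum 3).toNNReal : ℝ≥0) := by
      have := hC k n 1
      simp only [Pi.one_apply, mul_one] at this
      refine this.trans (le_of_eq ?_)
      push_cast
      rw [ENNReal.coe_toNNReal (wtSum_ne_top (by norm_num)), ENNReal.tsum_mul_right, wtSum]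
      norm_num
      ring
    calc _ ≤ (∑' I', ‖pair (dil hw.u (k, n)) (dil w I')‖ₑ * ‖pair b (dil w I')‖ₑ) ^ 2 :=
          pow_le_pow_left' (hw.enorm_pair_u_le hb _) 2
      _ ≤ (∑' I, ‖pair (dil hw.u (k, n)) (dil w I)‖ₑ) *
            ∑' I', ‖pair (dil hw.u (k, n)) (dil w I')‖ₑ * ‖pair b (dil w I')‖ₑ ^ 2 :=
          sq_tsum_weight_mul_le _ _
      _ ≤ (3 * C * (wtSum 3).toNNReal : ℝ≥0) * (C * ∑' t, wt 3 t * A t k n) := by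
          gcongr
          exact hC k n fun I => ‖pair b (dil w I)‖ₑ ^ 2
      _ = _ := by push_cast; ring
  · push_cast
    have h2 : ∑' t, wt 3 t * (((2 * |t| + 1 : ℤ).toNat : ℝ≥0∞) * (6 * K))
        ≤ 12 * (wtSum 2).toNNReal * K := by
      calc _ ≤ ∑' t, 2 * wt 2 t * (6 * K) := by
            refine ENNReal.tsum_le_tsum fun t => ?_
            rw [← mul_assoc]
            exact mul_le_mul' (wt_succ_mul_le 2 t) le_rfl
        _ = _ := by
            rw [ENNReal.tsum_mul_right, ENNReal.tsum_mul_left,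
              ENNReal.coe_toNNReal (wtSum_ne_top le_rfl), wtSum]
            ring
    calc _ ≤ 3 * (C : ℝ≥0∞) * (wtSum 3).toNNReal * C * (12 * (wtSum 2).toNNReal * K) := by gcongr
      _ = _ := by ring

end IsMeyerWavelet

/-! ### Two bilinear estimates driven by a Carleson sequence -/

lemma eLpNorm_two_sq (f : ℝ → ℂ) : eLpNorm f 2 volume ^ 2 = ∫⁻ x, ‖f x‖ₑ ^ 2 := by
  rw [eLpNorm_eq_lintegral_rpow_enorm_toReal (by norm_num) (by norm_num), ← ENNReal.rpow_two,
    ← ENNReal.rpow_mul]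
  norm_num

lemma enorm_sq_eq_lintegral (F : Lp ℂ 2 (volume : Measure ℝ)) :
    ‖F‖ₑ ^ 2 = ∫⁻ x, ‖F x‖ₑ ^ 2 := by
  rw [Lp.enorm_def, eLpNorm_two_sq]

lemma enorm_inner_le_lintegral (F G : Lp ℂ 2 (volume : Measure ℝ)) :
    ‖(inner ℂ F G : ℂ)‖ₑ ≤ ∫⁻ x, ‖F x‖ₑ * ‖G x‖ₑ := by
  rw [L2.inner_def]
  refine (enorm_integral_le_lintegral_enorm _).trans (lintegral_mono fun x => ?_)
  rw [← ofReal_norm, ← ofReal_norm, ← ofReal_norm, ← ENNReal.ofReal_mul (norm_nonneg _)]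
  exact ENNReal.ofReal_le_ofReal (norm_inner_le_norm _ _)

lemma enorm_inner_self (F : Lp ℂ 2 (volume : Measure ℝ)) :
    ‖(inner ℂ F F : ℂ)‖ₑ = ‖F‖ₑ ^ 2 := by
  rw [← ofReal_norm, ← ofReal_norm, ← ENNReal.ofReal_pow (norm_nonneg _),
    inner_self_eq_norm_sq_to_K]
  simp

lemma add_sq_le_two_mul (x y : ℝ≥0∞) : (x + y) ^ 2 ≤ 2 * (x ^ 2 + y ^ 2) := by
  have := sq_tsum_weight_mul_le (fun _ : Fin 2 => (1 : ℝ≥0∞)) ![x, y]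
  simpa [tsum_fintype] using this

namespace IsCarleson
variable {a : ℤ → ℤ → ℝ≥0∞} {K : ℝ≥0∞}

lemma lintegral_sq_le (ha : IsCarleson (fun k n => a k n ^ 2) K) {d : ℤ → ℝ≥0∞} {j : ℤ}
    {f : ℝ → ℂ} (hf : ∀ x, ‖f x‖ₑ ≤ isq j ^ 2 * (a j (idx j x) * d (idx j x))) :
    ∫⁻ x, ‖f x‖ₑ ^ 2 ≤ K * ∑' m, d m ^ 2 := by
  calc ∫⁻ x, ‖f x‖ₑ ^ 2 ≤ ∫⁻ x, isq j ^ 2 * K * d (idx j x) ^ 2 := by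
        refine lintegral_mono fun x => (pow_le_pow_left' (hf x) 2).trans ?_
        calc _ = isq j ^ 2 * isq j ^ 2 * (a j (idx j x) ^ 2) * d (idx j x) ^ 2 := by ring
          _ ≤ isq j ^ 2 * isq j ^ 2 * (K * vol j) * d (idx j x) ^ 2 := by
            gcongr; exact ha.apply_le _ _
          _ = isq j ^ 2 * (isq j ^ 2 * vol j) * K * d (idx j x) ^ 2 := by ring
          _ = _ := by rw [isq_sq_mul_vol, mul_one]
    _ = vol j * ∑' m, isq j ^ 2 * K * d m ^ 2 := lintegral_step j fun m => isq j ^ 2 * K * d m ^ 2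
    _ = (isq j ^ 2 * vol j) * (K * ∑' m, d m ^ 2) := by rw [ENNReal.tsum_mul_left]; ring
    _ = _ := by rw [isq_sq_mul_vol, one_mul]

/-- Duality with the sum `X` itself as test function: the pairing with the `j`-th term only sees
averages of `|X|` over intervals of length `2^j`, and the Carleson embedding applies to `|X|`. -/
lemma sq_enorm_sum_le (ha : IsCarleson (fun k n => a k n ^ 2) K) (hK : K ≠ ∞)
    {d : ℤ → ℤ → ℝ≥0∞} {D : ℤ → Lp ℂ 2 (volume : Measure ℝ)}
    (hD : ∀ j, ∀ᵐ x, ‖D j x‖ₑ ≤ isq j ^ 2 * (a j (idx j x) * d j (idx j x))) (s : Finset ℤ) :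
    ‖∑ j ∈ s, D j‖ₑ ^ 2 ≤ 4 * K * ∑ j ∈ s, ∑' m, d j m ^ 2 := by
  set X := ∑ j ∈ s, D j with hX
  set f : ℝ → ℝ≥0∞ := fun x => ‖X x‖ₑ with hf
  have hfm : AEMeasurable f := (Lp.aestronglyMeasurable X).enorm
  have hX2 : ∫⁻ x, f x ^ 2 = ‖X‖ₑ ^ 2 := (enorm_sq_eq_lintegral X).symm
  rcases eq_or_ne (‖X‖ₑ ^ 2) 0 with h0 | h0
  · rw [h0]; exact zero_le
  have hXt : ‖X‖ₑ ^ 2 ≠ ∞ := by finiteness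
  have h1 : ‖X‖ₑ ^ 2 ≤ ∑ j ∈ s, ∑' m, (a j m * avg f j m) * d j m := by
    calc ‖X‖ₑ ^ 2 = ‖(inner ℂ X X : ℂ)‖ₑ := (enorm_inner_self X).symm
      _ = ‖∑ j ∈ s, (inner ℂ (D j) X : ℂ)‖ₑ := by conv_lhs => rw [hX, sum_inner, ← hX]
      _ ≤ ∑ j ∈ s, ‖(inner ℂ (D j) X : ℂ)‖ₑ := enorm_sum_le _ _
      _ ≤ _ := by
        refine Finset.sum_le_sum fun j _ => (enorm_inner_le_lintegral _ _).trans ?_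
        calc ∫⁻ x, ‖D j x‖ₑ * ‖X x‖ₑ
            ≤ ∫⁻ x, (isq j ^ 2 * (a j (idx j x) * d j (idx j x))) * f x := by
              refine lintegral_mono_ae ?_
              filter_upwards [hD j] with x hx
              gcongr
          _ = ∑' m, (isq j ^ 2 * (a j m * d j m)) * (vol j * avg f j m) :=
              lintegral_step_mul j (fun m => isq j ^ 2 * (a j m * d j m)) hfm
          _ = ∑' m, (a j m * avg f j m) * d j m := by
              refine tsum_congr fun m => ?_
              calc _ = (isq j ^ 2 * vol j) * ((a j m * avg f j m) * d j m) := by ring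
                _ = _ := by rw [isq_sq_mul_vol, one_mul]
  have hsum : ∀ g : ℤ → ℤ → ℝ≥0∞, ∑ j ∈ s, ∑' m, g j m = ∑' p : s × ℤ, g p.1 p.2 := by
    intro g
    rw [ENNReal.tsum_prod', tsum_fintype, ← Finset.sum_coe_sort s]
  have h2 : (‖X‖ₑ ^ 2) ^ 2 ≤ (4 * K * ∑ j ∈ s, ∑' m, d j m ^ 2) * ‖X‖ₑ ^ 2 := by
    calc (‖X‖ₑ ^ 2) ^ 2 ≤ (∑ j ∈ s, ∑' m, (a j m * avg f j m) * d j m) ^ 2 :=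
          pow_le_pow_left' h1 2
      _ ≤ (∑ j ∈ s, ∑' m, (a j m * avg f j m) ^ 2) * ∑ j ∈ s, ∑' m, d j m ^ 2 := by
          rw [hsum, hsum, hsum]
          exact sq_tsum_mul_le_mul_tsum_sq (fun p : s × ℤ => a p.1 p.2 * avg f p.1 p.2)
            fun p => d p.1 p.2
      _ ≤ (4 * K * ‖X‖ₑ ^ 2) * ∑ j ∈ s, ∑' m, d j m ^ 2 := by
          gcongr
          refine (ENNReal.sum_le_tsum s).trans ?_
          rw [← hX2]
          simp_rw [mul_pow]
          exact ha.tsum_avg_le hK hfm (by rwa [hX2])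
      _ = _ := by ring
  -- The factor `‖X‖²` is finite and nonzero, so it cancels.
  rw [sq (‖X‖ₑ ^ 2)] at h2
  exact (ENNReal.mul_le_mul_iff_left h0 hXt).1 h2

/-- The averages of `g` are handled by the Carleson embedding, one offset `t` at a time; for the
boundary term `d`, the single-interval bound `a² ≤ K |I|` is enough. -/
lemma tsum_lintegral_sq_le (ha : IsCarleson (fun k n => a k n ^ 2) K) (hK : K ≠ ∞)
    {d : ℤ → ℤ → ℝ≥0∞} {g : ℝ → ℝ≥0∞} (hg : AEMeasurable g) (hg2 : ∫⁻ x, g x ^ 2 ≠ ∞) (C : ℝ≥0∞)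
    {f : ℤ → ℝ → ℂ} (hf : ∀ j x, ‖f j x‖ₑ ≤ isq j * a j (idx j x) *
      (C * ∑' t, wt 3 t * avg g j (idx j x + t) + isq j * d j (idx j x))) :
    ∑' j, ∫⁻ x, ‖f j x‖ₑ ^ 2
      ≤ 2 * (C ^ 2 * wtSum 3 * (8 * wtSum 2 * K) * ∫⁻ x, g x ^ 2)
        + 2 * (K * ∑' j, ∑' m, d j m ^ 2) := by
  have h1 : ∀ j, ∫⁻ x, ‖f j x‖ₑ ^ 2
      ≤ ∑' m, (2 * (C ^ 2 * wtSum 3 * ∑' t, wt 3 t * (a j m ^ 2 * avg g j (m + t) ^ 2))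
        + 2 * (K * d j m ^ 2)) := by
    intro j
    set V : ℤ → ℝ≥0∞ := fun m => C * ∑' t, wt 3 t * avg g j (m + t) + isq j * d j m with hV
    calc ∫⁻ x, ‖f j x‖ₑ ^ 2 ≤ ∫⁻ x, (isq j * a j (idx j x) * V (idx j x)) ^ 2 :=
          lintegral_mono fun x => pow_le_pow_left' (hf j x) 2
      _ = vol j * ∑' m, (isq j * a j m * V m) ^ 2 :=
          lintegral_step j fun m => (isq j * a j m * V m) ^ 2
      _ = ∑' m, a j m ^ 2 * V m ^ 2 := by
          rw [← ENNReal.tsum_mul_left]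
          refine tsum_congr fun m => ?_
          calc _ = (isq j ^ 2 * vol j) * (a j m ^ 2 * V m ^ 2) := by ring
            _ = _ := by rw [isq_sq_mul_vol, one_mul]
      _ ≤ _ := by
          refine ENNReal.tsum_le_tsum fun m => ?_
          have h2 : (∑' t, wt 3 t * avg g j (m + t)) ^ 2
              ≤ wtSum 3 * ∑' t, wt 3 t * avg g j (m + t) ^ 2 := sq_tsum_weight_mul_le _ _
          have h3 : a j m ^ 2 * (isq j * d j m) ^ 2 ≤ K * d j m ^ 2 := by
            calc _ ≤ (K * vol j) * (isq j * d j m) ^ 2 := by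
                  gcongr; exact ha.apply_le _ _
              _ = (isq j ^ 2 * vol j) * (K * d j m ^ 2) := by ring
              _ = _ := by rw [isq_sq_mul_vol, one_mul]
          calc a j m ^ 2 * V m ^ 2 ≤ a j m ^ 2 * (2 * ((C * ∑' t, wt 3 t * avg g j (m + t)) ^ 2
                + (isq j * d j m) ^ 2)) := by gcongr; exact add_sq_le_two_mul _ _
            _ = 2 * (C ^ 2 * (a j m ^ 2 * (∑' t, wt 3 t * avg g j (m + t)) ^ 2))
                + 2 * (a j m ^ 2 * (isq j * d j m) ^ 2) := by ring
            _ ≤ 2 * (C ^ 2 * (a j m ^ 2 * (wtSum 3 * ∑' t, wt 3 t * avg g j (m + t) ^ 2)))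
                + 2 * (K * d j m ^ 2) := by gcongr
            _ = _ := by
                congr 2
                rw [mul_assoc (C ^ 2)]
                congr 1
                rw [mul_left_comm, ← ENNReal.tsum_mul_left]
                congr 1
                exact tsum_congr fun t => by ring
  -- The translation is moved from the averages to the Carleson sequence.
  have h4 : ∀ t, ∑' j, ∑' m, a j m ^ 2 * avg g j (m + t) ^ 2
      ≤ 4 * (((2 * |t| + 1 : ℤ).toNat : ℝ≥0∞) * K) * ∫⁻ x, g x ^ 2 := by
    intro t
    have h5 := (ha.shift (-t)).tsum_avg_le (by rw [abs_neg]; finiteness) hg hg2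
    rw [abs_neg] at h5
    refine le_trans (le_of_eq (tsum_congr fun j => ?_)) h5
    rw [← (Equiv.addRight t).tsum_eq (fun m => a j (m + -t) ^ 2 * avg g j m ^ 2)]
    simp
  calc _ ≤ ∑' j, ∑' m, (2 * (C ^ 2 * wtSum 3 * ∑' t, wt 3 t * (a j m ^ 2 * avg g j (m + t) ^ 2))
        + 2 * (K * d j m ^ 2)) := ENNReal.tsum_le_tsum h1
    _ = 2 * (C ^ 2 * wtSum 3 * ∑' t, wt 3 t * ∑' j, ∑' m, a j m ^ 2 * avg g j (m + t) ^ 2)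
        + 2 * (K * ∑' j, ∑' m, d j m ^ 2) := by
      simp_rw [ENNReal.tsum_add, ENNReal.tsum_mul_left]
      congr 3
      rw [← (show ∀ G : ℤ → ℤ → ℤ → ℝ≥0∞, ∑' t, ∑' j, ∑' m, G j m t = ∑' j, ∑' m, ∑' t, G j m t
        from fun G => by
          rw [ENNReal.tsum_comm]
          exact tsum_congr fun j => ENNReal.tsum_comm)]
      simp_rw [ENNReal.tsum_mul_left]
    _ ≤ 2 * (C ^ 2 * wtSum 3 * ∑' t, 2 * wt 2 t * (4 * K * ∫⁻ x, g x ^ 2))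
        + 2 * (K * ∑' j, ∑' m, d j m ^ 2) := by
      gcongr 2 * (_ * ?_) + _
      refine ENNReal.tsum_le_tsum fun t => ?_
      calc _ ≤ wt 3 t * (4 * (((2 * |t| + 1 : ℤ).toNat : ℝ≥0∞) * K) * ∫⁻ x, g x ^ 2) := by
            gcongr; exact h4 t
        _ = (wt 3 t * ((2 * |t| + 1 : ℤ).toNat : ℝ≥0∞)) * (4 * K * ∫⁻ x, g x ^ 2) := by ring
        _ ≤ _ := mul_le_mul' (wt_succ_mul_le 2 t) le_rfl
    _ = _ := by
      rw [ENNReal.tsum_mul_right, ENNReal.tsum_mul_left, wtSum, wtSum]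
      ring

end IsCarleson

/-! ### Summability in Hilbert spaces -/

/-- Each `x j` interacts with at most the five `x k` with `|j - k| ≤ 2`; every such inner product is
at most the mean of the two squared norms. -/
lemma sq_norm_sum_le_of_almost_orthogonal {H : Type*} [NormedAddCommGroup H]
    [InnerProductSpace ℂ H] {x : ℤ → H} (hx : ∀ j k, j + 3 ≤ k → inner ℂ (x j) (x k) = 0)
    (s : Finset ℤ) : ‖∑ j ∈ s, x j‖ ^ 2 ≤ 5 * ∑ j ∈ s, ‖x j‖ ^ 2 := by
  have h1 : ∀ j k, ‖inner ℂ (x j) (x k)‖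
      ≤ if |j - k| ≤ 2 then (‖x j‖ ^ 2 + ‖x k‖ ^ 2) / 2 else 0 := by
    intro j k
    split_ifs with h
    · refine (norm_inner_le_norm _ _).trans ?_
      nlinarith [sq_nonneg (‖x j‖ - ‖x k‖)]
    · rw [abs_le] at h
      rcases le_total j k with hjk | hjk
      · rw [hx j k (by lia), norm_zero]
      · rw [← inner_conj_symm, hx k j (by lia)]; simp
  have h2 : ∀ j, ∑ k ∈ s, (if |j - k| ≤ 2 then ‖x j‖ ^ 2 / 2 else 0) ≤ 5 * (‖x j‖ ^ 2 / 2) := by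
    intro j
    rw [← Finset.sum_filter, Finset.sum_const, nsmul_eq_mul]
    gcongr
    have h3 : s.filter (fun k => |j - k| ≤ 2) ⊆ Finset.Icc (j - 2) (j + 2) := by
      intro k hk
      rw [Finset.mem_filter, abs_le] at hk
      rw [Finset.mem_Icc]
      constructor <;> lia
    have h4 := Finset.card_le_card h3
    rw [Int.card_Icc] at h4
    have h5 : (j + 2 + 1 - (j - 2)).toNat = 5 := by
      rw [show j + 2 + 1 - (j - 2) = 5 by ring]; rfl
    rw [h5] at h4
    exact_mod_cast h4
  have h6 : ∑ j ∈ s, ∑ k ∈ s, (if |j - k| ≤ 2 then ‖x j‖ ^ 2 / 2 else 0)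
      ≤ 5 / 2 * ∑ j ∈ s, ‖x j‖ ^ 2 := by
    rw [Finset.mul_sum]
    exact Finset.sum_le_sum fun j _ => (h2 j).trans_eq (by ring)
  have h7 : ∑ j ∈ s, ∑ k ∈ s, (if |j - k| ≤ 2 then ‖x k‖ ^ 2 / 2 else 0)
      ≤ 5 / 2 * ∑ j ∈ s, ‖x j‖ ^ 2 := by
    rw [Finset.sum_comm]
    simp_rw [fun j k : ℤ => abs_sub_comm k j] at h6 ⊢
    exact h6
  calc ‖∑ j ∈ s, x j‖ ^ 2 = ‖inner ℂ (∑ j ∈ s, x j) (∑ j ∈ s, x j)‖ := by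
        rw [inner_self_eq_norm_sq_to_K]; simp
    _ = ‖∑ j ∈ s, ∑ k ∈ s, inner ℂ (x j) (x k)‖ := by
        rw [sum_inner]; simp_rw [inner_sum]
    _ ≤ ∑ j ∈ s, ∑ k ∈ s, ‖inner ℂ (x j) (x k)‖ :=
        (norm_sum_le _ _).trans (Finset.sum_le_sum fun j _ => norm_sum_le _ _)
    _ ≤ ∑ j ∈ s, ∑ k ∈ s, ((if |j - k| ≤ 2 then ‖x j‖ ^ 2 / 2 else 0)
          + if |j - k| ≤ 2 then ‖x k‖ ^ 2 / 2 else 0) := by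
        refine Finset.sum_le_sum fun j _ => Finset.sum_le_sum fun k _ => (h1 j k).trans_eq ?_
        split_ifs <;> ring
    _ ≤ _ := by
        simp_rw [Finset.sum_add_distrib]
        linarith

/-- The bound over arbitrary finite sets is a Cauchy criterion: sets far out carry little of the
mass of `c`. Hence the convergence is unconditional. -/
lemma summable_of_sq_enorm_sum_le {ι H : Type*} [NormedAddCommGroup H] [CompleteSpace H]
    {x : ι → H} {c : ι → ℝ≥0∞} (hc : ∑' i, c i ≠ ∞)
    (h : ∀ s : Finset ι, ‖∑ i ∈ s, x i‖ₑ ^ 2 ≤ ∑ i ∈ s, c i) :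
    Summable x ∧ ‖∑' i, x i‖ₑ ^ 2 ≤ ∑' i, c i := by
  have hs : Summable x := by
    rw [summable_iff_vanishing_norm]
    intro ε hε
    have h1 := ENNReal.summable_toReal hc
    rw [summable_iff_vanishing_norm] at h1
    obtain ⟨s, hs⟩ := h1 (ε ^ 2) (by positivity)
    refine ⟨s, fun t ht => ?_⟩
    have h2 := hs t ht
    rw [← ENNReal.toReal_sum fun i _ => ENNReal.ne_top_of_tsum_ne_top hc i,
      Real.norm_of_nonneg ENNReal.toReal_nonneg] at h2
    have h3 : ∑ i ∈ t, c i ≠ ∞ := ne_top_of_le_ne_top hc (ENNReal.sum_le_tsum t)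
    have h4 := ENNReal.toReal_mono h3 (h t)
    rw [ENNReal.toReal_pow, toReal_enorm] at h4
    exact lt_of_pow_lt_pow_left₀ 2 hε.le (h4.trans_lt h2)
  refine ⟨hs, ?_⟩
  have h5 : Filter.Tendsto (fun s : Finset ι => ‖∑ i ∈ s, x i‖ₑ ^ 2) Filter.atTop
      (nhds (‖∑' i, x i‖ₑ ^ 2)) := by
    have h6 : Filter.Tendsto (fun s : Finset ι => ‖∑ i ∈ s, x i‖ₑ) Filter.atTop
      (nhds ‖∑' i, x i‖ₑ) := (continuous_enorm.tendsto _).comp hs.hasSum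
    exact ((ENNReal.continuous_pow 2).tendsto _).comp h6
  exact le_of_tendsto' h5 fun s => (h s).trans (ENNReal.sum_le_tsum s)

/-! ### Pointwise bounds for the operators `ΔU_j` and `U_j` -/

lemma summable_of_tsum_enorm_ne_top {ι : Type*} {f : ι → ℂ} (h : ∑' i, ‖f i‖ₑ ≠ ∞) :
    Summable f := by
  have h2 := ENNReal.summable_toReal h
  simp only [toReal_enorm] at h2
  exact h2.of_norm

/-- Turns coefficients into pointwise majorants: a wavelet sum at a point is a weighted average of
nearby coefficients, and averaging preserves packing. -/
lemma IsCarleson.average {a : ℤ → ℤ → ℝ≥0∞} {K : ℝ≥0∞} (ha : IsCarleson (fun k n => a k n ^ 2) K)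
    (C : ℝ≥0∞) : IsCarleson (fun k m => (C * ∑' n, wt 3 (n - m) * a k n) ^ 2)
      (C ^ 2 * wtSum 3 * (2 * wtSum 2 * K)) := by
  have h1 := IsCarleson.tsum (c := wt 3) fun t => ha.shift t
  refine (h1.const_mul (C ^ 2 * wtSum 3)).mono (fun k m => ?_) ?_
  · rw [mul_pow, mul_assoc]
    gcongr
    refine (sq_tsum_weight_mul_le _ _).trans (le_of_eq ?_)
    rw [tsum_wt_sub, ← (Equiv.subRight m).tsum_eq (fun t => wt 3 t * a k (m + t) ^ 2)]
    simp
  · gcongr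
    calc _ ≤ ∑' t, 2 * wt 2 t * K := ENNReal.tsum_le_tsum fun t => by
          rw [← mul_assoc]
          exact mul_le_mul' (wt_succ_mul_le 2 t) le_rfl
      _ = _ := by rw [ENNReal.tsum_mul_right, ENNReal.tsum_mul_left, wtSum]

lemma tsum_sq_average_le (i : ℕ) (c : ℤ → ℝ≥0∞) (C : ℝ≥0∞) :
    ∑' m, (C * ∑' n, wt 3 (2 ^ i * n - m) * c n) ^ 2 ≤ C ^ 2 * wtSum 3 ^ 2 * ∑' n, c n ^ 2 := by
  have hinj : ∀ m : ℤ, Function.Injective fun n : ℤ => 2 ^ i * n - m := fun m x y h => by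
    simpa using h
  calc _ ≤ ∑' m, C ^ 2 * (wtSum 3 * ∑' n, wt 3 (2 ^ i * n - m) * c n ^ 2) := by
        refine ENNReal.tsum_le_tsum fun m => ?_
        rw [mul_pow]
        gcongr
        refine (sq_tsum_weight_mul_le _ _).trans ?_
        gcongr
        exact tsum_wt_comp_le 3 (hinj m)
    _ = C ^ 2 * (wtSum 3 * ∑' n, wtSum 3 * c n ^ 2) := by
        rw [ENNReal.tsum_mul_left, ENNReal.tsum_mul_left, ENNReal.tsum_comm]
        congr 3
        funext n
        rw [ENNReal.tsum_mul_right, tsum_wt_sub']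
    _ = _ := by rw [ENNReal.tsum_mul_left]; ring

lemma deltaU_congr (w : ℝ → ℂ) {f g : ℝ → ℂ} (h : f =ᵐ[volume] g) : (deltaU w · f) = (deltaU w · g) := by
  funext j x
  simp only [deltaU, pair_congr h]

lemma opU_congr (w : ℝ → ℂ) {f g : ℝ → ℂ} (h : f =ᵐ[volume] g) : (opU w · f) = (opU w · g) := by
  funext j x
  have := deltaU_congr w h
  simp only [opU]
  exact tsum_congr fun k => congrFun (congrFun this k) x

lemma term_congr (w b : ℝ → ℂ) {f g : ℝ → ℂ} (h : f =ᵐ[volume] g) : term w b f = term w b g := by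
  funext j x
  have := congrFun (congrFun (opU_congr w h) j) x
  simp only [term]
  rw [this]

lemma isq_add (j : ℤ) (i : ℕ) : isq (j + i) = isq j * isq i := by
  rw [isq, isq, isq, ← ENNReal.ofReal_mul (by positivity), ← mul_inv,
    ← Real.sqrt_mul (by positivity), zpow_add₀ (by norm_num)]

lemma tsum_isq_ne_top : ∑' i : ℕ, isq i ≠ ∞ := by
  have h : ∀ i : ℕ, isq i = ENNReal.ofReal ((Real.sqrt 2)⁻¹ ^ i) := by
    intro i
    rw [isq, zpow_natCast, Real.sqrt_eq_rpow, ← Real.rpow_natCast, ← Real.rpow_mul (by norm_num),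
      mul_comm, Real.rpow_mul (by norm_num), Real.rpow_natCast, ← Real.sqrt_eq_rpow, inv_pow]
  simp_rw [h]
  refine (summable_geometric_of_lt_one (by positivity) ?_).tsum_ofReal_ne_top
  exact inv_lt_one_of_one_lt₀ (Real.lt_sqrt_of_sq_lt (by norm_num))

lemma measurable_tsum_of_summable {ι : Type*} [Countable ι] {f : ι → ℝ → ℂ}
    (hf : ∀ i, Measurable (f i)) (hs : ∀ x, Summable fun i => f i x) :
    Measurable fun x => ∑' i, f i x := by
  refine measurable_of_tendsto_metrizable' Filter.atTop
    (f := fun (s : Finset ι) x => ∑ i ∈ s, f i x) (fun s => ?_) ?_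
  · exact Finset.measurable_fun_sum s fun i _ => hf i
  · rw [tendsto_pi_nhds]
    exact fun x => (hs x).hasSum

namespace IsMeyerWavelet
variable {w : 𝓢(ℝ, ℂ)} (hw : IsMeyerWavelet w)
include hw

lemma deltaU_eq (j : ℤ) (f : ℝ → ℂ) (x : ℝ) :
    deltaU w j f x = ∑' n : ℤ, pair f (dil hw.u (j, n)) * dil hw.u (j, n) x := by
  rw [deltaU, hw.coe_u]

lemma continuous_dil_u (I : Dyadic) : Continuous (dil hw.u I) := (dilS hw.u I).continuous

lemma exists_tsum_bmo_bound : ∃ C : ℝ≥0, ∀ b, MemBMO w b → ∃ a : ℤ → ℤ → ℝ≥0∞,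
    IsCarleson (fun k n => a k n ^ 2) (C * bmoNorm w b ^ 2) ∧
    ∀ j x, ∑' n, ‖pair b (dil hw.u (j, n)) * dil hw.u (j, n) x‖ₑ ≤ isq j * a j (idx j x) := by
  obtain ⟨C, hC⟩ := hw.exists_isCarleson_coeff
  obtain ⟨A, hA⟩ := exists_dil_bound hw.u 3 0
  refine ⟨A ^ 2 * (wtSum 3).toNNReal * (2 * (wtSum 2).toNNReal * C), fun b hb =>
    ⟨fun j m => A * ∑' n, wt 3 (n - m) * ‖pair b (dil hw.u (j, n))‖ₑ,
      ((hC b hb).average A).mono (fun _ _ => le_rfl) (le_of_eq ?_), fun j x => ?_⟩⟩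
  · push_cast
    rw [ENNReal.coe_toNNReal (wtSum_ne_top le_rfl), ENNReal.coe_toNNReal (wtSum_ne_top (by norm_num))]
    ring
  · beta_reduce
    rw [← ENNReal.tsum_mul_left, ← ENNReal.tsum_mul_left]
    refine ENNReal.tsum_le_tsum fun n => ?_
    rw [enorm_mul]
    have h := hA j n x
    simp only [Nat.cast_zero, add_zero, pow_zero, one_mul] at h
    calc _ ≤ ‖pair b (dil hw.u (j, n))‖ₑ * (A * isq j * wt 3 (n - idx j x)) := by gcongr
      _ = _ := by ring

lemma exists_tsum_bound (i : ℕ) : ∃ C : ℝ≥0, ∀ φ : ℝ → ℂ, ∃ d : ℤ → ℤ → ℝ≥0∞,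
    (∀ j, ∑' m, d j m ^ 2 ≤ C * ∑' n, ‖pair φ (dil hw.u (j + i, n))‖ₑ ^ 2) ∧
    ∀ j x, ∑' n, ‖pair φ (dil hw.u (j + i, n)) * dil hw.u (j + i, n) x‖ₑ
      ≤ isq j * d j (idx j x) := by
  obtain ⟨A, hA⟩ := exists_dil_bound hw.u 3 i
  refine ⟨A ^ 2 * (wtSum 3).toNNReal ^ 2, fun φ =>
    ⟨fun j m => A * ∑' n, wt 3 (2 ^ i * n - m) * ‖pair φ (dil hw.u (j + i, n))‖ₑ,
      fun j => ?_, fun j x => ?_⟩⟩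
  · push_cast
    rw [ENNReal.coe_toNNReal (wtSum_ne_top (by norm_num))]
    exact tsum_sq_average_le i _ A
  · beta_reduce
    rw [← ENNReal.tsum_mul_left, ← ENNReal.tsum_mul_left]
    refine ENNReal.tsum_le_tsum fun n => ?_
    rw [enorm_mul]
    calc _ ≤ ‖pair φ (dil hw.u (j + i, n))‖ₑ * (A * isq j * wt 3 (2 ^ i * n - idx j x)) := by
          gcongr; exact hA j n x
      _ = _ := by ring

lemma enorm_pair_Lp_le (F : Lp ℂ 2 (volume : Measure ℝ)) (I : Dyadic) :
    ‖pair F (dil hw.u I)‖ₑ ≤ ‖F‖ₑ := by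
  have h := (ENNReal.le_tsum I).trans (hw.tsum_enorm_pair_sq_le F)
  exact (ENNReal.pow_le_pow_left_iff two_ne_zero).1 h

/-- The coefficients are bounded by `‖F‖`, and the normalizing factors `2^{-(j+i)/2}` decay
geometrically towards coarse scales. -/
lemma tsum_scales_ne_top (F : Lp ℂ 2 (volume : Measure ℝ)) (j : ℤ) (x : ℝ) :
    ∑' p : ℕ × ℤ, ‖pair F (dil hw.u (j + p.1, p.2)) * dil hw.u (j + p.1, p.2) x‖ₑ ≠ ∞ := by
  obtain ⟨A, hA⟩ := exists_dil_bound hw.u 2 0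
  have h : ∀ (i : ℕ) (n : ℤ), ‖pair F (dil hw.u (j + i, n)) * dil hw.u (j + i, n) x‖ₑ
      ≤ (‖F‖ₑ * A * isq j) * (isq i * wt 2 (n - idx (j + i) x)) := by
    intro i n
    have h1 := hA (j + i) n x
    simp only [Nat.cast_zero, add_zero, pow_zero, one_mul, isq_add] at h1
    rw [enorm_mul]
    calc _ ≤ ‖F‖ₑ * (A * (isq j * isq i) * wt 2 (n - idx (j + i) x)) := by
          gcongr; exact hw.enorm_pair_Lp_le F _
      _ = _ := by ring
  rw [ENNReal.tsum_prod']
  refine ne_top_of_le_ne_top ?_ (ENNReal.tsum_le_tsum fun i => ENNReal.tsum_le_tsum fun n => h i n)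
  simp_rw [ENNReal.tsum_mul_left, tsum_wt_sub, ENNReal.tsum_mul_right]
  have h2 : wtSum 2 ≠ ∞ := wtSum_ne_top le_rfl
  have h3 := tsum_isq_ne_top
  have h4 := isq_ne_top j
  finiteness

lemma summable_scales (F : Lp ℂ 2 (volume : Measure ℝ)) (j : ℤ) (x : ℝ) :
    Summable fun p : ℕ × ℤ =>
      pair F (dil hw.u (j + p.1, p.2)) * dil hw.u (j + p.1, p.2) x :=
  summable_of_tsum_enorm_ne_top (hw.tsum_scales_ne_top F j x)

lemma summable_deltaU_terms (F : Lp ℂ 2 (volume : Measure ℝ)) (j : ℤ) (x : ℝ) :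
    Summable fun n : ℤ => pair F (dil hw.u (j, n)) * dil hw.u (j, n) x := by
  have := (hw.summable_scales F j x).prod_factor 0
  simpa using this

lemma summable_deltaU_bmo {b : ℝ → ℂ} (hb : MemBMO w b) (j : ℤ) (x : ℝ) :
    Summable fun n : ℤ => pair b (dil hw.u (j, n)) * dil hw.u (j, n) x := by
  obtain ⟨C, hC⟩ := hw.exists_tsum_bmo_bound
  obtain ⟨a, ha, hle⟩ := hC b hb
  refine summable_of_tsum_enorm_ne_top (ne_top_of_le_ne_top ?_ (hle j x))
  have h1 := hb.norm_lt_top.ne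
  have h2 := vol_ne_top j
  have h3 : a j (idx j x) ^ 2 ≠ ∞ := ne_top_of_le_ne_top (by finiteness) (ha.apply_le j (idx j x))
  refine ENNReal.mul_ne_top (isq_ne_top j) fun h => h3 ?_
  rw [h]; simp

lemma summable_deltaU_nat (F : Lp ℂ 2 (volume : Measure ℝ)) (j : ℤ) (x : ℝ) :
    Summable fun i : ℕ => deltaU w (j + i) F x := by
  simp_rw [hw.deltaU_eq]
  exact (hw.summable_scales F j x).prod

omit hw in
/-- The scales above `j` are indexed by the natural numbers. -/
def scaleEquiv (j : ℤ) : ℕ ≃ {k : ℤ // j ≤ k} where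
  toFun i := ⟨j + i, by lia⟩
  invFun k := (k.1 - j).toNat
  left_inv i := by simp
  right_inv k := by
    obtain ⟨k, hk⟩ := k
    ext
    simp only
    lia

lemma summable_deltaU (F : Lp ℂ 2 (volume : Measure ℝ)) (j : ℤ) (x : ℝ) :
    Summable fun k : {k : ℤ // j ≤ k} => deltaU w k F x := by
  rw [← (scaleEquiv j).summable_iff]
  exact hw.summable_deltaU_nat F j x

omit hw in
lemma opU_eq_tsum (f : ℝ → ℂ) (j : ℤ) (x : ℝ) :
    opU w j f x = ∑' i : ℕ, deltaU w (j + i) f x :=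
  ((scaleEquiv j).tsum_eq fun k : {k : ℤ // j ≤ k} => deltaU w k f x).symm

lemma opU_eq_tsum_prod (F : Lp ℂ 2 (volume : Measure ℝ)) (j : ℤ) (x : ℝ) :
    opU w j F x = ∑' p : ℕ × ℤ, pair F (dil hw.u (j + p.1, p.2)) * dil hw.u (j + p.1, p.2) x := by
  rw [opU_eq_tsum, (hw.summable_scales F j x).tsum_prod]
  exact tsum_congr fun i => hw.deltaU_eq _ _ _

lemma opU_eq_sum_add (F : Lp ℂ 2 (volume : Measure ℝ)) (j : ℤ) (x : ℝ) :
    opU w j F x = ∑ i : Fin 4, deltaU w (j + (i : ℕ)) F x + opU w (j + 4) F x := by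
  rw [opU_eq_tsum, opU_eq_tsum, ← (hw.summable_deltaU_nat F j x).sum_add_tsum_nat_add 4,
    Fin.sum_univ_eq_sum_range (fun i => deltaU w (j + (i : ℕ)) F x) 4]
  congr 1
  refine tsum_congr fun i => ?_
  congr 1
  push_cast
  ring

lemma measurable_deltaU (F : Lp ℂ 2 (volume : Measure ℝ)) (j : ℤ) : Measurable (deltaU w j F) := by
  rw [funext (hw.deltaU_eq j F)]
  exact measurable_tsum_of_summable
    (fun n => ((hw.continuous_dil_u (j, n)).measurable).const_mul _) (hw.summable_deltaU_terms F j)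

lemma measurable_deltaU_bmo {b : ℝ → ℂ} (hb : MemBMO w b) (j : ℤ) : Measurable (deltaU w j b) := by
  rw [funext (hw.deltaU_eq j b)]
  exact measurable_tsum_of_summable
    (fun n => ((hw.continuous_dil_u (j, n)).measurable).const_mul _) (hw.summable_deltaU_bmo hb j)

lemma measurable_opU (F : Lp ℂ 2 (volume : Measure ℝ)) (j : ℤ) : Measurable (opU w j F) := by
  rw [funext (opU_eq_tsum F j)]
  exact measurable_tsum_of_summable (fun i => hw.measurable_deltaU F _) (hw.summable_deltaU_nat F j)

/-! ### The low-frequency part as a smooth average -/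

lemma pair_dil_u_lowpass_eq {j k : ℤ} (h : j ≤ k) (n : ℤ) (x : ℝ) :
    pair (dil hw.u (k, n)) (lowpass j x) = dil hw.u (k, n) x := by
  rw [← coe_dilS]
  refine pair_lowpass_eq (fun ξ hξ => ?_) x
  have h1 := hw.fourier_dilS_u_supp hξ
  have hk : (0 : ℝ) < 2 ^ k := by positivity
  have hξ0 : ξ < 0 := by
    by_contra hcon
    push Not at hcon
    nlinarith [mul_nonneg hk.le hcon]
  rw [abs_of_neg hξ0]
  have : (2 : ℝ) ^ j ≤ 2 ^ k := zpow_le_zpow_right₀ (by norm_num) h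
  nlinarith

lemma pair_dil_u_lowpass_eq_zero {j k : ℤ} (h : k + 3 ≤ j) (n : ℤ) (x : ℝ) :
    pair (dil hw.u (k, n)) (lowpass j x) = 0 := by
  rw [← coe_dilS]
  refine pair_lowpass_eq_zero (fun ξ hξ => ?_) x
  have h1 := hw.fourier_dilS_u_supp hξ
  have hk : (0 : ℝ) < 2 ^ k := by positivity
  have hξ0 : ξ < 0 := by
    by_contra hcon
    push Not at hcon
    nlinarith [mul_nonneg hk.le hcon]
  rw [abs_of_neg hξ0]
  have : (2 : ℝ) ^ k * 8 ≤ 2 ^ j := by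
    calc (2 : ℝ) ^ k * 8 = 2 ^ (k + 3) := by rw [zpow_add₀ (by norm_num)]; norm_num
      _ ≤ _ := zpow_le_zpow_right₀ (by norm_num) h
  nlinarith

/-- `U_j` is the smooth low-frequency average at scale `2^j`, up to the two boundary scales. -/
lemma opU_eq_lowpass (F : Lp ℂ 2 (volume : Measure ℝ)) (j : ℤ) (x : ℝ) :
    opU w j F x = pair (negProj F) (lowpass j x)
      - (∑' n, pair F (dil hw.u (j - 1, n)) * pair (dil hw.u (j - 1, n)) (lowpass j x)
        + ∑' n, pair F (dil hw.u (j - 2, n)) * pair (dil hw.u (j - 2, n)) (lowpass j x)) := by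
  have hs := hw.hasSum_pair_mul_pair F (lowpass j x)
  set G : ℤ → ℂ := fun k => ∑' n, pair F (dil hw.u (k, n)) * pair (dil hw.u (k, n)) (lowpass j x)
    with hG
  have hsum : Summable G := hs.summable.prod
  have htot : ∑' k, G k = pair (negProj F) (lowpass j x) := by
    rw [← hs.tsum_eq, hs.summable.tsum_prod]
  -- The filter reproduces scales `k ≥ j` and kills `k ≤ j - 3`; only `j - 1` and `j - 2` fall in
  -- its transition band.
  have hge : ∀ k, j ≤ k → G k = deltaU w k F x := by
    intro k hk
    rw [hw.deltaU_eq]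
    exact tsum_congr fun n => by rw [hw.pair_dil_u_lowpass_eq hk]
  have hlt : ∀ k, k + 3 ≤ j → G k = 0 := by
    intro k hk
    simp only [hG, hw.pair_dil_u_lowpass_eq_zero hk, mul_zero, tsum_zero]
  have hsplit := hsum.tsum_subtype_add_tsum_subtype_compl {k : ℤ | j ≤ k}
  have h1 : ∑' k : {k : ℤ | j ≤ k}, G k = opU w j F x :=
    tsum_congr fun k => hge k.1 k.2
  have h2 : ∑' k : ({k : ℤ | j ≤ k}ᶜ : Set ℤ), G k = G (j - 1) + G (j - 2) := by
    rw [tsum_subtype, tsum_eq_sum (s := {j - 1, j - 2}), Finset.sum_pair (by lia),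
      Set.indicator_of_mem (by simp), Set.indicator_of_mem (by simp)]
    intro k hk
    simp only [Finset.mem_insert, Finset.mem_singleton, not_or] at hk
    by_cases hjk : j ≤ k
    · exact Set.indicator_of_notMem (by simpa using hjk) _
    · rw [Set.indicator_of_mem (by simpa using hjk), hlt k (by lia)]
  rw [h1, h2, htot] at hsplit
  rw [← hsplit]
  ring

lemma exists_pair_lowpass_bound (i : ℕ) : ∃ C : ℝ≥0, ∀ (j n : ℤ) (x : ℝ),
    ‖pair (dil hw.u (j + i, n)) (lowpass (j + 4) x)‖ₑ
      ≤ C * isq j * wt 3 (2 ^ i * n - idx j x) := by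
  obtain ⟨A, hA⟩ := exists_lowpass_bound 5 4
  obtain ⟨B, hB⟩ := exists_dil_bound hw.u 3 i
  refine ⟨A * B * (wtSum 2).toNNReal, fun j n x => ?_⟩
  rw [enorm_pair_comm]
  refine (enorm_pair_le (p := 3) (hA j x) (hB j n)).trans (le_of_eq ?_)
  push_cast
  rw [ENNReal.coe_toNNReal (wtSum_ne_top le_rfl), wt_sub_comm]
  calc _ = A * B * (isq j ^ 2 * vol j) * isq j * wtSum 2 * wt 3 (2 ^ i * n - idx j x) := by ring
    _ = _ := by rw [isq_sq_mul_vol]; ring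

lemma exists_tsum_lowpass_bound (i : ℕ) : ∃ C : ℝ≥0, ∀ φ : ℝ → ℂ, ∃ d : ℤ → ℤ → ℝ≥0∞,
    (∀ j, ∑' m, d j m ^ 2 ≤ C * ∑' n, ‖pair φ (dil hw.u (j + i, n))‖ₑ ^ 2) ∧
    ∀ j x, ‖∑' n, pair φ (dil hw.u (j + i, n)) *
        pair (dil hw.u (j + i, n)) (lowpass (j + 4) x)‖ₑ ≤ isq j * d j (idx j x) := by
  obtain ⟨A, hA⟩ := hw.exists_pair_lowpass_bound i
  refine ⟨A ^ 2 * (wtSum 3).toNNReal ^ 2, fun φ =>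
    ⟨fun j m => A * ∑' n, wt 3 (2 ^ i * n - m) * ‖pair φ (dil hw.u (j + i, n))‖ₑ,
      fun j => ?_, fun j x => ?_⟩⟩
  · push_cast
    rw [ENNReal.coe_toNNReal (wtSum_ne_top (by norm_num))]
    exact tsum_sq_average_le i _ A
  · refine enorm_tsum_le_tsum_enorm.trans ?_
    beta_reduce
    rw [← ENNReal.tsum_mul_left, ← ENNReal.tsum_mul_left]
    refine ENNReal.tsum_le_tsum fun n => ?_
    rw [enorm_mul]
    calc _ ≤ ‖pair φ (dil hw.u (j + i, n))‖ₑ * (A * isq j * wt 3 (2 ^ i * n - idx j x)) := by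
          gcongr; exact hA j n x
      _ = _ := by ring

omit hw in
lemma exists_enorm_pair_lowpass_le : ∃ C : ℝ≥0, ∀ (G : Lp ℂ 2 (volume : Measure ℝ)) (j : ℤ) (x : ℝ),
    ‖pair G (lowpass (j + 4) x)‖ₑ
      ≤ C * ∑' t, wt 3 t * avg (fun y => ‖G y‖ₑ) j (idx j x + t) := by
  obtain ⟨A, hA⟩ := exists_lowpass_bound 3 4
  refine ⟨A, fun G j x => ?_⟩
  calc ‖pair G (lowpass (j + 4) x)‖ₑ
      ≤ ∫⁻ y, ‖G y * conj (lowpass (j + 4) x y)‖ₑ := enorm_integral_le_lintegral_enorm _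
    _ ≤ ∫⁻ y, (A * isq j ^ 2 * wt 3 (idx j x - idx j y)) * ‖G y‖ₑ := by
        refine lintegral_mono fun y => ?_
        have hc : ‖conj (lowpass (j + 4) x y)‖ₑ = ‖lowpass (j + 4) x y‖ₑ := by
          rw [← ofReal_norm, RCLike.norm_conj, ofReal_norm]
        rw [enorm_mul, hc, mul_comm]
        gcongr
        exact hA j x y
    _ = ∑' m, (A * isq j ^ 2 * wt 3 (idx j x - m)) * (vol j * avg (fun y => ‖G y‖ₑ) j m) :=
        lintegral_step_mul j (fun m => A * isq j ^ 2 * wt 3 (idx j x - m))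
          (Lp.aestronglyMeasurable G).enorm
    _ = ∑' m, A * (wt 3 (m - idx j x) * avg (fun y => ‖G y‖ₑ) j m) := by
        refine tsum_congr fun m => ?_
        rw [wt_sub_comm]
        calc _ = (isq j ^ 2 * vol j) * (A * (wt 3 (m - idx j x) * avg (fun y => ‖G y‖ₑ) j m)) := by
              ring
          _ = _ := by rw [isq_sq_mul_vol, one_mul]
    _ = _ := by
        rw [ENNReal.tsum_mul_left, ← (Equiv.subRight (idx j x)).tsum_eq
          (fun t => wt 3 t * avg (fun y => ‖G y‖ₑ) j (idx j x + t))]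
        simp

/-- Everything is measured on the grid of `ΔU_j b`, four scales finer than the filter; the boundary
scales of `U_{j+4}` are `j + 3` and `j + 2`. -/
lemma exists_opU_bound : ∃ C C' : ℝ≥0, ∀ F : Lp ℂ 2 (volume : Measure ℝ), ∃ d : ℤ → ℤ → ℝ≥0∞,
    (∀ j, ∑' m, d j m ^ 2 ≤ C' * (∑' n, ‖pair F (dil hw.u (j + 3, n))‖ₑ ^ 2
      + ∑' n, ‖pair F (dil hw.u (j + 2, n))‖ₑ ^ 2)) ∧
    ∀ j x, ‖opU w (j + 4) F x‖ₑ
      ≤ C * ∑' t, wt 3 t * avg (fun y => ‖negProj F y‖ₑ) j (idx j x + t)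
        + isq j * d j (idx j x) := by
  obtain ⟨C, hC⟩ := exists_enorm_pair_lowpass_le
  obtain ⟨A, hA⟩ := hw.exists_tsum_lowpass_bound 3
  obtain ⟨B, hB⟩ := hw.exists_tsum_lowpass_bound 2
  refine ⟨C, 2 * (A + B), fun F => ?_⟩
  obtain ⟨d₁, h1, h1'⟩ := hA F
  obtain ⟨d₂, h2, h2'⟩ := hB F
  refine ⟨fun j m => d₁ j m + d₂ j m, fun j => ?_, fun j x => ?_⟩
  · calc ∑' m, (d₁ j m + d₂ j m) ^ 2 ≤ ∑' m, 2 * (d₁ j m ^ 2 + d₂ j m ^ 2) :=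
          ENNReal.tsum_le_tsum fun m => add_sq_le_two_mul _ _
      _ = 2 * (∑' m, d₁ j m ^ 2 + ∑' m, d₂ j m ^ 2) := by
          rw [ENNReal.tsum_mul_left, ENNReal.tsum_add]
      _ ≤ 2 * (A * ∑' n, ‖pair F (dil hw.u (j + 3, n))‖ₑ ^ 2
            + B * ∑' n, ‖pair F (dil hw.u (j + 2, n))‖ₑ ^ 2) := by
          gcongr
          · exact h1 j
          · exact h2 j
      _ ≤ 2 * ((A + B) * ∑' n, ‖pair F (dil hw.u (j + 3, n))‖ₑ ^ 2
            + (A + B) * ∑' n, ‖pair F (dil hw.u (j + 2, n))‖ₑ ^ 2) := by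
          gcongr
          · exact le_self_add
          · exact le_add_self
      _ = _ := by push_cast; ring
  · rw [hw.opU_eq_lowpass]
    refine (enorm_sub_le).trans (add_le_add (hC _ _ _) ?_)
    refine (enorm_add_le _ _).trans ?_
    rw [mul_add]
    have e3 : j + 4 - 1 = j + (3 : ℕ) := by push_cast; ring
    have e2 : j + 4 - 2 = j + (2 : ℕ) := by push_cast; ring
    rw [e3, e2]
    exact add_le_add (h1' j x) (h2' j x)

end IsMeyerWavelet

/-! ### Almost orthogonality of the separated frequencies -/

/-- Intended for `ΔU_j b`, which is bounded but need not be in `L²`: a uniform absolute bound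
against an integrable `G` allows termwise integration. -/
lemma integral_tsum_mul_eq_zero {β : ℤ → ℂ} {f : ℤ → ℝ → ℂ} {G : ℝ → ℂ} {M : ℝ≥0}
    (hf : ∀ n, Measurable (f n)) (hM : ∀ x, ∑' n, ‖β n * f n x‖ₑ ≤ M) (hG : Integrable G)
    (h : ∀ n, ∫ x, f n x * G x = 0) : ∫ x, (∑' n, β n * f n x) * G x = 0 := by
  have hs : ∀ x, Summable fun n => β n * f n x := fun x =>
    summable_of_tsum_enorm_ne_top (ne_top_of_le_ne_top ENNReal.coe_ne_top (hM x))
  have hm : ∀ n, AEStronglyMeasurable fun x => β n * f n x * G x := fun n =>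
    ((hf n).const_mul _).aestronglyMeasurable.mul hG.1
  have hfin : ∑' n, ∫⁻ x, ‖β n * f n x * G x‖ₑ ≠ ∞ := by
    rw [← lintegral_tsum fun n => (hm n).enorm]
    refine ne_top_of_le_ne_top (ENNReal.mul_ne_top (ENNReal.coe_ne_top (r := M)) hG.2.ne) ?_
    rw [← lintegral_const_mul' _ _ ENNReal.coe_ne_top]
    refine lintegral_mono fun x => ?_
    simp_rw [enorm_mul _ (G x)]
    rw [ENNReal.tsum_mul_right]
    gcongr
    exact hM x
  calc ∫ x, (∑' n, β n * f n x) * G x = ∫ x, ∑' n, β n * f n x * G x :=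
        integral_congr_ae (.of_forall fun x => (hs x).tsum_mul_right (G x) |>.symm)
    _ = ∑' n, ∫ x, β n * f n x * G x :=
        integral_tsum hm hfin
    _ = 0 := by
        simp_rw [mul_assoc, integral_const_mul, h, mul_zero, tsum_zero]

/-- The partial sums of `∑ T_j` are square-bounded by an additive quantity of total mass `M`. -/
def SquareBounded (T : ℤ → ℝ → ℂ) (M : ℝ≥0∞) : Prop :=
  ∃ (hm : ∀ j, MemLp (T j) 2 (volume : Measure ℝ)) (c : ℤ → ℝ≥0∞), ∑' j, c j ≤ M ∧
    ∀ s : Finset ℤ, ‖∑ j ∈ s, (hm j).toLp (T j)‖ₑ ^ 2 ≤ ∑ j ∈ s, c j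

lemma SquareBounded.add {T T' : ℤ → ℝ → ℂ} {M M' : ℝ≥0∞} (h : SquareBounded T M)
    (h' : SquareBounded T' M') : SquareBounded (fun j => T j + T' j) (2 * (M + M')) := by
  obtain ⟨hm, c, hc, hs⟩ := h
  obtain ⟨hm', c', hc', hs'⟩ := h'
  refine ⟨fun j => (hm j).add (hm' j), fun j => 2 * (c j + c' j), ?_, fun s => ?_⟩
  · rw [ENNReal.tsum_mul_left, ENNReal.tsum_add]
    gcongr
  · have e : ∀ j, ((hm j).add (hm' j)).toLp (T j + T' j) = (hm j).toLp (T j) + (hm' j).toLp (T' j) :=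
      fun j => MemLp.toLp_add _ _
    rw [Finset.sum_congr rfl fun j _ => e j, Finset.sum_add_distrib, ← Finset.mul_sum, Finset.sum_add_distrib]
    refine (pow_le_pow_left' (enorm_add_le _ _) 2).trans ((add_sq_le_two_mul _ _).trans ?_)
    gcongr
    · exact hs s
    · exact hs' s

lemma memLp_two_of_lintegral_sq {f : ℝ → ℂ} (hf : AEStronglyMeasurable f)
    (h : ∫⁻ x, ‖f x‖ₑ ^ 2 ≠ ∞) : MemLp f 2 := by
  refine ⟨hf, lt_top_iff_ne_top.2 fun h' => h ?_⟩
  rw [← eLpNorm_two_sq, h']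
  simp

lemma enorm_toLp_sq {f : ℝ → ℂ} (hf : MemLp f 2) : ‖hf.toLp f‖ₑ ^ 2 = ∫⁻ x, ‖f x‖ₑ ^ 2 := by
  rw [Lp.enorm_toLp, eLpNorm_two_sq]

lemma enorm_conj (z : ℂ) : ‖conj z‖ₑ = ‖z‖ₑ := by
  rw [← ofReal_norm, RCLike.norm_conj, ofReal_norm]

namespace IsMeyerWavelet
variable {w : 𝓢(ℝ, ℂ)} (hw : IsMeyerWavelet w)
include hw

lemma tsum_enorm_pair_shift_sq_le (F : Lp ℂ 2 (volume : Measure ℝ)) (i : ℤ) :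
    ∑' j : ℤ, ∑' n : ℤ, ‖pair F (dil hw.u (j + i, n))‖ₑ ^ 2 ≤ ‖F‖ₑ ^ 2 := by
  refine le_of_eq_of_le ?_ (hw.tsum_enorm_pair_sq_le F)
  rw [ENNReal.tsum_prod']
  exact (Equiv.addRight i).tsum_eq fun j => ∑' n : ℤ, ‖pair F (dil hw.u (j, n))‖ₑ ^ 2

lemma exists_tsum_bmo_le {b : ℝ → ℂ} (hb : MemBMO w b) (j : ℤ) : ∃ M : ℝ≥0, ∀ x,
    ∑' n, ‖pair b (dil hw.u (j, n)) * dil hw.u (j, n) x‖ₑ ≤ M := by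
  obtain ⟨C, hC⟩ := hw.exists_tsum_bmo_bound
  obtain ⟨a, ha, hle⟩ := hC b hb
  have h1 := hb.norm_lt_top.ne
  set K : ℝ≥0∞ := C * bmoNorm w b ^ 2
  have hK : K ≠ ∞ := by finiteness
  -- The square of the sum is at most `K ≤ (1 + K)²`, which avoids a square root.
  refine ⟨(1 + K).toNNReal, fun x => (hle j x).trans ?_⟩
  rw [ENNReal.coe_toNNReal (by finiteness), ← ENNReal.pow_le_pow_left_iff two_ne_zero]
  calc (isq j * a j (idx j x)) ^ 2 = isq j ^ 2 * a j (idx j x) ^ 2 := by ring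
    _ ≤ isq j ^ 2 * (K * vol j) := by gcongr; exact ha.apply_le _ _
    _ = isq j ^ 2 * vol j * K := by ring
    _ = K := by rw [isq_sq_mul_vol, one_mul]
    _ ≤ K + (1 + K + K ^ 2) := le_self_add
    _ = _ := by ring

lemma memLp_top_conj_deltaU {b : ℝ → ℂ} (hb : MemBMO w b) (j : ℤ) :
    MemLp (fun x => conj (deltaU w j b x)) ∞ (volume : Measure ℝ) := by
  obtain ⟨M, hM⟩ := hw.exists_tsum_bmo_le hb j
  refine memLp_top_of_bound
    (RCLike.continuous_conj.measurable.comp (hw.measurable_deltaU_bmo hb j)).aestronglyMeasurable M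
    (.of_forall fun x => ?_)
  rw [RCLike.norm_conj, hw.deltaU_eq]
  exact_mod_cast enorm_le_coe.1 (enorm_tsum_le_tsum_enorm.trans (hM x))

lemma exists_hasSum_opU (F : Lp ℂ 2 (volume : Measure ℝ)) (j : ℤ) :
    ∃ V : Lp ℂ 2 (volume : Measure ℝ), V =ᵐ[volume] opU w j F ∧
      HasSum (fun p : ℕ × ℤ => pair F (dil hw.u (j + p.1, p.2)) •
        (dilS hw.u (j + p.1, p.2)).toLp 2) V := by
  have hinj : Function.Injective fun p : ℕ × ℤ => ((j + p.1, p.2) : Dyadic) := by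
    rintro ⟨p, m⟩ ⟨q, n⟩ h
    simpa using h
  have hs := ((hw.hasSum_negProj F).summable.comp_injective hinj).hasSum
  refine ⟨_, ae_eq_of_hasSum hs
    (f := fun p x => pair F (dil hw.u (j + p.1, p.2)) * dil hw.u (j + p.1, p.2) x)
    (fun p => ?_) (.of_forall fun x => ?_), hs⟩
  · filter_upwards [Lp.coeFn_smul (pair F (dil hw.u (j + p.1, p.2)))
      ((dilS hw.u (j + p.1, p.2)).toLp 2), (dilS hw.u (j + p.1, p.2)).coeFn_toLp 2] with x h1 h2
    simp only [Function.comp_apply]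
    rw [h1, Pi.smul_apply, h2, smul_eq_mul, coe_dilS]
  · rw [hw.opU_eq_tsum_prod]
    exact (hw.summable_scales F j x).hasSum

/-- In units of `2^{-j}`: `t < -1/3` and `s' < 0` give `t + s' < -1/3`, while `t' > -1/6` and `s >
-1/12` give `t' + s > -1/4`. -/
lemma pair_dil_u_mul_eq_zero {j k : ℤ} (hjk : j + 3 ≤ k) {I J : Dyadic} (hI : j + 4 ≤ I.1)
    (hJ : k + 4 ≤ J.1) (m n : ℤ) :
    pair (fun x => dil hw.u (j, m) x * conj (dil hw.u I x))
      (fun x => dil hw.u (k, n) x * conj (dil hw.u J x)) = 0 := by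
  simp only [← coe_dilS]
  refine integral_mul_conj_eq_zero fun t s t' s' h ht hs ht' hs' => ?_
  have h1 := hw.fourier_dilS_u_supp ht
  have h2 := hw.fourier_dilS_u_supp (k := I.1) (n := I.2) hs
  have h3 := hw.fourier_dilS_u_supp ht'
  have h4 := hw.fourier_dilS_u_supp (k := J.1) (n := J.2) hs'
  have hj : (0 : ℝ) < 2 ^ j := by positivity
  have key : ∀ {l : ℤ} {i : ℕ} {ξ : ℝ}, j + i ≤ l → -(4 / 3) < 2 ^ l * ξ → 2 ^ l * ξ < -(1 / 3) →
      -(4 / 3) < 2 ^ i * (2 ^ j * ξ) ∧ 2 ^ j * ξ < 0 := by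
    intro l i ξ hl ha hb
    have hl0 : (0 : ℝ) < 2 ^ l := by positivity
    have hξ : ξ < 0 := by
      by_contra hcon
      push Not at hcon
      nlinarith [mul_nonneg hl0.le hcon]
    have hle : (2 : ℝ) ^ i * 2 ^ j ≤ 2 ^ l := by
      calc (2 : ℝ) ^ i * 2 ^ j = 2 ^ (j + i) := by
            rw [zpow_add₀ (by norm_num), zpow_natCast, mul_comm]
        _ ≤ _ := zpow_le_zpow_right₀ (by norm_num) hl
    refine ⟨?_, mul_neg_of_pos_of_neg hj hξ⟩
    nlinarith
  have e2 := key (i := 4) (by exact_mod_cast hI) h2.1 h2.2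
  have e3 := key (i := 3) (by exact_mod_cast hjk) h3.1 h3.2
  have e4 := key (i := 4) (by push_cast; lia) h4.1 h4.2
  have e : 2 ^ j * t + 2 ^ j * s' = 2 ^ j * t' + 2 ^ j * s := by rw [← mul_add, h, mul_add]
  norm_num at e2 e3 e4
  linarith [h1.2, e2.1, e3.1, e4.2]

lemma integral_deltaU_mul_eq_zero {b : ℝ → ℂ} (hb : MemBMO w b) {j k : ℤ} (hjk : j + 3 ≤ k)
    {I J : Dyadic} (hI : j + 4 ≤ I.1) (hJ : k + 4 ≤ J.1) :
    ∫ x, deltaU w k b x * (conj (dil hw.u J x) * conj (deltaU w j b x) * dil hw.u I x) = 0 := by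
  obtain ⟨M, hM⟩ := hw.exists_tsum_bmo_le hb j
  obtain ⟨M', hM'⟩ := hw.exists_tsum_bmo_le hb k
  have hmul : ∀ I J : Dyadic, Integrable fun x => dil hw.u I x * conj (dil hw.u J x) := fun I J =>
    ((dilS hw.u I).memLp 2).integrable_mul ((dilS hw.u J).memLp 2).star
  have hbdd := hw.memLp_top_conj_deltaU hb j
  simp only [hw.deltaU_eq k]
  refine integral_tsum_mul_eq_zero (fun n => (hw.continuous_dil_u _).measurable) hM' ?_ fun n => ?_
  · refine ((hmul I J).mul_of_top_left hbdd).congr (.of_forall fun x => ?_)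
    simp only [Pi.mul_apply]
    ring
  · have h0 : ∫ x, deltaU w j b x *
        (dil hw.u J x * conj (dil hw.u I x) * conj (dil hw.u (k, n) x)) = 0 := by
      simp only [hw.deltaU_eq j]
      refine integral_tsum_mul_eq_zero (fun n => (hw.continuous_dil_u _).measurable) hM ?_
        fun m => ?_
      · refine (hmul J I).mul_of_top_left ?_
        exact ((dilS hw.u (k, n)).memLp ∞).star
      · rw [← hw.pair_dil_u_mul_eq_zero hjk hI hJ m n]
        refine integral_congr_ae (.of_forall fun x => ?_)
        simp only [map_mul, Complex.conj_conj]
        ring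
    have h1 := congrArg conj h0
    rw [← integral_conj, map_zero] at h1
    rw [← h1]
    refine integral_congr_ae (.of_forall fun x => ?_)
    simp only [map_mul, Complex.conj_conj]
    ring

/-- Multiplication by the bounded function `conj (ΔU b)` is continuous on `L²`, so orthogonality for
single `u_I`, `u_J` extends to the `L²` expansions of both `U` factors. -/
lemma pair_deltaU_mul_opU_eq_zero {b : ℝ → ℂ} (hb : MemBMO w b) (F : Lp ℂ 2 (volume : Measure ℝ))
    {j k : ℤ} (hjk : j + 3 ≤ k) :
    pair (fun x => deltaU w k b x * conj (opU w (k + 4) F x))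
      (fun x => deltaU w j b x * conj (opU w (j + 4) F x)) = 0 := by
  obtain ⟨V, hV, hVs⟩ := hw.exists_hasSum_opU F (j + 4)
  obtain ⟨W, hW, hWs⟩ := hw.exists_hasSum_opU F (k + 4)
  set P := mulCLM (hw.memLp_top_conj_deltaU hb j)
  set Q := mulCLM (hw.memLp_top_conj_deltaU hb k)
  have h0 : ∀ p q : ℕ × ℤ, inner ℂ (Q ((dilS hw.u (k + 4 + p.1, p.2)).toLp 2))
      (P ((dilS hw.u (j + 4 + q.1, q.2)).toLp 2)) = 0 := by
    intro p q
    rw [← hw.integral_deltaU_mul_eq_zero hb hjk (I := (j + 4 + q.1, q.2))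
      (J := (k + 4 + p.1, p.2)) (by simp) (by simp), L2.inner_def]
    refine integral_congr_ae ?_
    filter_upwards [coeFn_mulCLM (hw.memLp_top_conj_deltaU hb j)
      ((dilS hw.u (j + 4 + q.1, q.2)).toLp 2), coeFn_mulCLM (hw.memLp_top_conj_deltaU hb k)
      ((dilS hw.u (k + 4 + p.1, p.2)).toLp 2), (dilS hw.u (j + 4 + q.1, q.2)).coeFn_toLp 2,
      (dilS hw.u (k + 4 + p.1, p.2)).coeFn_toLp 2] with x h1 h2 h3 h4
    rw [h1, h2, h3, h4, RCLike.inner_apply, coe_dilS, coe_dilS]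
    simp only [map_mul, Complex.conj_conj]
    ring
  have h1 : ∀ p : ℕ × ℤ, inner ℂ (Q ((dilS hw.u (k + 4 + p.1, p.2)).toLp 2)) (P V) = 0 := by
    intro p
    have h := (hVs.mapL P).mapL (innerSL ℂ (Q ((dilS hw.u (k + 4 + p.1, p.2)).toLp 2)))
    simp only [map_smul, innerSL_apply_apply, h0, smul_zero] at h
    exact h.unique hasSum_zero
  have h2 : inner ℂ (P V) (Q W) = 0 := by
    have h := (hWs.mapL Q).mapL (innerSL ℂ (P V))
    simp only [map_smul, innerSL_apply_apply, inner_eq_zero_symm.1 (h1 _), smul_zero] at h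
    exact h.unique hasSum_zero
  rw [inner_eq_zero_symm, L2.inner_def] at h2
  rw [← h2]
  refine integral_congr_ae ?_
  filter_upwards [coeFn_mulCLM (hw.memLp_top_conj_deltaU hb j) V,
    coeFn_mulCLM (hw.memLp_top_conj_deltaU hb k) W, hV, hW] with x e1 e2 e3 e4
  rw [e1, e2, e3, e4, RCLike.inner_apply]
  simp only [map_mul, Complex.conj_conj]
  ring

/-! ### The paraproduct -/

lemma exists_squareBounded_diagonal (i : ℕ) : ∃ C : ℝ≥0, ∀ (b : ℝ → ℂ)
    (F : Lp ℂ 2 (volume : Measure ℝ)), MemBMO w b →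
    SquareBounded (fun j x => deltaU w j b x * conj (deltaU w (j + i) F x))
      (C * (bmoNorm w b ^ 2 * ‖F‖ₑ ^ 2)) := by
  obtain ⟨A, hA⟩ := hw.exists_tsum_bmo_bound
  obtain ⟨B, hB⟩ := hw.exists_tsum_bound i
  refine ⟨4 * A * B, fun b F hb => ?_⟩
  obtain ⟨a, ha, hale⟩ := hA b hb
  obtain ⟨d, hd, hdle⟩ := hB F
  have hb1 := hb.norm_lt_top.ne
  have hK : (A * bmoNorm w b ^ 2 : ℝ≥0∞) ≠ ∞ := by finiteness
  have hsum : ∑' j, ∑' m, d j m ^ 2 ≤ B * ‖F‖ₑ ^ 2 := by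
    refine (ENNReal.tsum_le_tsum hd).trans ?_
    rw [ENNReal.tsum_mul_left]
    gcongr
    exact hw.tsum_enorm_pair_shift_sq_le F i
  have hle : ∀ j x, ‖deltaU w j b x * conj (deltaU w (j + i) F x)‖ₑ
      ≤ isq j ^ 2 * (a j (idx j x) * d j (idx j x)) := by
    intro j x
    rw [enorm_mul, enorm_conj, hw.deltaU_eq, hw.deltaU_eq]
    calc _ ≤ (isq j * a j (idx j x)) * (isq j * d j (idx j x)) :=
          mul_le_mul' (enorm_tsum_le_tsum_enorm.trans (hale j x))
            (enorm_tsum_le_tsum_enorm.trans (hdle j x))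
      _ = _ := by ring
  have hm : ∀ j, MemLp (fun x => deltaU w j b x * conj (deltaU w (j + i) F x)) 2 := fun j => by
    refine memLp_two_of_lintegral_sq ((hw.measurable_deltaU_bmo hb j).mul
      (RCLike.continuous_conj.measurable.comp (hw.measurable_deltaU F _))).aestronglyMeasurable ?_
    refine ne_top_of_le_ne_top ?_ (ha.lintegral_sq_le (hle j))
    refine ENNReal.mul_ne_top hK (ne_top_of_le_ne_top ?_ ((ENNReal.le_tsum j).trans hsum))
    finiteness
  refine ⟨hm, fun j => 4 * (A * bmoNorm w b ^ 2) * ∑' m, d j m ^ 2, ?_, fun s => ?_⟩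
  · rw [ENNReal.tsum_mul_left]
    refine (mul_le_mul' le_rfl hsum).trans (le_of_eq ?_)
    push_cast
    ring
  · rw [← Finset.mul_sum]
    refine ha.sq_enorm_sum_le hK (fun j => ?_) s
    filter_upwards [(hm j).coeFn_toLp] with x hx
    rw [hx]
    exact hle j x

lemma exists_squareBounded_separated : ∃ C : ℝ≥0, ∀ (b : ℝ → ℂ)
    (F : Lp ℂ 2 (volume : Measure ℝ)), MemBMO w b →
    SquareBounded (fun j x => deltaU w j b x * conj (opU w (j + 4) F x))
      (C * (bmoNorm w b ^ 2 * ‖F‖ₑ ^ 2)) := by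
  obtain ⟨A, hA⟩ := hw.exists_tsum_bmo_bound
  obtain ⟨B, B', hB⟩ := hw.exists_opU_bound
  refine ⟨5 * (2 * (B ^ 2 * (wtSum 3).toNNReal * (8 * (wtSum 2).toNNReal * A))
    + 2 * (A * (B' * 2))), fun b F hb => ?_⟩
  obtain ⟨a, ha, hale⟩ := hA b hb
  obtain ⟨d, hd, hdle⟩ := hB F
  have hb1 := hb.norm_lt_top.ne
  have hK : (A * bmoNorm w b ^ 2 : ℝ≥0∞) ≠ ∞ := by finiteness
  have hsum : ∑' j, ∑' m, d j m ^ 2 ≤ B' * (2 * ‖F‖ₑ ^ 2) := by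
    refine (ENNReal.tsum_le_tsum hd).trans ?_
    rw [ENNReal.tsum_mul_left, ENNReal.tsum_add, two_mul]
    gcongr
    · exact hw.tsum_enorm_pair_shift_sq_le F 3
    · exact hw.tsum_enorm_pair_shift_sq_le F 2
  have hN : ∫⁻ y, ‖negProj F y‖ₑ ^ 2 ≤ ‖F‖ₑ ^ 2 := by
    rw [← enorm_sq_eq_lintegral]
    gcongr
    exact enorm_le_iff_norm_le.2 (norm_negProj_le F)
  have hle : ∀ j x, ‖deltaU w j b x * conj (opU w (j + 4) F x)‖ₑ ≤ isq j * a j (idx j x) *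
      (B * ∑' t, wt 3 t * avg (fun y => ‖negProj F y‖ₑ) j (idx j x + t)
        + isq j * d j (idx j x)) := by
    intro j x
    rw [enorm_mul, enorm_conj, hw.deltaU_eq]
    exact mul_le_mul' (enorm_tsum_le_tsum_enorm.trans (hale j x)) (hdle j x)
  have htot := ha.tsum_lintegral_sq_le hK (Lp.aestronglyMeasurable (negProj F)).enorm
    (ne_top_of_le_ne_top (by finiteness) hN) B hle
  have hbound : ∑' j, ∫⁻ x, ‖deltaU w j b x * conj (opU w (j + 4) F x)‖ₑ ^ 2
      ≤ 2 * (B ^ 2 * wtSum 3 * (8 * wtSum 2 * (A * bmoNorm w b ^ 2)) * ‖F‖ₑ ^ 2)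
        + 2 * (A * bmoNorm w b ^ 2 * (B' * (2 * ‖F‖ₑ ^ 2))) := by
    refine htot.trans ?_
    gcongr
  have hw3 : wtSum 3 ≠ ∞ := wtSum_ne_top (by norm_num)
  have hw2 : wtSum 2 ≠ ∞ := wtSum_ne_top le_rfl
  have hm : ∀ j, MemLp (fun x => deltaU w j b x * conj (opU w (j + 4) F x)) 2 := fun j => by
    refine memLp_two_of_lintegral_sq ((hw.measurable_deltaU_bmo hb j).mul
      (RCLike.continuous_conj.measurable.comp (hw.measurable_opU F _))).aestronglyMeasurable ?_
    refine ne_top_of_le_ne_top ?_ ((ENNReal.le_tsum j).trans hbound)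
    finiteness
  refine ⟨hm, fun j => 5 * ∫⁻ x, ‖deltaU w j b x * conj (opU w (j + 4) F x)‖ₑ ^ 2, ?_, fun s => ?_⟩
  · rw [ENNReal.tsum_mul_left]
    refine (mul_le_mul' le_rfl hbound).trans (le_of_eq ?_)
    push_cast
    rw [ENNReal.coe_toNNReal hw2, ENNReal.coe_toNNReal hw3]
    ring
  · have horth : ∀ j k : ℤ, j + 3 ≤ k → inner ℂ ((hm j).toLp _) ((hm k).toLp _) = 0 :=
      fun j k hjk => by rw [inner_toLp_eq_pair, hw.pair_deltaU_mul_opU_eq_zero hb F hjk]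
    have h := sq_norm_sum_le_of_almost_orthogonal horth s
    simp_rw [← enorm_toLp_sq (hm _), ← ofReal_norm]
    rw [← ENNReal.ofReal_pow (norm_nonneg _)]
    simp_rw [← ENNReal.ofReal_pow (norm_nonneg _)]
    rw [← Finset.mul_sum, ← ENNReal.ofReal_sum_of_nonneg fun _ _ => by positivity,
      show (5 : ℝ≥0∞) = ENNReal.ofReal 5 by simp, ← ENNReal.ofReal_mul (by norm_num)]
    exact ENNReal.ofReal_le_ofReal h

lemma exists_squareBounded_term : ∃ C : ℝ≥0, ∀ (b : ℝ → ℂ) (F : Lp ℂ 2 (volume : Measure ℝ)),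
    MemBMO w b → SquareBounded (term w b F) (C * (bmoNorm w b ^ 2 * ‖F‖ₑ ^ 2)) := by
  choose D hD using hw.exists_squareBounded_diagonal
  obtain ⟨S, hS⟩ := hw.exists_squareBounded_separated
  refine ⟨2 * (2 * (2 * (2 * (D 0 + D 1) + D 2) + D 3) + S), fun b F hb => ?_⟩
  have h := ((((hD 0 b F hb).add (hD 1 b F hb)).add (hD 2 b F hb)).add (hD 3 b F hb)).add
    (hS b F hb)
  convert! h using 1
  · funext j x
    simp only [term, hw.opU_eq_sum_add F j x, Fin.sum_univ_four, map_add, Pi.add_apply]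
    simp only [Fin.coe_ofNat_eq_mod]
    norm_num
    ring
  · push_cast
    ring

lemma exists_paraproduct_bound : ∃ C : ℝ≥0, ∀ (b : ℝ → ℂ) (F : Lp ℂ 2 (volume : Measure ℝ)),
    MemBMO w b → ∃ hm : ∀ j, MemLp (term w b F j) 2 (volume : Measure ℝ),
      Summable (fun j => (hm j).toLp (term w b F j)) ∧
      ‖∑' j, (hm j).toLp (term w b F j)‖ₑ ≤ C * bmoNorm w b * ‖F‖ₑ := by
  obtain ⟨C, hC⟩ := hw.exists_squareBounded_term
  refine ⟨C + 1, fun b F hb => ?_⟩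
  obtain ⟨hm, c, hc, hs⟩ := hC b F hb
  have hb1 := hb.norm_lt_top.ne
  obtain ⟨h1, h2⟩ := summable_of_sq_enorm_sum_le (ne_top_of_le_ne_top (by finiteness) hc) hs
  refine ⟨hm, h1, ?_⟩
  rw [← ENNReal.pow_le_pow_left_iff two_ne_zero]
  calc _ ≤ C * (bmoNorm w b ^ 2 * ‖F‖ₑ ^ 2) := h2.trans hc
    -- The bracket is `(C + 1)²`, so the squared bound is a perfect square.
    _ ≤ (C + (C ^ 2 + C + 1)) * (bmoNorm w b ^ 2 * ‖F‖ₑ ^ 2) := by gcongr; exact le_self_add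
    _ = _ := by push_cast; ring

end IsMeyerWavelet

end MeyerPara

end

/-! ### From `L²` classes to functions `φ` -/

theorem theoremt (w : SchwartzMap ℝ ℂ) (hw : MeyerPara.IsMeyerWavelet w) :
    ∃ C : ℝ≥0, ∀ b φ : ℝ → ℂ, MeyerPara.MemBMO w b → MemLp φ 2 (volume : Measure ℝ) →
      (∀ (j : ℤ) (x : ℝ), Summable (fun n : ℤ =>
        MeyerPara.pair b (MeyerPara.dil (MeyerPara.antianalytic w) (j, n)) *
          MeyerPara.dil (MeyerPara.antianalytic w) (j, n) x)) ∧
      (∀ (j : ℤ) (x : ℝ), Summable (fun n : ℤ =>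
        MeyerPara.pair φ (MeyerPara.dil (MeyerPara.antianalytic w) (j, n)) *
          MeyerPara.dil (MeyerPara.antianalytic w) (j, n) x)) ∧
      (∀ (j : ℤ) (x : ℝ), Summable (fun k : {k : ℤ // j ≤ k} => MeyerPara.deltaU w k φ x)) ∧
      ∃ hmem : ∀ j : ℤ, MemLp (MeyerPara.term w b φ j) 2 (volume : Measure ℝ),
        Summable (fun j : ℤ => (hmem j).toLp (MeyerPara.term w b φ j)) ∧
        ‖∑' j : ℤ, (hmem j).toLp (MeyerPara.term w b φ j)‖ₑ ≤
          (C : ℝ≥0∞) * MeyerPara.bmoNorm w b * eLpNorm φ 2 (volume : Measure ℝ) := by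
  obtain ⟨C, hC⟩ := hw.exists_paraproduct_bound
  refine ⟨C, fun b φ hb hφ => ?_⟩
  have he := hφ.coeFn_toLp
  have h := hC b (hφ.toLp φ) hb
  rw [MeyerPara.term_congr w b he, Lp.enorm_toLp] at h
  rw [← hw.coe_u]
  refine ⟨hw.summable_deltaU_bmo hb, fun j x => ?_, fun j x => ?_, h⟩
  · simpa only [MeyerPara.pair_congr he] using hw.summable_deltaU_terms (hφ.toLp φ) j x
  · have hs := hw.summable_deltaU (hφ.toLp φ) j x
    rwa [show (fun k : {k : ℤ // j ≤ k} => MeyerPara.deltaU w k (hφ.toLp φ) x)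
      = fun k : {k : ℤ // j ≤ k} => MeyerPara.deltaU w k φ x from
      funext fun k => congrFun (congrFun (MeyerPara.deltaU_congr w he) k) x] at hs
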